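/- Let $n\ge 2$ and let $f\colon[0,\infty)\to\mathbb R$ be smooth with $f''\ge 0$ and $0<m\le f'\le M$ for some constants $m,M$. For $R>0$ let $(x_R,r_R,\theta_R)$ be the solution, in the half plane $r>0$, of $$\dot x=\cos\theta,\qquad \dot r=\sin\theta,\qquad \dot\theta=\Big(\frac{n-1}{r}-\frac r2 f'(x^2+r^2)\Big)\cos\theta+\frac x2 f'(x^2+r^2)\sin\theta,$$ with $x(0)=0$, $r(0)=R$, $\theta(0)=0$, and let $t_1=t_1(R)$ be the first time $t>0$ at which $\theta_R(t)=0$, or $\theta_R(t)=-\pi$, or $x_R(t)=0$, or $r_R(t)=0$ (the solution being extended by continuity to a point where $r=0$). Then there is a least number $R^*>0$ such that for all $R>R^*$ one has $t_1(R)<\infty$ and $x_R(t_1(R))=0$. It satisfies $R^*\ge r_0$, where $r_0>0$ is the solution of $\frac{n-1}{r_0}-\frac{r_0}{2}f'(r_0^2)=0$. For $R=R^*$ one has $0<t_1<\infty$ and $$x_{R^*}(t_1)=0,\qquad \theta_{R^*}(t_1)=-\pi,\qquad r_{R^*}(t_1)>0 .$$ Moreover the solution with $R=R^*$ extends to a solution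 $(X,P,\Theta)$ on all of $\mathbb R$ with $P>0$, which satisfies $X(-t)=-X(t)$, $P(-t)=P(t)$, $\Theta(-t)=-\Theta(t)$ and $X(t+2t_1)=X(t)$, $P(t+2t_1)=P(t)$, $\Theta(t+2t_1)=\Theta(t)-2\pi$ for all $t$. The curve $t\mapsto(X(t),P(t))$ is injective on $[0,2t_1)$, and its trace is the union of the arc $\{(x_{R^*}(t),r_{R^*}(t)):0\le t\le t_1\}$ and its mirror image under $(x,r)\mapsto(-x,r)$. Thus it is a closed, embedded profile curve symmetric about the $r$-axis. -/

import Mathlib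

open scoped ContDiff

/-- The right-hand side of the equation for the angle `θ` in the arc-length profile system
`ẋ = cos θ`, `ṙ = sin θ`,
`θ̇ = ((n - 1) / r - (r / 2) f'(x² + r²)) cos θ + (x / 2) f'(x² + r²) sin θ`. -/
noncomputable def angleSpeed (n : ℕ) (f : ℝ → ℝ) (x r θ : ℝ) : ℝ :=
  (((n : ℝ) - 1) / r - r / 2 * deriv f (x ^ 2 + r ^ 2)) * Real.cos θ
    + x / 2 * deriv f (x ^ 2 + r ^ 2) * Real.sin θ

/-- `(x, r, θ)` solves the profile system on `[0, T)` with initial data `(0, R, 0)`, stays in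
the half plane `r > 0` there, and extends continuously to the endpoint `T` (where `r = 0` is
not excluded). -/
structure IsProfileSolution (n : ℕ) (f : ℝ → ℝ) (R T : ℝ) (x r θ : ℝ → ℝ) : Prop where
  x_zero : x 0 = 0
  r_zero : r 0 = R
  theta_zero : θ 0 = 0
  x_cont : ContinuousOn x (Set.Icc 0 T)
  r_cont : ContinuousOn r (Set.Icc 0 T)
  theta_cont : ContinuousOn θ (Set.Icc 0 T)
  r_pos : ∀ t ∈ Set.Ico 0 T, 0 < r t
  x_deriv : ∀ t ∈ Set.Ico 0 T, HasDerivWithinAt x (Real.cos (θ t)) (Set.Icc 0 T) t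
  r_deriv : ∀ t ∈ Set.Ico 0 T, HasDerivWithinAt r (Real.sin (θ t)) (Set.Icc 0 T) t
  theta_deriv : ∀ t ∈ Set.Ico 0 T,
    HasDerivWithinAt θ (angleSpeed n f (x t) (r t) (θ t)) (Set.Icc 0 T) t

/-- The event that stops the profile curve. -/
def StopsAt (x r θ : ℝ → ℝ) (t : ℝ) : Prop :=
  θ t = 0 ∨ θ t = -Real.pi ∨ x t = 0 ∨ r t = 0

/-- `(x, r, θ)` is the solution of the initial value problem with `r(0) = R`, and `t₁ > 0` is its
first stopping time. -/
structure IsStoppedProfile (n : ℕ) (f : ℝ → ℝ) (R t₁ : ℝ) (x r θ : ℝ → ℝ) : Prop where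
  pos : 0 < t₁
  sol : IsProfileSolution n f R t₁ x r θ
  not_before : ∀ t ∈ Set.Ioo 0 t₁, ¬ StopsAt x r θ t
  stops : StopsAt x r θ t₁

/-- `t₁(R) < ∞` and `x_R(t₁(R)) = 0`. -/
def StopsOnAxis (n : ℕ) (f : ℝ → ℝ) (R : ℝ) : Prop :=
  ∃ (t₁ : ℝ) (x r θ : ℝ → ℝ), IsStoppedProfile n f R t₁ x r θ ∧ x t₁ = 0

/-- `Rs` is the threshold: the least positive number such that for every `R > Rs` one has
`t₁(R) < ∞` and `x_R(t₁(R)) = 0`. -/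
def IsThreshold (n : ℕ) (f : ℝ → ℝ) (Rs : ℝ) : Prop :=
  IsLeast {ρ : ℝ | 0 < ρ ∧ ∀ R : ℝ, ρ < R → StopsOnAxis n f R} Rs

/-- `(X, P, Θ)` is a global solution of the profile system in the half plane `P > 0` which extends
the arc `(x, r, θ)` on `[0, t₁]`, and whose trace `(X, P)` is a closed, embedded curve (of length
`2 t₁`), symmetric under the reflection `(x, r) ↦ (-x, r)`: it is the union of the arc and of the
mirror image of the arc. -/
structure IsClosedEmbeddedReflection (n : ℕ) (f : ℝ → ℝ) (t₁ : ℝ) (x r θ X P Θ : ℝ → ℝ) :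
    Prop where
  extends_arc : ∀ t ∈ Set.Icc 0 t₁, X t = x t ∧ P t = r t ∧ Θ t = θ t
  pos : ∀ t, 0 < P t
  x_deriv : ∀ t, HasDerivAt X (Real.cos (Θ t)) t
  r_deriv : ∀ t, HasDerivAt P (Real.sin (Θ t)) t
  theta_deriv : ∀ t, HasDerivAt Θ (angleSpeed n f (X t) (P t) (Θ t)) t
  reflect : ∀ t, X (-t) = -X t ∧ P (-t) = P t ∧ Θ (-t) = -Θ t
  closed : ∀ t, X (t + 2 * t₁) = X t ∧ P (t + 2 * t₁) = P t ∧
    Θ (t + 2 * t₁) = Θ t - 2 * Real.pi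
  embedded : Set.InjOn (fun t => (X t, P t)) (Set.Ico 0 (2 * t₁))
  trace : Set.range (fun t => (X t, P t)) =
    (fun t => (x t, r t)) '' Set.Icc 0 t₁ ∪ (fun t => (-x t, r t)) '' Set.Icc 0 t₁

/-!
The profile curves are the geodesics of the half plane `r > 0` with the conformal factor
`weight = r ^ (n - 1) exp (-f (x² + r²) / 4)`. Along a curve, `SolvesAt.hasDerivAt_weight_mul_cos`,
`SolvesAt.hasDerivAt_weight_mul_sin` and `SolvesAt.hasDerivAt_weight_mul_supportPart` give the
balance of forces in the two coordinate directions and the balance of torques. The curve starting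
at height `R` is said to *return* if it comes back to the line `x = 0` after an arc in `x > 0` on
which `θ > -π` and the distance to the origin decreases (`Returns`, `IsReturningArc`). Such a curve
is stopped on the line `x = 0`. Let `ρ` be the radius of the spherical profile, given by
`ρ² f'(ρ²) = 2 n`, and let `R*` be the infimum of the `q ≥ ρ` such that all curves with `R > q`
return. This is the threshold.

* The infimum is over a nonempty set (`Admissible.exists_forall_returns`). For large `R`, the curve
  runs down along the `r`-axis: while the support function `r cos θ - x sin θ` is positive, it is
  of Gaussian smallness, so that the position vector hardly rotates (`IsEarlyArc.div_le`). By the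
  balance of torques, the support function vanishes before the curve gets close to the origin
  (`IsEarlyArc.sq_end_ne`). After that `cos θ < 0`, the tangent vector remains almost vertical
  (`IsLateArc.neg_cos_le`), and the horizontal balance of forces brings the curve back to the line
  `x = 0` at positive height (`IsLateArc.r_end_ne`).

* The curve with `R = R*` returns (`Admissible.exists_isReturningArc_of_forall_gt`). Returning arcs
  have length at most `4 R` (`IsInwardArc.length_le`) and stay away from the axis `r = 0`, locally
  uniformly in `R` (`Admissible.exists_pos_le_r`), hence they converge to an arc satisfying the
  same inequalities in the weak sense. All of them are strict (`IsInwardArc.isReturningArc`):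
  otherwise uniqueness identifies the curve with the line `x = 0` or with the spherical profile, or
  the vertical balance of forces is violated. This also shows that `R* > ρ`.

* A curve starting close to a returning one either returns or reaches the angle `-π` in `x > 0`,
  and then it is not stopped on the line `x = 0`. If the given curve ends with an angle larger than
  `-π`, then the second case does not occur (`IsReturningArc.exists_forall_returns_or`). Since `R*`
  is an infimum, its curve ends with the angle `-π`, and there are curves below and arbitrarily
  close to it that are not stopped on the line `x = 0` (`Admissible.exists_isThreshold`).

* The curve with `R = R*` meets the line `x = 0` perpendicularly at both ends, so it closes up under
  reflection, by uniqueness (`IsReturningArc.isClosedEmbeddedReflection`). It is embedded because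
  `r` is strictly decreasing on the arc.

To have solutions for all times and continuous dependence on `R`, the vector field is truncated
outside of a box in the half plane (`truncatedField`); all the arcs considered remain in a box.
-/

open Set Filter Topology

/-! ### Monotonicity of functions of one real variable -/

/-- Mean value inequality in the form used for all the differential inequalities below. -/
theorem le_of_forall_hasDerivAt_nonpos {φ φ' : ℝ → ℝ} {a b : ℝ} (hab : a ≤ b)
    (hd : ∀ t ∈ Icc a b, HasDerivAt φ (φ' t) t) (hle : ∀ t ∈ Ioo a b, φ' t ≤ 0) : φ b ≤ φ a := by
  refine antitoneOn_of_deriv_nonpos (convex_Icc a b)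
    (fun t ht => (hd t ht).continuousAt.continuousWithinAt) ?_ ?_
    (left_mem_Icc.2 hab) (right_mem_Icc.2 hab) hab
  · rw [interior_Icc]
    exact fun t ht => (hd t (Ioo_subset_Icc_self ht)).differentiableAt.differentiableWithinAt
  · rw [interior_Icc]
    intro t ht
    rw [(hd t (Ioo_subset_Icc_self ht)).deriv]
    exact hle t ht

theorem lt_of_forall_hasDerivAt_neg {φ φ' : ℝ → ℝ} {a b : ℝ} (hab : a < b)
    (hd : ∀ t ∈ Icc a b, HasDerivAt φ (φ' t) t) (hlt : ∀ t ∈ Ioo a b, φ' t < 0) : φ b < φ a := by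
  refine strictAntiOn_of_deriv_neg (convex_Icc a b)
    (fun t ht => (hd t ht).continuousAt.continuousWithinAt) ?_
    (left_mem_Icc.2 hab.le) (right_mem_Icc.2 hab.le) hab
  rw [interior_Icc]
  intro t ht
  rw [(hd t (Ioo_subset_Icc_self ht)).deriv]
  exact hlt t ht

/-- If `φ < 0` on `[a, b)` and `φ b = 0`, then `φ' b ≥ 0`. -/
theorem nonneg_of_hasDerivAt_of_neg_left {φ : ℝ → ℝ} {a b d : ℝ} (hab : a < b)
    (hd : HasDerivAt φ d b) (hb : φ b = 0) (hneg : ∀ t ∈ Ioo a b, φ t ≤ 0) : 0 ≤ d := by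
  by_contra hlt
  push Not at hlt
  have h1 := (hasDerivAt_iff_tendsto_slope_left_right.1 hd).1
  have h2 : ∀ᶠ t in 𝓝[<] b, slope φ b t < 0 := h1.eventually_lt_const hlt
  have h3 : ∀ᶠ t in 𝓝[<] b, t ∈ Ioo a b := Ioo_mem_nhdsLT hab
  obtain ⟨t, ht, ht'⟩ := (h2.and h3).exists
  rw [slope_def_field, hb, sub_zero] at ht
  have : 0 ≤ φ t / (t - b) := div_nonneg_of_nonpos (hneg t ht') (by linarith [ht'.2])
  linarith

/-- If `φ a ≤ 0` and `φ` has negative derivative at each of its zeros, then `φ < 0` after `a`. -/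
theorem neg_of_hasDerivAt_neg_of_eq_zero {φ φ' : ℝ → ℝ} {a b : ℝ}
    (hd : ∀ t ∈ Icc a b, HasDerivAt φ (φ' t) t) (ha : φ a ≤ 0)
    (hz : ∀ t ∈ Icc a b, φ t = 0 → φ' t < 0) {t : ℝ} (ht : t ∈ Ioc a b) : φ t < 0 := by
  have key : ∀ x ∈ Icc a b, φ x ≤ 0 := by
    intro x hx
    have := image_le_of_deriv_right_lt_deriv_boundary (f := φ) (f' := φ') (a := a) (b := b)
      (B := fun _ => 0) (B' := fun _ => 0)
      (fun t ht => (hd t ht).continuousAt.continuousWithinAt)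
      (fun t ht => (hd t (Ico_subset_Icc_self ht)).hasDerivWithinAt) ha
      (fun t => hasDerivAt_const t 0) (fun t ht h => hz t (Ico_subset_Icc_self ht) h)
    exact this hx
  have htI : t ∈ Icc a b := Ioc_subset_Icc_self ht
  rcases (key t htI).lt_or_eq with h | h
  · exact h
  · have := nonneg_of_hasDerivAt_of_neg_left ht.1 (hd t htI) h
      (fun u hu => key u ⟨hu.1.le, hu.2.le.trans ht.2⟩)
    linarith [hz t htI h]

/-! ### The standing hypotheses -/

/-- The standing hypotheses on the dimension `n` and the function `f`. -/
structure Admissible (n : ℕ) (f : ℝ → ℝ) (m M : ℝ) : Prop where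
  two_le : 2 ≤ n
  smooth : ContDiffOn ℝ ∞ f (Ici 0)
  convex : ∀ s : ℝ, 0 < s → 0 ≤ deriv (deriv f) s
  m_pos : 0 < m
  bound : ∀ s : ℝ, 0 < s → m ≤ deriv f s ∧ deriv f s ≤ M

namespace Admissible

variable {n : ℕ} {f : ℝ → ℝ} {m M : ℝ} (h : Admissible n f m M)
include h

theorem two_le_cast : (2 : ℝ) ≤ n := by exact_mod_cast h.two_le

theorem m_le_M : m ≤ M := (h.bound 1 one_pos).1.trans (h.bound 1 one_pos).2

theorem deriv_pos {s : ℝ} (hs : 0 < s) : 0 < deriv f s := h.m_pos.trans_le (h.bound s hs).1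

theorem hasDerivAt {s : ℝ} (hs : 0 < s) : HasDerivAt f (deriv f s) s :=
  (((h.smooth.contDiffAt (Ici_mem_nhds hs)).differentiableAt (by simp))).hasDerivAt

theorem contDiffOn_deriv : ContDiffOn ℝ ∞ (deriv f) (Ioi 0) :=
  ((contDiffOn_infty_iff_deriv_of_isOpen isOpen_Ioi).1
    (h.smooth.mono (Ioi_subset_Ici le_rfl))).2

theorem monotoneOn_deriv : MonotoneOn (deriv f) (Ioi 0) := by
  refine monotoneOn_of_deriv_nonneg (convex_Ioi 0) h.contDiffOn_deriv.continuousOn ?_ ?_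
  · rw [interior_Ioi]
    exact h.contDiffOn_deriv.differentiableOn (by simp)
  · rw [interior_Ioi]
    exact fun s hs => h.convex s hs

theorem continuousOn_deriv : ContinuousOn (deriv f) (Ioi 0) := h.contDiffOn_deriv.continuousOn

theorem monotoneOn : MonotoneOn f (Ici 0) := by
  refine monotoneOn_of_deriv_nonneg (convex_Ici 0) h.smooth.continuousOn ?_ ?_
  · rw [interior_Ici]
    exact fun s hs => (h.hasDerivAt hs).differentiableAt.differentiableWithinAt
  · rw [interior_Ici]
    exact fun s hs => (h.deriv_pos hs).le

theorem add_mul_le {s : ℝ} (hs : 0 ≤ s) : f 0 + m * s ≤ f s := by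
  have := (convex_Ici (0 : ℝ)).mul_sub_le_image_sub_of_le_deriv h.smooth.continuousOn (C := m)
    (by rw [interior_Ici]
        exact fun s hs => (h.hasDerivAt hs).differentiableAt.differentiableWithinAt)
    (by rw [interior_Ici]; exact fun s hs => (h.bound s hs).1) 0 self_mem_Ici s hs hs
  linarith

/-- `s f'(s)` is strictly increasing. -/
theorem strictMonoOn_mul_deriv : StrictMonoOn (fun s => s * deriv f s) (Ioi 0) := by
  intro a ha b hb hab
  have h1 := h.monotoneOn_deriv ha hb hab.le
  have h2 := h.deriv_pos ha
  have ha' : 0 < a := ha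
  have hb' : 0 < b := hb
  show a * deriv f a < b * deriv f b
  calc a * deriv f a < b * deriv f a := by gcongr
    _ ≤ b * deriv f b := by gcongr

theorem exists_mul_deriv_eq {c : ℝ} (hc : 0 < c) : ∃ s, 0 < s ∧ s * deriv f s = c := by
  have hM : 0 < M := h.m_pos.trans_le h.m_le_M
  have h1 : 0 < c / M := by positivity
  have h2 : c / M ≤ c / m := by
    have := h.m_le_M
    have := h.m_pos
    gcongr
  have hcont : ContinuousOn (fun s => s * deriv f s) (Icc (c / M) (c / m)) :=
    (continuousOn_id.mul h.continuousOn_deriv).mono fun s hs => h1.trans_le hs.1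
  have hmem : c ∈ Icc ((c / M) * deriv f (c / M)) ((c / m) * deriv f (c / m)) := by
    constructor
    · calc (c / M) * deriv f (c / M) ≤ (c / M) * M := by gcongr; exact (h.bound _ h1).2
        _ = c := by field_simp
    · have := h.m_pos
      calc c = (c / m) * m := by field_simp
        _ ≤ _ := by gcongr; exact (h.bound _ (h1.trans_le h2)).1
  obtain ⟨s, hs, hs'⟩ := intermediate_value_Icc h2 hcont hmem
  exact ⟨s, h1.trans_le hs.1, hs'⟩

end Admissible

/-! ### Conserved and monotone quantities along profile curves -/

/-- The profile system holds at time `t`, at a point of the open half plane `r > 0`. -/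
structure SolvesAt (n : ℕ) (f : ℝ → ℝ) (x r θ : ℝ → ℝ) (t : ℝ) : Prop where
  r_pos : 0 < r t
  x_deriv : HasDerivAt x (Real.cos (θ t)) t
  r_deriv : HasDerivAt r (Real.sin (θ t)) t
  theta_deriv : HasDerivAt θ (angleSpeed n f (x t) (r t) (θ t)) t

/-- The product of the position vector and the unit tangent vector; half the derivative of the
squared distance to the origin. -/
noncomputable def radialPart (x r θ : ℝ) : ℝ := x * Real.cos θ + r * Real.sin θ

/-- The support function: the product of the position vector and the unit normal vector. -/
noncomputable def supportPart (x r θ : ℝ) : ℝ := r * Real.cos θ - x * Real.sin θ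

/-- The conformal factor `r ^ (n - 1) exp (-f(x² + r²) / 4)` whose geodesics are the profile
curves, for `r > 0`. -/
noncomputable def weight (n : ℕ) (f : ℝ → ℝ) (x r : ℝ) : ℝ :=
  Real.exp (((n : ℝ) - 1) * Real.log r - f (x ^ 2 + r ^ 2) / 4)

/-- The logarithmic derivative of the conformal factor in the direction of `r`. -/
noncomputable def verticalForce (n : ℕ) (f : ℝ → ℝ) (x r : ℝ) : ℝ :=
  ((n : ℝ) - 1) / r - r / 2 * deriv f (x ^ 2 + r ^ 2)

theorem weight_pos (n : ℕ) (f : ℝ → ℝ) (x r : ℝ) : 0 < weight n f x r := Real.exp_pos _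

theorem angleSpeed_eq (n : ℕ) (f : ℝ → ℝ) (x r θ : ℝ) :
    angleSpeed n f x r θ = ((n : ℝ) - 1) * Real.cos θ / r
      - deriv f (x ^ 2 + r ^ 2) / 2 * supportPart x r θ := by
  unfold angleSpeed supportPart; ring

theorem angleSpeed_eq_verticalForce (n : ℕ) (f : ℝ → ℝ) (x r θ : ℝ) :
    angleSpeed n f x r θ = verticalForce n f x r * Real.cos θ
      + x / 2 * deriv f (x ^ 2 + r ^ 2) * Real.sin θ := rfl

theorem radialPart_sq_add_supportPart_sq (x r θ : ℝ) :
    radialPart x r θ ^ 2 + supportPart x r θ ^ 2 = x ^ 2 + r ^ 2 := by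
  unfold radialPart supportPart
  linear_combination (x ^ 2 + r ^ 2) * Real.sin_sq_add_cos_sq θ

theorem cos_mul_sq (x r θ : ℝ) :
    Real.cos θ * (x ^ 2 + r ^ 2) = r * supportPart x r θ + x * radialPart x r θ := by
  unfold radialPart supportPart; ring

theorem sin_mul_sq (x r θ : ℝ) :
    Real.sin θ * (x ^ 2 + r ^ 2) = r * radialPart x r θ - x * supportPart x r θ := by
  unfold radialPart supportPart; ring

namespace SolvesAt

variable {n : ℕ} {f : ℝ → ℝ} {m M : ℝ} {x r θ : ℝ → ℝ} {t : ℝ}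

theorem sq_pos (hs : SolvesAt n f x r θ t) : 0 < x t ^ 2 + r t ^ 2 := by
  have := hs.r_pos
  positivity

theorem hasDerivAt_sq (hs : SolvesAt n f x r θ t) :
    HasDerivAt (fun t => x t ^ 2 + r t ^ 2) (2 * radialPart (x t) (r t) (θ t)) t := by
  refine ((hs.x_deriv.pow 2).add (hs.r_deriv.pow 2)).congr_deriv ?_
  unfold radialPart; push_cast; ring

theorem hasDerivAt_radialPart (hs : SolvesAt n f x r θ t) :
    HasDerivAt (fun t => radialPart (x t) (r t) (θ t))
      (1 + supportPart (x t) (r t) (θ t) * angleSpeed n f (x t) (r t) (θ t)) t := by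
  refine ((hs.x_deriv.mul hs.theta_deriv.cos).add
    (hs.r_deriv.mul hs.theta_deriv.sin)).congr_deriv ?_
  unfold supportPart
  linear_combination Real.sin_sq_add_cos_sq (θ t)

theorem hasDerivAt_supportPart (hs : SolvesAt n f x r θ t) :
    HasDerivAt (fun t => supportPart (x t) (r t) (θ t))
      (-(radialPart (x t) (r t) (θ t) * angleSpeed n f (x t) (r t) (θ t))) t := by
  refine ((hs.r_deriv.mul hs.theta_deriv.cos).sub
    (hs.x_deriv.mul hs.theta_deriv.sin)).congr_deriv ?_
  unfold radialPart; ring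

theorem hasDerivAt_div (hs : SolvesAt n f x r θ t) :
    HasDerivAt (fun t => x t / r t) (supportPart (x t) (r t) (θ t) / r t ^ 2) t := by
  refine (hs.x_deriv.div hs.r_deriv hs.r_pos.ne').congr_deriv ?_
  unfold supportPart; ring

theorem hasDerivAt_weight (h : Admissible n f m M) (hs : SolvesAt n f x r θ t) :
    HasDerivAt (fun t => weight n f (x t) (r t))
      (weight n f (x t) (r t) * (((n : ℝ) - 1) * Real.sin (θ t) / r t
        - deriv f (x t ^ 2 + r t ^ 2) / 2 * radialPart (x t) (r t) (θ t))) t := by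
  have h1 := (hs.r_deriv.log hs.r_pos.ne').const_mul ((n : ℝ) - 1)
  have h2 := ((h.hasDerivAt hs.sq_pos).comp t hs.hasDerivAt_sq).div_const 4
  refine (h1.sub h2).exp.congr_deriv ?_
  unfold weight; simp only [Pi.sub_apply, Function.comp_apply]; ring

/-- Balance of forces along the axis of rotation. -/
theorem hasDerivAt_weight_mul_cos (h : Admissible n f m M) (hs : SolvesAt n f x r θ t) :
    HasDerivAt (fun t => weight n f (x t) (r t) * Real.cos (θ t))
      (-(x t * deriv f (x t ^ 2 + r t ^ 2) / 2 * weight n f (x t) (r t))) t := by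
  refine ((hs.hasDerivAt_weight h).mul hs.theta_deriv.cos).congr_deriv ?_
  rw [angleSpeed_eq]
  unfold supportPart radialPart
  linear_combination (-(x t * deriv f (x t ^ 2 + r t ^ 2) / 2 * weight n f (x t) (r t))) *
    Real.sin_sq_add_cos_sq (θ t)

/-- Balance of forces orthogonal to the axis of rotation. -/
theorem hasDerivAt_weight_mul_sin (h : Admissible n f m M) (hs : SolvesAt n f x r θ t) :
    HasDerivAt (fun t => weight n f (x t) (r t) * Real.sin (θ t))
      (weight n f (x t) (r t) * verticalForce n f (x t) (r t)) t := by
  refine ((hs.hasDerivAt_weight h).mul hs.theta_deriv.sin).congr_deriv ?_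
  rw [angleSpeed_eq]
  unfold supportPart radialPart verticalForce
  linear_combination (weight n f (x t) (r t)) * (((n : ℝ) - 1) / r t
    - r t / 2 * deriv f (x t ^ 2 + r t ^ 2)) * Real.sin_sq_add_cos_sq (θ t)

/-- Balance of torques: the part of the weight depending on `x² + r²` exerts no torque. -/
theorem hasDerivAt_weight_mul_supportPart (h : Admissible n f m M) (hs : SolvesAt n f x r θ t) :
    HasDerivAt (fun t => weight n f (x t) (r t) * supportPart (x t) (r t) (θ t))
      (-(((n : ℝ) - 1) * weight n f (x t) (r t) * (x t / r t))) t := by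
  refine ((hs.hasDerivAt_weight h).mul hs.hasDerivAt_supportPart).congr_deriv ?_
  have hr := hs.r_pos.ne'
  rw [angleSpeed_eq]
  unfold supportPart radialPart
  field_simp
  linear_combination (-(2 * ((n : ℝ) - 1) * x t * weight n f (x t) (r t))) *
    Real.sin_sq_add_cos_sq (θ t)

end SolvesAt

/-! ### The truncated system -/

section GlobalSolution

variable {E : Type*} [NormedAddCommGroup E] [NormedSpace ℝ E]

theorem eqOn_Ioo_of_lipschitzWith {F : E → E} {L : NNReal} (hL : LipschitzWith L F)
    {Y Z : ℝ → E} {a b c : ℝ} (hc : c ∈ Ioo a b)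
    (hY : ∀ t ∈ Ioo a b, HasDerivAt Y (F (Y t)) t)
    (hZ : ∀ t ∈ Ioo a b, HasDerivAt Z (F (Z t)) t) (h0 : Y c = Z c) : EqOn Y Z (Ioo a b) :=
  ODE_solution_unique_of_mem_Ioo (v := fun _ => F) (s := fun _ => univ) (K := L)
    (fun _ _ => hL.lipschitzOnWith) hc (fun t ht => ⟨hY t ht, mem_univ _⟩)
    (fun t ht => ⟨hZ t ht, mem_univ _⟩) h0

/-- A bounded Lipschitz vector field has solutions defined for all times. -/
theorem exists_forall_hasDerivAt [CompleteSpace E] {F : E → E} {L : NNReal}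
    (hL : LipschitzWith L F) {C : NNReal} (hC : ∀ y, ‖F y‖ ≤ C) (y₀ : E) :
    ∃ Y : ℝ → E, Y 0 = y₀ ∧ ∀ t, HasDerivAt Y (F (Y t)) t := by
  have loc : ∀ N : ℕ, ∃ α : ℝ → E, α 0 = y₀ ∧
      ∀ t ∈ Ioo (-(N + 1 : ℝ)) (N + 1), HasDerivAt α (F (α t)) t := by
    intro N
    have h0 : (0 : ℝ) ∈ Icc (-(N + 1 : ℝ)) (N + 1) := by
      constructor <;> linarith [N.cast_nonneg (α := ℝ)]
    have hpl : IsPicardLindelof (fun _ : ℝ => F) (⟨0, h0⟩ : Icc (-(N + 1 : ℝ)) (N + 1)) y₀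
        (C * (N + 1)) 0 C L :=
      { lipschitzOnWith := fun t _ => hL.lipschitzOnWith
        continuousOn := fun y _ => continuousOn_const
        norm_le := fun t _ y _ => hC y
        mul_max_le := by simp }
    obtain ⟨α, hα0, hα⟩ := hpl.exists_eq_forall_mem_Icc_hasDerivWithinAt₀
    exact ⟨α, hα0, fun t ht =>
      (hα t (Ioo_subset_Icc_self ht)).hasDerivAt (Icc_mem_nhds ht.1 ht.2)⟩
  choose α hα0 hα using loc
  have agree : ∀ (N k : ℕ) (t : ℝ), |t| < N + 1 → |t| < k + 1 → α N t = α k t := by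
    have aux : ∀ (N k : ℕ) (t : ℝ), N ≤ k → |t| < N + 1 → α N t = α k t := by
      intro N k t hNk ht
      have hk : (N : ℝ) ≤ k := by exact_mod_cast hNk
      have hN : (0 : ℝ) ≤ N := N.cast_nonneg
      refine eqOn_Ioo_of_lipschitzWith hL (a := -(N + 1 : ℝ)) (b := N + 1) (c := 0)
        ⟨by linarith, by linarith⟩ (hα N)
        (fun u hu => hα k u ⟨by linarith [hu.1], by linarith [hu.2]⟩) ?_ (abs_lt.1 ht)
      rw [hα0, hα0]
    intro N k t hN hk
    rcases le_total N k with h | h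
    · exact aux N k t h hN
    · exact (aux k N t h hk).symm
  refine ⟨fun t => α ⌈|t|⌉₊ t, by simp [hα0], fun t => ?_⟩
  have hceil : ∀ u : ℝ, |u| < (⌈|u|⌉₊ : ℝ) + 1 := fun u => by linarith [Nat.le_ceil |u|]
  have hder := hα ⌈|t|⌉₊ t (abs_lt.1 (hceil t))
  refine hder.congr_of_eventuallyEq ?_
  have : ∀ᶠ u in 𝓝 t, |u| < (⌈|t|⌉₊ : ℝ) + 1 :=
    continuous_abs.continuousAt.eventually_lt continuousAt_const (hceil t)
  filter_upwards [this] with u hu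
  exact agree _ _ u (hceil u) hu

theorem dist_le_of_lipschitzWith {F : E → E} {L : NNReal} (hL : LipschitzWith L F)
    {Y Z : ℝ → E} {a b : ℝ} (hab : a ≤ b) (hY : ∀ t ∈ Icc a b, HasDerivAt Y (F (Y t)) t)
    (hZ : ∀ t ∈ Icc a b, HasDerivAt Z (F (Z t)) t) :
    dist (Y b) (Z b) ≤ dist (Y a) (Z a) * Real.exp (L * (b - a)) :=
  dist_le_of_trajectories_ODE (v := fun _ => F) (K := L) (fun _ => hL)
    (fun t ht => (hY t ht).continuousAt.continuousWithinAt)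
    (fun t ht => (hY t (Ico_subset_Icc_self ht)).hasDerivWithinAt)
    (fun t ht => (hZ t ht).continuousAt.continuousWithinAt)
    (fun t ht => (hZ t (Ico_subset_Icc_self ht)).hasDerivWithinAt)
    le_rfl b (right_mem_Icc.2 hab)

end GlobalSolution

/-- The vector field of the profile system, with the position truncated to the box
`[-K, K] × [δ, K]`; it is globally Lipschitz and bounded. -/
noncomputable def truncatedField (n : ℕ) (f : ℝ → ℝ) (δ K : ℝ) (y : ℝ × ℝ × ℝ) : ℝ × ℝ × ℝ :=
  (Real.cos y.2.2, Real.sin y.2.2,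
    angleSpeed n f (max (-K) (min K y.1)) (max δ (min K y.2.1)) y.2.2)

theorem truncate_mem_Icc {a b : ℝ} (hab : a ≤ b) (x : ℝ) : max a (min b x) ∈ Icc a b :=
  ⟨le_max_left _ _, max_le hab (min_le_left _ _)⟩

theorem truncate_eq_self {a b x : ℝ} (hx : x ∈ Icc a b) : max a (min b x) = x := by
  rw [min_eq_right hx.2, max_eq_right hx.1]

theorem lipschitzWith_truncate (a b : ℝ) : LipschitzWith 1 fun x : ℝ => max a (min b x) :=
  (LipschitzWith.id.const_min b).const_max a

theorem Admissible.exists_lipschitzWith_truncatedField {n : ℕ} {f : ℝ → ℝ} {m M : ℝ}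
    (h : Admissible n f m M) {δ K : ℝ} (hδ : 0 < δ) (hK : δ ≤ K) :
    ∃ L C : NNReal, LipschitzWith L (truncatedField n f δ K) ∧
      ∀ y, ‖truncatedField n f δ K y‖ ≤ C := by
  -- The field factors through the compact convex box of all `(x, r, cos θ, sin θ)`.
  let box : Set (ℝ × ℝ × ℝ × ℝ) := Icc (-K) K ×ˢ Icc δ K ×ˢ Icc (-1) 1 ×ˢ Icc (-1) 1
  let G : ℝ × ℝ × ℝ × ℝ → ℝ × ℝ × ℝ := fun z => (z.2.2.1, z.2.2.2,
    (((n : ℝ) - 1) / z.2.1 - z.2.1 / 2 * deriv f (z.1 ^ 2 + z.2.1 ^ 2)) * z.2.2.1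
      + z.1 / 2 * deriv f (z.1 ^ 2 + z.2.1 ^ 2) * z.2.2.2)
  let P : ℝ × ℝ × ℝ → ℝ × ℝ × ℝ × ℝ := fun y =>
    (max (-K) (min K y.1), max δ (min K y.2.1), Real.cos y.2.2, Real.sin y.2.2)
  have hGP : truncatedField n f δ K = G ∘ P := rfl
  have hcomp : IsCompact box :=
    isCompact_Icc.prod (isCompact_Icc.prod (isCompact_Icc.prod isCompact_Icc))
  have hconv : Convex ℝ box :=
    (convex_Icc _ _).prod ((convex_Icc _ _).prod ((convex_Icc _ _).prod (convex_Icc _ _)))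
  have hpos : ∀ z ∈ box, 0 < z.2.1 := fun z hz => hδ.trans_le hz.2.1.1
  have hPmem : ∀ y, P y ∈ box := fun y =>
    ⟨truncate_mem_Icc (by linarith) _, truncate_mem_Icc hK _,
      ⟨Real.neg_one_le_cos _, Real.cos_le_one _⟩, ⟨Real.neg_one_le_sin _, Real.sin_le_one _⟩⟩
  have hderiv : ContDiffOn ℝ 1 (fun z : ℝ × ℝ × ℝ × ℝ => deriv f (z.1 ^ 2 + z.2.1 ^ 2)) box := by
    refine (h.contDiffOn_deriv.of_le (by simp)).comp (by fun_prop) ?_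
    intro z hz
    have := hpos z hz
    show 0 < z.1 ^ 2 + z.2.1 ^ 2
    positivity
  have hinv : ContDiffOn ℝ 1 (fun z : ℝ × ℝ × ℝ × ℝ => ((n : ℝ) - 1) / z.2.1) box :=
    contDiffOn_const.div (by fun_prop) fun z hz => (hpos z hz).ne'
  have hG : ContDiffOn ℝ 1 G box := by
    refine ContDiffOn.prodMk (by fun_prop) (ContDiffOn.prodMk (by fun_prop) ?_)
    exact ((hinv.sub (ContDiffOn.mul (by fun_prop) hderiv)).mul (by fun_prop)).add
      ((ContDiffOn.mul (by fun_prop) hderiv).mul (by fun_prop))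
  obtain ⟨L, hL⟩ := (hG.locallyLipschitzOn hconv).exists_lipschitzOnWith_of_compact hcomp
  obtain ⟨C, hC⟩ := hcomp.exists_bound_of_continuousOn hG.continuousOn
  have hcos : LipschitzWith 1 Real.cos := Real.lipschitzWith_cos
  have hsin : LipschitzWith 1 Real.sin := Real.lipschitzWith_sin
  have hP := ((lipschitzWith_truncate (-K) K).comp
    (LipschitzWith.prod_fst (α := ℝ) (β := ℝ × ℝ))).prodMk
    (((lipschitzWith_truncate δ K).comp ((LipschitzWith.prod_fst (α := ℝ) (β := ℝ)).comp
      (LipschitzWith.prod_snd (α := ℝ) (β := ℝ × ℝ)))).prodMk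
    ((hcos.comp ((LipschitzWith.prod_snd (α := ℝ) (β := ℝ)).comp
      (LipschitzWith.prod_snd (α := ℝ) (β := ℝ × ℝ)))).prodMk
     (hsin.comp ((LipschitzWith.prod_snd (α := ℝ) (β := ℝ)).comp
      (LipschitzWith.prod_snd (α := ℝ) (β := ℝ × ℝ))))))
  have hLip := hL.comp (lipschitzOnWith_univ.2 hP) (fun y _ => hPmem y)
  rw [lipschitzOnWith_univ] at hLip
  exact ⟨_, C.toNNReal, hLip, fun y => (hC _ (hPmem y)).trans (Real.le_coe_toNNReal C)⟩

/-- A triple of functions solves the truncated system at all times. -/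
structure IsTruncatedSolution (n : ℕ) (f : ℝ → ℝ) (δ K : ℝ) (Y : ℝ → ℝ × ℝ × ℝ) (R : ℝ) :
    Prop where
  init : Y 0 = (0, R, 0)
  hasDerivAt : ∀ t, HasDerivAt Y (truncatedField n f δ K (Y t)) t

theorem Admissible.exists_isTruncatedSolution {n : ℕ} {f : ℝ → ℝ} {m M : ℝ}
    (h : Admissible n f m M) {δ K : ℝ} (hδ : 0 < δ) (hK : δ ≤ K) (R : ℝ) :
    ∃ Y, IsTruncatedSolution n f δ K Y R := by
  obtain ⟨L, C, hL, hC⟩ := h.exists_lipschitzWith_truncatedField hδ hK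
  obtain ⟨Y, hY0, hY⟩ := exists_forall_hasDerivAt hL hC (0, R, 0)
  exact ⟨Y, hY0, hY⟩

namespace IsTruncatedSolution

variable {n : ℕ} {f : ℝ → ℝ} {δ K R : ℝ} {Y : ℝ → ℝ × ℝ × ℝ}

theorem hasDerivAt_fst (hY : IsTruncatedSolution n f δ K Y R) (t : ℝ) :
    HasDerivAt (fun t => (Y t).1) (Real.cos (Y t).2.2) t :=
  (hY.hasDerivAt t).fst

theorem hasDerivAt_snd (hY : IsTruncatedSolution n f δ K Y R) (t : ℝ) :
    HasDerivAt (fun t => (Y t).2.1) (Real.sin (Y t).2.2) t :=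
  (hY.hasDerivAt t).snd.fst

theorem hasDerivAt_angle (hY : IsTruncatedSolution n f δ K Y R) (t : ℝ) :
    HasDerivAt (fun t => (Y t).2.2) (truncatedField n f δ K (Y t)).2.2 t :=
  (hY.hasDerivAt t).snd.snd

theorem continuous (hY : IsTruncatedSolution n f δ K Y R) : Continuous Y :=
  continuous_iff_continuousAt.2 fun t => (hY.hasDerivAt t).continuousAt

/-- Inside the box, the truncation has no effect. -/
theorem solvesAt (hY : IsTruncatedSolution n f δ K Y R) (hδ : 0 < δ) {t : ℝ}
    (hx : (Y t).1 ∈ Icc (-K) K) (hr : (Y t).2.1 ∈ Icc δ K) :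
    SolvesAt n f (fun t => (Y t).1) (fun t => (Y t).2.1) (fun t => (Y t).2.2) t := by
  refine ⟨hδ.trans_le hr.1, hY.hasDerivAt_fst t, hY.hasDerivAt_snd t, ?_⟩
  have := hY.hasDerivAt_angle t
  simpa only [truncatedField, truncate_eq_self hx, truncate_eq_self hr] using this

end IsTruncatedSolution

theorem SolvesAt.hasDerivAt_truncatedField {n : ℕ} {f : ℝ → ℝ} {δ K : ℝ} {x r θ : ℝ → ℝ} {t : ℝ}
    (hs : SolvesAt n f x r θ t) (hx : x t ∈ Icc (-K) K) (hr : r t ∈ Icc δ K) :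
    HasDerivAt (fun t => (x t, r t, θ t)) (truncatedField n f δ K (x t, r t, θ t)) t := by
  simp only [truncatedField, truncate_eq_self hx, truncate_eq_self hr]
  exact hs.x_deriv.prodMk (hs.r_deriv.prodMk hs.theta_deriv)

/-! ### Arcs with decreasing distance to the origin -/

/-- A solution on `[0, T]` that starts horizontally at `(0, R)`, stays in the quadrant `x ≥ 0`,
has `θ ≥ -π`, and along which the distance to the origin does not increase. -/
structure IsInwardArc (n : ℕ) (f : ℝ → ℝ) (R T : ℝ) (x r θ : ℝ → ℝ) : Prop where
  pos : 0 < T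
  x_zero : x 0 = 0
  r_zero : r 0 = R
  theta_zero : θ 0 = 0
  solves : ∀ t ∈ Icc 0 T, SolvesAt n f x r θ t
  x_nonneg : ∀ t ∈ Icc 0 T, 0 ≤ x t
  neg_pi_le : ∀ t ∈ Icc 0 T, -Real.pi ≤ θ t
  radial_nonpos : ∀ t ∈ Icc 0 T, radialPart (x t) (r t) (θ t) ≤ 0

theorem Admissible.abs_angleSpeed_le {n : ℕ} {f : ℝ → ℝ} {m M : ℝ} (h : Admissible n f m M)
    {a K x r : ℝ} (θ : ℝ) (ha : 0 < a) (har : a ≤ r) (hr : r ≤ K) (hx : |x| ≤ K) :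
    |angleSpeed n f x r θ| ≤ ((n : ℝ) - 1) / a + K * M := by
  have hr0 : 0 < r := ha.trans_le har
  have hn := h.two_le_cast
  have hs : 0 < x ^ 2 + r ^ 2 := by positivity
  obtain ⟨hg1, hg2⟩ := h.bound _ hs
  have hg0 := h.deriv_pos hs
  set g := deriv f (x ^ 2 + r ^ 2)
  have hK : 0 ≤ K := (abs_nonneg x).trans hx
  have h1 : |((n : ℝ) - 1) / r - r / 2 * g| ≤ ((n : ℝ) - 1) / a + K / 2 * M := by
    have e1 : ((n : ℝ) - 1) / r ≤ ((n : ℝ) - 1) / a := by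
      have : 0 ≤ (n : ℝ) - 1 := by linarith
      gcongr
    have e2 : r / 2 * g ≤ K / 2 * M := by gcongr
    have e3 : 0 ≤ ((n : ℝ) - 1) / r := div_nonneg (by linarith) hr0.le
    have e4 : 0 ≤ r / 2 * g := by positivity
    rw [abs_le]; constructor <;> linarith
  have h2 : |x / 2 * g| ≤ K / 2 * M := by
    rw [abs_mul, abs_div, abs_of_pos hg0, abs_two]
    gcongr
  calc |angleSpeed n f x r θ|
      ≤ |(((n : ℝ) - 1) / r - r / 2 * g) * Real.cos θ| + |x / 2 * g * Real.sin θ| := abs_add_le _ _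
    _ ≤ |((n : ℝ) - 1) / r - r / 2 * g| * 1 + |x / 2 * g| * 1 := by
        rw [abs_mul, abs_mul (x / 2 * g)]
        gcongr
        · exact Real.abs_cos_le_one θ
        · exact Real.abs_sin_le_one θ
    _ ≤ _ := by linarith

namespace IsInwardArc

variable {n : ℕ} {f : ℝ → ℝ} {m M R T : ℝ} {x r θ : ℝ → ℝ}

theorem zero_mem (ha : IsInwardArc n f R T x r θ) : (0 : ℝ) ∈ Icc 0 T := left_mem_Icc.2 ha.pos.le

theorem end_mem (ha : IsInwardArc n f R T x r θ) : T ∈ Icc 0 T := right_mem_Icc.2 ha.pos.le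

theorem radius_pos (ha : IsInwardArc n f R T x r θ) : 0 < R :=
  ha.r_zero ▸ (ha.solves 0 ha.zero_mem).r_pos

theorem sub_mem (_ha : IsInwardArc n f R T x r θ) {a b : ℝ} (ha0 : a ∈ Icc 0 T)
    (hb : b ∈ Icc 0 T) {t : ℝ} (ht : t ∈ Icc a b) : t ∈ Icc 0 T :=
  ⟨ha0.1.trans ht.1, ht.2.trans hb.2⟩

theorem continuousOn_theta (ha : IsInwardArc n f R T x r θ) : ContinuousOn θ (Icc 0 T) :=
  fun t ht => (ha.solves t ht).theta_deriv.continuousAt.continuousWithinAt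

theorem continuousOn_x (ha : IsInwardArc n f R T x r θ) : ContinuousOn x (Icc 0 T) :=
  fun t ht => (ha.solves t ht).x_deriv.continuousAt.continuousWithinAt

/-- The angle cannot become positive, since the curve would then move away from the origin. -/
theorem theta_nonpos (ha : IsInwardArc n f R T x r θ) {t : ℝ} (ht : t ∈ Icc 0 T) : θ t ≤ 0 := by
  by_contra hlt
  push Not at hlt
  have hmin : min (θ t) (Real.pi / 2) ∈ Icc (θ 0) (θ t) := by
    rw [ha.theta_zero]
    exact ⟨le_min hlt.le (by positivity), min_le_left _ _⟩
  obtain ⟨u, hu, hu'⟩ := intermediate_value_Icc ht.1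
    (ha.continuousOn_theta.mono (Icc_subset_Icc_right ht.2)) hmin
  have hu0 : u ∈ Icc 0 T := ⟨hu.1, hu.2.trans ht.2⟩
  have hpos : 0 < θ u := by rw [hu']; exact lt_min hlt (by positivity)
  have hle : θ u ≤ Real.pi / 2 := by rw [hu']; exact min_le_right _ _
  have hsin : 0 < Real.sin (θ u) := Real.sin_pos_of_pos_of_lt_pi hpos (by linarith [Real.pi_pos])
  have hcos : 0 ≤ Real.cos (θ u) := Real.cos_nonneg_of_mem_Icc ⟨by linarith, hle⟩
  have h1 := ha.radial_nonpos u hu0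
  have h2 := mul_nonneg (ha.x_nonneg u hu0) hcos
  have h3 := mul_pos (ha.solves u hu0).r_pos hsin
  unfold radialPart at h1
  linarith

theorem sin_nonpos (ha : IsInwardArc n f R T x r θ) {t : ℝ} (ht : t ∈ Icc 0 T) :
    Real.sin (θ t) ≤ 0 :=
  Real.sin_nonpos_of_nonpos_of_neg_pi_le (ha.theta_nonpos ht) (ha.neg_pi_le t ht)

theorem r_antitone (ha : IsInwardArc n f R T x r θ) {a b : ℝ} (h0 : a ∈ Icc 0 T)
    (hb : b ∈ Icc 0 T) (hab : a ≤ b) : r b ≤ r a :=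
  le_of_forall_hasDerivAt_nonpos hab (fun t ht => (ha.solves t (ha.sub_mem h0 hb ht)).r_deriv)
    fun _ ht => ha.sin_nonpos (ha.sub_mem h0 hb (Ioo_subset_Icc_self ht))

theorem sq_antitone (ha : IsInwardArc n f R T x r θ) {a b : ℝ} (h0 : a ∈ Icc 0 T)
    (hb : b ∈ Icc 0 T) (hab : a ≤ b) : x b ^ 2 + r b ^ 2 ≤ x a ^ 2 + r a ^ 2 :=
  le_of_forall_hasDerivAt_nonpos (φ := fun t => x t ^ 2 + r t ^ 2) hab
    (fun t ht => (ha.solves t (ha.sub_mem h0 hb ht)).hasDerivAt_sq)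
    fun t ht => by linarith [ha.radial_nonpos t (ha.sub_mem h0 hb (Ioo_subset_Icc_self ht))]

theorem sq_le (ha : IsInwardArc n f R T x r θ) {t : ℝ} (ht : t ∈ Icc 0 T) :
    x t ^ 2 + r t ^ 2 ≤ R ^ 2 := by
  have := ha.sq_antitone ha.zero_mem ht ht.1
  rwa [ha.x_zero, ha.r_zero, zero_pow two_ne_zero, zero_add] at this

theorem x_le (ha : IsInwardArc n f R T x r θ) {t : ℝ} (ht : t ∈ Icc 0 T) : x t ≤ R :=
  (abs_le_of_sq_le_sq' (by nlinarith [ha.sq_le ht, sq_nonneg (r t)]) ha.radius_pos.le).2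

theorem r_le (ha : IsInwardArc n f R T x r θ) {t : ℝ} (ht : t ∈ Icc 0 T) : r t ≤ R :=
  ha.r_zero ▸ ha.r_antitone ha.zero_mem ht ht.1

theorem weight_mul_cos_antitone (h : Admissible n f m M) (ha : IsInwardArc n f R T x r θ)
    {a b : ℝ} (h0 : a ∈ Icc 0 T) (hb : b ∈ Icc 0 T) (hab : a ≤ b) :
    weight n f (x b) (r b) * Real.cos (θ b) ≤ weight n f (x a) (r a) * Real.cos (θ a) := by
  refine le_of_forall_hasDerivAt_nonpos
    (φ := fun t => weight n f (x t) (r t) * Real.cos (θ t)) hab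
    (fun t ht => (ha.solves t (ha.sub_mem h0 hb ht)).hasDerivAt_weight_mul_cos h) fun t ht => ?_
  have htT := ha.sub_mem h0 hb (Ioo_subset_Icc_self ht)
  have h1 := ha.x_nonneg t htT
  have h2 := h.deriv_pos (ha.solves t htT).sq_pos
  have h3 := weight_pos n f (x t) (r t)
  have : 0 ≤ x t * deriv f (x t ^ 2 + r t ^ 2) / 2 * weight n f (x t) (r t) := by positivity
  linarith

/-- Along an inward arc both `r` and `x² + r²` decrease, hence the vertical force increases. -/
theorem verticalForce_monotone (h : Admissible n f m M) (ha : IsInwardArc n f R T x r θ)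
    {a b : ℝ} (h0 : a ∈ Icc 0 T) (hb : b ∈ Icc 0 T) (hab : a ≤ b) :
    verticalForce n f (x a) (r a) ≤ verticalForce n f (x b) (r b) := by
  have hrab := ha.r_antitone h0 hb hab
  have hra := (ha.solves a h0).r_pos
  have hrb := (ha.solves b hb).r_pos
  have hg := h.monotoneOn_deriv (ha.solves b hb).sq_pos (ha.solves a h0).sq_pos
    (ha.sq_antitone h0 hb hab)
  have hgb := h.deriv_pos (ha.solves b hb).sq_pos
  have hn : 0 ≤ (n : ℝ) - 1 := by linarith [h.two_le_cast]
  unfold verticalForce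
  gcongr

/-- As long as the vertical force has not become positive, the curve moves strictly downwards. -/
theorem sin_neg_of_verticalForce_nonpos (h : Admissible n f m M)
    (ha : IsInwardArc n f R T x r θ) (hA0 : verticalForce n f 0 R < 0) {t : ℝ} (ht : t ∈ Icc 0 T)
    (ht0 : 0 < t) (hA : verticalForce n f (x t) (r t) ≤ 0) : Real.sin (θ t) < 0 := by
  have hle : ∀ u ∈ Icc 0 t, verticalForce n f (x u) (r u) ≤ 0 := fun u hu =>
    (ha.verticalForce_monotone h (ha.sub_mem ha.zero_mem ht hu) ht hu.2).trans hA
  let φ : ℝ → ℝ := fun t => weight n f (x t) (r t) * Real.sin (θ t)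
  have hd : ∀ u ∈ Icc 0 t, HasDerivAt φ
      (weight n f (x u) (r u) * verticalForce n f (x u) (r u)) u := fun u hu =>
    (ha.solves u (ha.sub_mem ha.zero_mem ht hu)).hasDerivAt_weight_mul_sin h
  have hφ0 : φ 0 = 0 := by simp [φ, ha.theta_zero]
  have hφle : ∀ u ∈ Icc 0 t, φ u ≤ 0 := fun u hu => by
    rw [← hφ0]
    refine le_of_forall_hasDerivAt_nonpos hu.1 (fun v hv => hd v ⟨hv.1, hv.2.trans hu.2⟩)
      fun v hv => mul_nonpos_of_nonneg_of_nonpos (weight_pos _ _ _ _).le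
        (hle v ⟨hv.1.le, hv.2.le.trans hu.2⟩)
  have hlt : φ t < 0 := by
    rcases (hφle t ⟨ht0.le, le_rfl⟩).lt_or_eq with h1 | h1
    · exact h1
    · exfalso
      -- `φ` is antitone with equal end values, hence vanishes, contradicting its slope at `0`.
      have hzero : ∀ u ∈ Icc 0 t, φ u = 0 := fun u hu => by
        refine le_antisymm (hφle u hu) ?_
        rw [← h1]
        exact le_of_forall_hasDerivAt_nonpos hu.2 (fun v hv => hd v ⟨hu.1.trans hv.1, hv.2⟩)
          fun v hv => mul_nonpos_of_nonneg_of_nonpos (weight_pos _ _ _ _).le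
            (hle v ⟨hu.1.trans hv.1.le, hv.2.le⟩)
      have hd0 := (hd 0 ⟨le_rfl, ht0.le⟩).hasDerivWithinAt (s := Icc 0 t)
      have hc : HasDerivWithinAt φ 0 (Icc 0 t) 0 :=
        (hasDerivWithinAt_const (0 : ℝ) (Icc 0 t) (0 : ℝ)).congr hzero (hzero 0 ⟨le_rfl, ht0.le⟩)
      have heq := (uniqueDiffOn_Icc ht0 0 ⟨le_rfl, ht0.le⟩).eq_deriv _ hd0 hc
      rw [ha.x_zero, ha.r_zero] at heq
      have := mul_neg_of_pos_of_neg (weight_pos n f 0 R) hA0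
      linarith
  exact (neg_of_mul_neg_right hlt (weight_pos _ _ _ _).le)

/-- An inward arc returning to the line `x = 0` first moves to the right and then to the left. -/
theorem exists_turning_time (h : Admissible n f m M) (ha : IsInwardArc n f R T x r θ)
    (hend : x T = 0) : ∃ τ ∈ Icc 0 T, (∀ t ∈ Icc 0 τ, 0 ≤ Real.cos (θ t)) ∧
      ∀ t ∈ Icc τ T, Real.cos (θ t) ≤ 0 := by
  have hsign : ∀ {a b : ℝ}, a ∈ Icc 0 T → b ∈ Icc 0 T → a ≤ b → 0 ≤ Real.cos (θ b) →
      0 ≤ Real.cos (θ a) := by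
    intro a b h0 hb hab hcos
    have h1 := ha.weight_mul_cos_antitone h h0 hb hab
    have h2 := mul_nonneg (weight_pos n f (x b) (r b)).le hcos
    exact nonneg_of_mul_nonneg_right (h2.trans h1) (weight_pos _ _ _ _)
  have hsign' : ∀ {a b : ℝ}, a ∈ Icc 0 T → b ∈ Icc 0 T → a ≤ b → Real.cos (θ a) ≤ 0 →
      Real.cos (θ b) ≤ 0 := by
    intro a b h0 hb hab hcos
    have h1 := ha.weight_mul_cos_antitone h h0 hb hab
    have h2 := mul_nonpos_of_nonneg_of_nonpos (weight_pos n f (x a) (r a)).le hcos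
    exact nonpos_of_mul_nonpos_right (h1.trans h2) (weight_pos _ _ _ _)
  have hT : Real.cos (θ T) ≤ 0 := by
    by_contra hpos
    push Not at hpos
    have hpos' : ∀ u ∈ Icc 0 T, 0 < Real.cos (θ u) := by
      intro u hu
      have h1 := ha.weight_mul_cos_antitone h hu ha.end_mem hu.2
      have h2 := mul_pos (weight_pos n f (x T) (r T)) hpos
      exact pos_of_mul_pos_right (h2.trans_le h1) (weight_pos _ _ _ _).le
    have := lt_of_forall_hasDerivAt_neg (φ := fun t => -x t) ha.pos
      (fun t ht => (ha.solves t ht).x_deriv.neg)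
      (fun t ht => neg_neg_of_pos (hpos' t (Ioo_subset_Icc_self ht)))
    simp only [hend, ha.x_zero] at this
    exact lt_irrefl _ this
  have hcont : ContinuousOn (fun t => Real.cos (θ t)) (Icc 0 T) :=
    Real.continuous_cos.comp_continuousOn ha.continuousOn_theta
  obtain ⟨τ, hτ, hτ0⟩ := intermediate_value_Icc' ha.pos.le hcont
    (show (0 : ℝ) ∈ Icc (Real.cos (θ T)) (Real.cos (θ 0)) by
      rw [ha.theta_zero, Real.cos_zero]; exact ⟨hT, zero_le_one⟩)
  simp only at hτ0
  exact ⟨τ, hτ, fun t ht => hsign ⟨ht.1, ht.2.trans hτ.2⟩ hτ ht.2 hτ0.ge,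
    fun t ht => hsign' hτ ⟨hτ.1.trans ht.1, ht.2⟩ ht.1 hτ0.le⟩

/-- An inward arc that returns to the line `x = 0` has length at most `4 R`. -/
theorem length_le (h : Admissible n f m M) (ha : IsInwardArc n f R T x r θ) (hend : x T = 0) :
    T ≤ 4 * R := by
  obtain ⟨τ, hτ, hτ1, hτ2⟩ := ha.exists_turning_time h hend
  have hone : ∀ t ∈ Icc 0 T, 1 ≤ |Real.cos (θ t)| - Real.sin (θ t) := fun t ht => by
    have h1 := ha.sin_nonpos ht
    nlinarith [Real.sin_sq_add_cos_sq (θ t), sq_abs (Real.cos (θ t)), abs_nonneg (Real.cos (θ t)),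
      Real.abs_cos_le_one (θ t), Real.neg_one_le_sin (θ t)]
  have e1 := le_of_forall_hasDerivAt_nonpos (φ := fun t => t - x t + r t) hτ.1
    (fun t ht => ((hasDerivAt_id t).sub (ha.solves t ⟨ht.1, ht.2.trans hτ.2⟩).x_deriv).add
      (ha.solves t ⟨ht.1, ht.2.trans hτ.2⟩).r_deriv) (fun t ht => by
      have := hone t ⟨ht.1.le, ht.2.le.trans hτ.2⟩
      rw [abs_of_nonneg (hτ1 t (Ioo_subset_Icc_self ht))] at this
      linarith)
  have e2 := le_of_forall_hasDerivAt_nonpos (φ := fun t => t + x t + r t) hτ.2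
    (fun t ht => ((hasDerivAt_id t).add (ha.solves t ⟨hτ.1.trans ht.1, ht.2⟩).x_deriv).add
      (ha.solves t ⟨hτ.1.trans ht.1, ht.2⟩).r_deriv) (fun t ht => by
      have := hone t ⟨hτ.1.trans ht.1.le, ht.2.le⟩
      rw [abs_of_nonpos (hτ2 t (Ioo_subset_Icc_self ht))] at this
      linarith)
  simp only [ha.x_zero, ha.r_zero, hend] at e1 e2
  have := ha.x_le hτ
  have := ha.r_le hτ
  have := (ha.solves τ hτ).r_pos
  have := (ha.solves T ha.end_mem).r_pos
  linarith

end IsInwardArc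

/-- While the angle has turned by at most `1`, the curve moves to the right with speed at
least `1 / 2`. -/
theorem half_le_x_of_angleSpeed_ge {n : ℕ} {f : ℝ → ℝ} {x r θ : ℝ → ℝ} {C t₀ : ℝ} (ht₀ : 0 ≤ t₀)
    (hx0 : x 0 = 0) (hθ0 : θ 0 = 0) (hs : ∀ t ∈ Icc 0 t₀, SolvesAt n f x r θ t)
    (hθ : ∀ t ∈ Icc 0 t₀, θ t ≤ 0) (hC : ∀ t ∈ Icc 0 t₀, -C ≤ angleSpeed n f (x t) (r t) (θ t))
    (hC0 : 0 ≤ C) (hCt : C * t₀ ≤ 1) : t₀ / 2 ≤ x t₀ := by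
  have hlow : ∀ t ∈ Icc 0 t₀, -1 ≤ θ t := by
    intro t ht
    have := le_of_forall_hasDerivAt_nonpos (φ := fun t => -θ t - C * t) ht.1
      (fun u hu => (hs u ⟨hu.1, hu.2.trans ht.2⟩).theta_deriv.neg.sub
        ((hasDerivAt_id u).const_mul C)) (fun u hu => by
        linarith [hC u ⟨hu.1.le, hu.2.le.trans ht.2⟩])
    simp only [hθ0] at this
    have : C * t ≤ C * t₀ := mul_le_mul_of_nonneg_left ht.2 hC0
    linarith
  have := le_of_forall_hasDerivAt_nonpos (φ := fun t => t / 2 - x t) ht₀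
    (fun u hu => ((hasDerivAt_id u).div_const 2).sub (hs u hu).x_deriv) (fun u hu => by
      have hu' := Ioo_subset_Icc_self hu
      have h1 := Real.one_sub_sq_div_two_le_cos (x := θ u)
      nlinarith [hlow u hu', hθ u hu'])
  simp only [hx0] at this
  linarith

theorem Admissible.min_le_r_of_le_weight {n : ℕ} {f : ℝ → ℝ} {m M : ℝ} (h : Admissible n f m M)
    {c x r : ℝ} (hr : 0 < r) (hc : c ≤ weight n f x r) : min 1 (c * Real.exp (f 0 / 4)) ≤ r := by
  rcases le_total 1 r with h1 | h1
  · exact (min_le_left _ _).trans h1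
  · refine (min_le_right _ _).trans ?_
    have hn := h.two_le_cast
    have hwle : weight n f x r ≤ Real.exp (Real.log r - f 0 / 4) := by
      unfold weight
      have e1 : Real.log r ≤ 0 := Real.log_nonpos hr.le h1
      have hs : 0 ≤ x ^ 2 + r ^ 2 := by positivity
      have e2 := h.monotoneOn self_mem_Ici hs hs
      refine Real.exp_le_exp.2 ?_
      nlinarith
    rw [Real.exp_sub, Real.exp_log hr] at hwle
    have := hc.trans hwle
    rwa [le_div_iff₀ (Real.exp_pos _)] at this

/-- Inward arcs returning to the line `x = 0` keep a distance from the axis of rotation which is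
uniform for bounded initial heights. Close to the axis the curvature is so large that the angle
would pass `-π` before `x` returns to `0`; and once the curve has moved back towards `x = 0` by a
definite amount, the horizontal balance of forces bounds the weight from below. -/
theorem Admissible.exists_pos_le_r {n : ℕ} {f : ℝ → ℝ} {m M : ℝ} (h : Admissible n f m M)
    {ρ K : ℝ} (hρ : 0 < ρ) (hρK : ρ ≤ K) :
    ∃ δ, 0 < δ ∧ δ ≤ ρ ∧ ∀ (R T : ℝ) (x r θ : ℝ → ℝ), ρ ≤ R → R ≤ K →
      IsInwardArc n f R T x r θ → x T = 0 → ∀ t ∈ Icc 0 T, δ ≤ r t := by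
  have hn := h.two_le_cast
  have hM : 0 < M := h.m_pos.trans_le h.m_le_M
  have hm := h.m_pos
  have hK : 0 < K := hρ.trans_le hρK
  have hπ := Real.pi_pos
  obtain ⟨C, hCdef⟩ : ∃ C, C = ((n : ℝ) - 1) / (ρ / 2) + K * M := ⟨_, rfl⟩
  have hC : 0 < C := by
    have : 0 < ((n : ℝ) - 1) / (ρ / 2) := div_pos (by linarith) (by linarith)
    have : 0 < K * M := by positivity
    linarith
  obtain ⟨t₀, ht₀def⟩ : ∃ t₀, t₀ = min (ρ / 2) (1 / C) := ⟨_, rfl⟩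
  have ht₀ : 0 < t₀ := by rw [ht₀def]; exact lt_min (by linarith) (by positivity)
  have ht₀ρ : t₀ ≤ ρ / 2 := by rw [ht₀def]; exact min_le_left _ _
  have ht₀C : C * t₀ ≤ 1 := by
    have : t₀ ≤ 1 / C := by rw [ht₀def]; exact min_le_right _ _
    calc C * t₀ ≤ C * (1 / C) := by gcongr
      _ = 1 := by field_simp
  obtain ⟨ξ, hξdef⟩ : ∃ ξ, ξ = t₀ / 2 := ⟨_, rfl⟩
  have hξ : 0 < ξ := by rw [hξdef]; linarith
  obtain ⟨k, hkdef⟩ : ∃ k, k = 2 * Real.pi / ξ + 1 := ⟨_, rfl⟩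
  have hk : 0 < k := by rw [hkdef]; positivity
  have hkξ : Real.pi < k * (ξ / 2) := by
    rw [hkdef]
    have : (2 * Real.pi / ξ + 1) * (ξ / 2) = Real.pi + ξ / 2 := by field_simp
    linarith
  obtain ⟨δ₁, hδ₁def⟩ : ∃ δ₁, δ₁ = 1 / (M / 2 + k + 1) := ⟨_, rfl⟩
  have hδ₁ : 0 < δ₁ := by rw [hδ₁def]; positivity
  have hδ₁1 : δ₁ ≤ 1 := by
    rw [hδ₁def, div_le_one (by positivity)]; linarith
  obtain ⟨w, hwdef⟩ : ∃ w, w = Real.exp (((n : ℝ) - 1) * Real.log δ₁ - f (K ^ 2) / 4) := ⟨_, rfl⟩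
  have hw : 0 < w := by rw [hwdef]; exact Real.exp_pos _
  obtain ⟨c, hcdef⟩ : ∃ c, c = ξ / 2 * m / 2 * w * (ξ / 2) := ⟨_, rfl⟩
  have hc : 0 < c := by rw [hcdef]; positivity
  refine ⟨min ρ (min δ₁ (c * Real.exp (f 0 / 4))), by positivity, min_le_left _ _, ?_⟩
  intro R T x r θ hρR hRK ha hend t ht
  have hR := ha.radius_pos
  -- The initial part of the arc reaches the line `x = ξ`.
  have hrlow : ∀ u ∈ Icc 0 T, u ≤ t₀ → ρ / 2 ≤ r u := by
    intro u hu hut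
    have := le_of_forall_hasDerivAt_nonpos (φ := fun t => -r t - t) hu.1
      (fun v hv => (ha.solves v ⟨hv.1, hv.2.trans hu.2⟩).r_deriv.neg.sub (hasDerivAt_id v))
      (fun v _ => by linarith [Real.neg_one_le_sin (θ v)])
    simp only [ha.r_zero] at this
    linarith
  have hstart : ∀ u, 0 ≤ u → u ≤ t₀ → u ≤ T → u / 2 ≤ x u := by
    intro u hu0 hut huT
    have hmem : ∀ v ∈ Icc 0 u, v ∈ Icc 0 T := fun v hv => ⟨hv.1, hv.2.trans huT⟩
    refine half_le_x_of_angleSpeed_ge hu0 ha.x_zero ha.theta_zero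
      (fun v hv => ha.solves v (hmem v hv)) (fun v hv => ha.theta_nonpos (hmem v hv))
      (C := C) (fun v hv => ?_) hC.le ?_
    · have := h.abs_angleSpeed_le (a := ρ / 2) (K := K) (θ v) (by linarith)
        (hrlow v (hmem v hv) (hv.2.trans hut)) ((ha.r_le (hmem v hv)).trans hRK)
        (by rw [abs_of_nonneg (ha.x_nonneg v (hmem v hv))]
            exact (ha.x_le (hmem v hv)).trans hRK)
      rw [← hCdef] at this
      exact (abs_le.1 this).1
    · exact (mul_le_mul_of_nonneg_left hut hC.le).trans ht₀C
  have ht₀T : t₀ ≤ T := by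
    by_contra hlt
    push Not at hlt
    have := hstart T ha.pos.le hlt.le le_rfl
    rw [hend] at this
    linarith [ha.pos]
  have hx₀ : ξ ≤ x t₀ := by rw [hξdef]; exact hstart t₀ ht₀.le le_rfl ht₀T
  have ht₀mem : t₀ ∈ Icc 0 T := ⟨ht₀.le, ht₀T⟩
  obtain ⟨τ, hτ, hτ1, hτ2⟩ := ha.exists_turning_time h hend
  have hxanti : ∀ {a b : ℝ}, τ ≤ a → a ≤ b → b ≤ T → x b ≤ x a := by
    intro a b hτa hab hbT
    exact le_of_forall_hasDerivAt_nonpos hab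
      (fun v hv => (ha.solves v ⟨hτ.1.trans (hτa.trans hv.1), hv.2.trans hbT⟩).x_deriv)
      (fun v hv => hτ2 v ⟨hτa.trans hv.1.le, hv.2.le.trans hbT⟩)
  have hxτ : ξ ≤ x τ := by
    refine hx₀.trans ?_
    rcases le_total t₀ τ with hle | hle
    · have := le_of_forall_hasDerivAt_nonpos (φ := fun t => -x t) hle
        (fun v hv => (ha.solves v ⟨ht₀.le.trans hv.1, hv.2.trans hτ.2⟩).x_deriv.neg)
        (fun v hv => neg_nonpos.2 (hτ1 v ⟨ht₀.le.trans hv.1.le, hv.2.le⟩))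
      linarith
    · exact hxanti le_rfl hle ht₀T
  -- On its way back the arc passes the line `x = ξ / 2` at time `η`.
  obtain ⟨η, hη, hxη⟩ := intermediate_value_Icc' hτ.2
    (ha.continuousOn_x.mono (Icc_subset_Icc_left hτ.1))
    (show ξ / 2 ∈ Icc (x T) (x τ) by rw [hend]; constructor <;> linarith)
  have hηmem : η ∈ Icc 0 T := ⟨hτ.1.trans hη.1, hη.2⟩
  have hrη : δ₁ < r η := by
    by_contra hle
    push Not at hle
    have hturn := le_of_forall_hasDerivAt_nonpos (φ := fun t => θ t - k * x t) hη.2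
      (fun v hv => (ha.solves v ⟨hηmem.1.trans hv.1, hv.2⟩).theta_deriv.sub
        ((ha.solves v ⟨hηmem.1.trans hv.1, hv.2⟩).x_deriv.const_mul k)) (fun v hv => by
        have hv' : v ∈ Icc 0 T := ⟨hηmem.1.trans hv.1.le, hv.2.le⟩
        have hrv : r v ≤ δ₁ := (ha.r_antitone hηmem hv' hv.1.le).trans hle
        have hrv0 := (ha.solves v hv').r_pos
        have hg := h.bound _ (ha.solves v hv').sq_pos
        have hA : k ≤ verticalForce n f (x v) (r v) := by
          have e1 : 1 / δ₁ ≤ ((n : ℝ) - 1) / r v := by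
            rw [div_le_div_iff₀ hδ₁ hrv0]; nlinarith
          have e2 : 1 / δ₁ = M / 2 + k + 1 := by rw [hδ₁def, one_div_one_div]
          have e3 : r v / 2 * deriv f (x v ^ 2 + r v ^ 2) ≤ 1 / 2 * M := by
            have := h.deriv_pos (ha.solves v hv').sq_pos
            have := hg.2
            have : r v ≤ 1 := hrv.trans hδ₁1
            gcongr
          unfold verticalForce
          linarith
        have hcos := hτ2 v ⟨hη.1.trans hv.1.le, hv.2.le⟩
        have hsin := ha.sin_nonpos hv'
        have hB : 0 ≤ x v / 2 * deriv f (x v ^ 2 + r v ^ 2) := by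
          have := h.deriv_pos (ha.solves v hv').sq_pos
          have := ha.x_nonneg v hv'
          positivity
        rw [angleSpeed_eq_verticalForce]
        nlinarith [mul_nonneg (sub_nonneg.2 hA) (neg_nonneg.2 hcos),
          mul_nonneg hB (neg_nonneg.2 hsin)])
    simp only [hend, hxη] at hturn
    have := ha.neg_pi_le T ha.end_mem
    have := ha.theta_nonpos hηmem
    linarith
  rcases le_total t η with hle | hle
  · exact (min_le_right _ _).trans ((min_le_left _ _).trans
      (hrη.le.trans (ha.r_antitone ht hηmem hle)))
  -- At time `η` the horizontal force has accumulated the amount `c`.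
  have hdrop : weight n f (x η) (r η) * Real.cos (θ η) ≤ -c := by
    have hlen : ξ / 2 ≤ η - τ := by
      have := le_of_forall_hasDerivAt_nonpos (φ := fun t => -x t - t) hη.1
        (fun v hv => (ha.solves v ⟨hτ.1.trans hv.1, hv.2.trans hη.2⟩).x_deriv.neg.sub
          (hasDerivAt_id v)) (fun v _ => by linarith [Real.neg_one_le_cos (θ v)])
      simp only [hxη] at this
      linarith
    have hint := le_of_forall_hasDerivAt_nonpos
      (φ := fun t => weight n f (x t) (r t) * Real.cos (θ t) + ξ / 2 * m / 2 * w * t) hη.1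
      (fun v hv => ((ha.solves v ⟨hτ.1.trans hv.1, hv.2.trans hη.2⟩).hasDerivAt_weight_mul_cos
        h).add ((hasDerivAt_id v).const_mul _)) (fun v hv => by
        have hv' : v ∈ Icc 0 T := ⟨hτ.1.trans hv.1.le, hv.2.le.trans hη.2⟩
        have hxv : ξ / 2 ≤ x v := hxη ▸ hxanti hv.1.le hv.2.le hη.2
        have hrv : δ₁ ≤ r v := hrη.le.trans (ha.r_antitone hv' hηmem hv.2.le)
        have hwv : w ≤ weight n f (x v) (r v) := by
          rw [hwdef]
          unfold weight
          have e1 : Real.log δ₁ ≤ Real.log (r v) := Real.log_le_log hδ₁ hrv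
          have e2 : f (x v ^ 2 + r v ^ 2) ≤ f (K ^ 2) := by
            refine h.monotoneOn (ha.solves v hv').sq_pos.le (sq_nonneg K) ?_
            exact (ha.sq_le hv').trans (by gcongr)
          have e3 : 0 ≤ (n : ℝ) - 1 := by linarith
          gcongr
        have hg := (h.bound _ (ha.solves v hv').sq_pos).1
        have : ξ / 2 * m / 2 * w ≤
            x v * deriv f (x v ^ 2 + r v ^ 2) / 2 * weight n f (x v) (r v) := by
          have := ha.x_nonneg v hv'
          have := h.m_pos.trans_le hg
          have : 0 ≤ x v * deriv f (x v ^ 2 + r v ^ 2) / 2 := by positivity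
          gcongr
        linarith)
    have hτcos := mul_nonpos_of_nonneg_of_nonpos (weight_pos n f (x τ) (r τ)).le
      (hτ2 τ ⟨le_rfl, hτ.2⟩)
    have : c ≤ ξ / 2 * m / 2 * w * (η - τ) := by rw [hcdef]; gcongr
    linarith
  have hct := (ha.weight_mul_cos_antitone h hηmem ht hle).trans hdrop
  have hcw : c ≤ weight n f (x t) (r t) := by
    nlinarith [weight_pos n f (x t) (r t), Real.neg_one_le_cos (θ t)]
  refine le_trans ?_ (h.min_le_r_of_le_weight (ha.solves t ht).r_pos hcw)
  exact (min_le_right _ _).trans (le_min ((min_le_left _ _).trans hδ₁1) (min_le_right _ _))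

/-! ### Uniqueness -/

theorem exists_box_of_continuousOn {Y : ℝ → ℝ × ℝ × ℝ} {a b : ℝ}
    (hY : ContinuousOn Y (Icc a b)) (hr : ∀ t ∈ Icc a b, 0 < (Y t).2.1) :
    ∃ δ K, 0 < δ ∧ ∀ t ∈ Icc a b, (Y t).1 ∈ Icc (-K) K ∧ (Y t).2.1 ∈ Icc δ K := by
  rcases (Icc a b).eq_empty_or_nonempty with he | hne
  · exact ⟨1, 0, one_pos, by simp [he]⟩
  obtain ⟨K, hK⟩ := isCompact_Icc.exists_bound_of_continuousOn hY
  obtain ⟨t₀, ht₀, hmin⟩ := isCompact_Icc.exists_isMinOn hne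
    (continuous_snd.fst.comp_continuousOn hY : ContinuousOn (fun t => (Y t).2.1) (Icc a b))
  refine ⟨(Y t₀).2.1, K, hr t₀ ht₀, fun t ht => ⟨abs_le.1 ?_, hmin ht, (le_abs_self _).trans ?_⟩⟩
  · exact (norm_fst_le (Y t)).trans (hK t ht)
  · exact (norm_fst_le (Y t).2).trans ((norm_snd_le (Y t)).trans (hK t ht))

theorem truncatedField_eq_of_mem {n : ℕ} {f : ℝ → ℝ} {δ K : ℝ} {y : ℝ × ℝ × ℝ}
    (hx : y.1 ∈ Icc (-K) K) (hr : y.2.1 ∈ Icc δ K) : truncatedField n f δ K y =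
      (Real.cos y.2.2, Real.sin y.2.2, angleSpeed n f y.1 y.2.1 y.2.2) := by
  simp only [truncatedField, truncate_eq_self hx, truncate_eq_self hr]

/-- Two solutions in the open half plane with the same initial data agree. -/
theorem Admissible.eqOn_of_hasDerivWithinAt {n : ℕ} {f : ℝ → ℝ} {m M : ℝ} (h : Admissible n f m M)
    {Y Z : ℝ → ℝ × ℝ × ℝ} {a b : ℝ} (hYc : ContinuousOn Y (Icc a b))
    (hZc : ContinuousOn Z (Icc a b)) (hYr : ∀ t ∈ Icc a b, 0 < (Y t).2.1)
    (hZr : ∀ t ∈ Icc a b, 0 < (Z t).2.1)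
    (hY : ∀ t ∈ Ico a b, HasDerivWithinAt Y (Real.cos (Y t).2.2, Real.sin (Y t).2.2,
      angleSpeed n f (Y t).1 (Y t).2.1 (Y t).2.2) (Ici t) t)
    (hZ : ∀ t ∈ Ico a b, HasDerivWithinAt Z (Real.cos (Z t).2.2, Real.sin (Z t).2.2,
      angleSpeed n f (Z t).1 (Z t).2.1 (Z t).2.2) (Ici t) t)
    (h0 : Y a = Z a) : EqOn Y Z (Icc a b) := by
  obtain ⟨δ₁, K₁, hδ₁, hb₁⟩ := exists_box_of_continuousOn hYc hYr
  obtain ⟨δ₂, K₂, hδ₂, hb₂⟩ := exists_box_of_continuousOn hZc hZr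
  obtain ⟨δ, hδ⟩ : ∃ δ, δ = min δ₁ δ₂ := ⟨_, rfl⟩
  obtain ⟨K, hK⟩ : ∃ K, K = max δ (max K₁ K₂) := ⟨_, rfl⟩
  have hδ1 : δ ≤ δ₁ := hδ ▸ min_le_left _ _
  have hδ2 : δ ≤ δ₂ := hδ ▸ min_le_right _ _
  have hK1 : K₁ ≤ K := hK ▸ (le_max_left _ _).trans (le_max_right _ _)
  have hK2 : K₂ ≤ K := hK ▸ (le_max_right _ _).trans (le_max_right _ _)
  obtain ⟨L, C, hL, -⟩ := h.exists_lipschitzWith_truncatedField (n := n) (f := f)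
    (δ := δ) (K := K) (hδ ▸ lt_min hδ₁ hδ₂) (hK ▸ le_max_left _ _)
  refine ODE_solution_unique (v := fun _ => truncatedField n f δ K) (fun _ => hL) hYc
    (fun t ht => ?_) hZc (fun t ht => ?_) h0
  · obtain ⟨⟨e1, e2⟩, e3, e4⟩ := hb₁ t (Ico_subset_Icc_self ht)
    rw [truncatedField_eq_of_mem ⟨by linarith, by linarith⟩ ⟨by linarith, by linarith⟩]
    exact hY t ht
  · obtain ⟨⟨e1, e2⟩, e3, e4⟩ := hb₂ t (Ico_subset_Icc_self ht)
    rw [truncatedField_eq_of_mem ⟨by linarith, by linarith⟩ ⟨by linarith, by linarith⟩]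
    exact hZ t ht

theorem SolvesAt.hasDerivAt_triple {n : ℕ} {f : ℝ → ℝ} {x r θ : ℝ → ℝ} {t : ℝ}
    (hs : SolvesAt n f x r θ t) : HasDerivAt (fun t => (x t, r t, θ t))
      (Real.cos (θ t), Real.sin (θ t), angleSpeed n f (x t) (r t) (θ t)) t :=
  hs.x_deriv.prodMk (hs.r_deriv.prodMk hs.theta_deriv)

theorem Admissible.eqOn_of_solvesAt {n : ℕ} {f : ℝ → ℝ} {m M : ℝ} (h : Admissible n f m M)
    {x r θ x' r' θ' : ℝ → ℝ} {a b : ℝ} (hs : ∀ t ∈ Icc a b, SolvesAt n f x r θ t)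
    (hs' : ∀ t ∈ Icc a b, SolvesAt n f x' r' θ' t) (hx : x a = x' a) (hr : r a = r' a)
    (hθ : θ a = θ' a) : ∀ t ∈ Icc a b, x t = x' t ∧ r t = r' t ∧ θ t = θ' t := by
  have := h.eqOn_of_hasDerivWithinAt (Y := fun t => (x t, r t, θ t))
    (Z := fun t => (x' t, r' t, θ' t)) (a := a) (b := b)
    (fun t ht => (hs t ht).hasDerivAt_triple.continuousAt.continuousWithinAt)
    (fun t ht => (hs' t ht).hasDerivAt_triple.continuousAt.continuousWithinAt)
    (fun t ht => (hs t ht).r_pos) (fun t ht => (hs' t ht).r_pos)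
    (fun t ht => (hs t (Ico_subset_Icc_self ht)).hasDerivAt_triple.hasDerivWithinAt)
    (fun t ht => (hs' t (Ico_subset_Icc_self ht)).hasDerivAt_triple.hasDerivWithinAt)
    (by simp only [hx, hr, hθ])
  intro t ht
  simpa only [Prod.mk.injEq] using this ht

/-- The system is invariant under reversal of time combined with a rotation of the tangent
vector by a half turn. -/
theorem SolvesAt.reverse {n : ℕ} {f : ℝ → ℝ} {x r θ : ℝ → ℝ} {t : ℝ} (c : ℝ)
    (hs : SolvesAt n f x r θ (c - t)) : SolvesAt n f (fun t => x (c - t)) (fun t => r (c - t))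
      (fun t => θ (c - t) + Real.pi) t := by
  have hsub : HasDerivAt (fun t : ℝ => c - t) (-1) t := by
    simpa using (hasDerivAt_id t).const_sub c
  refine ⟨hs.r_pos, ?_, ?_, ?_⟩
  · exact (hs.x_deriv.comp t hsub).congr_deriv (by rw [Real.cos_add_pi]; ring)
  · exact (hs.r_deriv.comp t hsub).congr_deriv (by rw [Real.sin_add_pi]; ring)
  · refine ((hs.theta_deriv.comp t hsub).add_const Real.pi).congr_deriv ?_
    unfold angleSpeed
    rw [Real.cos_add_pi, Real.sin_add_pi]; ring

theorem solvesAt_axis (n : ℕ) (f : ℝ → ℝ) {c t : ℝ} (ht : 0 < c + t) :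
    SolvesAt n f (fun _ => 0) (fun t => c + t) (fun _ => Real.pi / 2) t := by
  refine ⟨ht, ?_, ?_, ?_⟩
  · rw [Real.cos_pi_div_two]; exact hasDerivAt_const _ _
  · rw [Real.sin_pi_div_two]; exact (hasDerivAt_id t).const_add c
  · refine (hasDerivAt_const _ _).congr_deriv ?_
    simp [angleSpeed]

/-- The profile curve of the sphere on which `s f'(s) = 2 n`. -/
theorem solvesAt_circle {n : ℕ} {f : ℝ → ℝ} {ρ β t : ℝ} (hρ : 0 < ρ)
    (hF : ρ ^ 2 * deriv f (ρ ^ 2) = 2 * n) (hpos : 0 < Real.cos (β + t / ρ)) :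
    SolvesAt n f (fun t => ρ * Real.sin (β + t / ρ)) (fun t => ρ * Real.cos (β + t / ρ))
      (fun t => -(β + t / ρ)) t := by
  have hd : HasDerivAt (fun t => β + t / ρ) (1 / ρ) t := by
    simpa using ((hasDerivAt_id t).div_const ρ).const_add β
  refine ⟨by positivity, ?_, ?_, ?_⟩
  · refine (hd.sin.const_mul ρ).congr_deriv ?_
    rw [Real.cos_neg]; field_simp
  · refine (hd.cos.const_mul ρ).congr_deriv ?_
    rw [Real.sin_neg]; field_simp
  · refine hd.neg.congr_deriv ?_
    have hs : (ρ * Real.sin (β + t / ρ)) ^ 2 + (ρ * Real.cos (β + t / ρ)) ^ 2 = ρ ^ 2 := by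
      linear_combination ρ ^ 2 * Real.sin_sq_add_cos_sq (β + t / ρ)
    have hg : deriv f (ρ ^ 2) = 2 * n / ρ ^ 2 := by field_simp; linarith
    have hp : supportPart (ρ * Real.sin (β + t / ρ)) (ρ * Real.cos (β + t / ρ))
        (-(β + t / ρ)) = ρ := by
      unfold supportPart
      rw [Real.cos_neg, Real.sin_neg]
      linear_combination ρ * Real.sin_sq_add_cos_sq (β + t / ρ)
    rw [angleSpeed_eq, hs, hp, hg, Real.cos_neg]
    clear hs hp hd
    generalize Real.cos (β + t / ρ) = c at hpos ⊢
    field_simp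
    ring

/-! ### Inward arcs returning to the line of symmetry -/

/-- An inward arc that ends at its first return to the line `x = 0`; before, all defining
inequalities are strict. -/
structure IsReturningArc (n : ℕ) (f : ℝ → ℝ) (R T : ℝ) (x r θ : ℝ → ℝ) : Prop
    extends IsInwardArc n f R T x r θ where
  x_pos : ∀ t ∈ Ioo 0 T, 0 < x t
  neg_pi_lt : ∀ t ∈ Ioo 0 T, -Real.pi < θ t
  radial_neg : ∀ t ∈ Ioo 0 T, radialPart (x t) (r t) (θ t) < 0
  x_end : x T = 0

/-- The curve starting at height `R` moves inwards until it returns to the line `x = 0`. -/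
def Returns (n : ℕ) (f : ℝ → ℝ) (R : ℝ) : Prop :=
  ∃ (T : ℝ) (x r θ : ℝ → ℝ), IsReturningArc n f R T x r θ

theorem IsReturningArc.isStoppedProfile {n : ℕ} {f : ℝ → ℝ} {R T : ℝ} {x r θ : ℝ → ℝ}
    (ha : IsReturningArc n f R T x r θ) : IsStoppedProfile n f R T x r θ where
  pos := ha.pos
  sol :=
    { x_zero := ha.x_zero
      r_zero := ha.r_zero
      theta_zero := ha.theta_zero
      x_cont := ha.continuousOn_x
      r_cont := fun t ht => (ha.solves t ht).r_deriv.continuousAt.continuousWithinAt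
      theta_cont := ha.continuousOn_theta
      r_pos := fun t ht => (ha.solves t (Ico_subset_Icc_self ht)).r_pos
      x_deriv := fun t ht => (ha.solves t (Ico_subset_Icc_self ht)).x_deriv.hasDerivWithinAt
      r_deriv := fun t ht => (ha.solves t (Ico_subset_Icc_self ht)).r_deriv.hasDerivWithinAt
      theta_deriv := fun t ht =>
        (ha.solves t (Ico_subset_Icc_self ht)).theta_deriv.hasDerivWithinAt }
  not_before := by
    rintro t ht (h1 | h1 | h1 | h1)
    · have h2 := ha.radial_neg t ht
      have h3 := ha.x_pos t ht
      simp only [radialPart, h1, Real.cos_zero, Real.sin_zero] at h2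
      linarith
    · exact (ha.neg_pi_lt t ht).ne' h1
    · exact (ha.x_pos t ht).ne' h1
    · exact (ha.solves t (Ioo_subset_Icc_self ht)).r_pos.ne' h1
  stops := Or.inr (Or.inr (Or.inl ha.x_end))

theorem Returns.stopsOnAxis {n : ℕ} {f : ℝ → ℝ} {R : ℝ} (hR : Returns n f R) :
    StopsOnAxis n f R := by
  obtain ⟨T, x, r, θ, ha⟩ := hR
  exact ⟨T, x, r, θ, ha.isStoppedProfile, ha.x_end⟩

/-- If the angle reaches `-π` while `x > 0`, then the curve is stopped off the line `x = 0`. -/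
theorem Admissible.not_stopsOnAxis {n : ℕ} {f : ℝ → ℝ} {m M : ℝ} (h : Admissible n f m M)
    {R t' : ℝ} {x r θ : ℝ → ℝ} (ht' : 0 < t') (hx0 : x 0 = 0) (hr0 : r 0 = R) (hθ0 : θ 0 = 0)
    (hs : ∀ t ∈ Icc 0 t', SolvesAt n f x r θ t) (hx : ∀ t ∈ Ioc 0 t', 0 < x t)
    (hθ : θ t' ≤ -Real.pi) : ¬ StopsOnAxis n f R := by
  rintro ⟨t₁, x', r', θ', hst, hx1⟩
  have hsol := hst.sol
  have hderiv : ∀ t ∈ Ico 0 t₁, HasDerivWithinAt (fun t => (x' t, r' t, θ' t))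
      (Real.cos (θ' t), Real.sin (θ' t), angleSpeed n f (x' t) (r' t) (θ' t)) (Ici t) t := by
    intro t ht
    have hd := (hsol.x_deriv t ht).prodMk ((hsol.r_deriv t ht).prodMk (hsol.theta_deriv t ht))
    refine hd.mono_of_mem_nhdsWithin ?_
    exact mem_of_superset (Icc_mem_nhdsGE ht.2) (Icc_subset_Icc_left ht.1)
  have hcont : ContinuousOn (fun t => (x' t, r' t, θ' t)) (Icc 0 t₁) :=
    hsol.x_cont.prodMk (hsol.r_cont.prodMk hsol.theta_cont)
  have agree : ∀ b, 0 ≤ b → b < t₁ → b ≤ t' → x b = x' b ∧ θ b = θ' b := by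
    intro b hb0 hb1 hb'
    have := h.eqOn_of_hasDerivWithinAt (Y := fun t => (x t, r t, θ t))
      (Z := fun t => (x' t, r' t, θ' t)) (a := 0) (b := b)
      (fun t ht => (hs t ⟨ht.1, ht.2.trans hb'⟩).hasDerivAt_triple.continuousAt.continuousWithinAt)
      (hcont.mono (Icc_subset_Icc_right hb1.le))
      (fun t ht => (hs t ⟨ht.1, ht.2.trans hb'⟩).r_pos)
      (fun t ht => hsol.r_pos t ⟨ht.1, ht.2.trans_lt hb1⟩)
      (fun t ht => (hs t ⟨ht.1, ht.2.le.trans hb'⟩).hasDerivAt_triple.hasDerivWithinAt)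
      (fun t ht => hderiv t ⟨ht.1, ht.2.trans hb1⟩)
      (by simp only [hx0, hr0, hθ0, hsol.x_zero, hsol.r_zero, hsol.theta_zero])
      (right_mem_Icc.2 hb0)
    simp only [Prod.mk.injEq] at this
    exact ⟨this.1, this.2.2⟩
  rcases le_or_gt t₁ t' with hle | hlt
  · have hEq : EqOn x x' (Icc 0 t₁) := by
      refine EqOn.of_subset_closure (s := Ico 0 t₁)
        (fun b hb => (agree b hb.1 hb.2 (hb.2.le.trans hle)).1)
        (fun t ht => (hs t ⟨ht.1, ht.2.trans hle⟩).x_deriv.continuousAt.continuousWithinAt)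
        hsol.x_cont Ico_subset_Icc_self ?_
      rw [closure_Ico hst.pos.ne]
    have := hEq (right_mem_Icc.2 hst.pos.le)
    rw [hx1] at this
    exact (hx t₁ ⟨hst.pos, hle⟩).ne' this
  · have hcθ : ContinuousOn θ' (Icc 0 t') := hsol.theta_cont.mono (Icc_subset_Icc_right hlt.le)
    obtain ⟨u, hu, hu'⟩ := intermediate_value_Icc' ht'.le hcθ
      (show -Real.pi ∈ Icc (θ' t') (θ' 0) by
        rw [← (agree t' ht'.le hlt le_rfl).2, hsol.theta_zero]
        exact ⟨hθ, by linarith [Real.pi_pos]⟩)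
    have hu0 : 0 < u := by
      rcases hu.1.lt_or_eq with h1 | h1
      · exact h1
      · rw [← h1, hsol.theta_zero] at hu'
        linarith [Real.pi_pos]
    exact hst.not_before u ⟨hu0, hu.2.trans_lt hlt⟩ (Or.inr (Or.inl hu'))

namespace IsInwardArc

variable {n : ℕ} {f : ℝ → ℝ} {m M R T : ℝ} {x r θ : ℝ → ℝ}

/-- The line `x = 0` is itself a solution, so it is only crossed transversally. -/
theorem cos_ne_zero_of_x_eq_zero (h : Admissible n f m M) (ha : IsInwardArc n f R T x r θ) {t : ℝ}
    (ht : t ∈ Icc 0 T) (hx : x t = 0) : Real.cos (θ t) ≠ 0 := by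
  intro hc
  have hθ : θ t = -(Real.pi / 2) := by
    have h1 := ha.theta_nonpos ht
    have h2 := ha.neg_pi_le t ht
    have := Real.injOn_cos (show -θ t ∈ Icc 0 Real.pi from ⟨by linarith, by linarith⟩)
      (show Real.pi / 2 ∈ Icc 0 Real.pi from ⟨by positivity, by linarith [Real.pi_pos]⟩)
      (by rw [Real.cos_neg, hc, Real.cos_pi_div_two])
    linarith
  have := h.eqOn_of_solvesAt (a := 0) (b := t)
    (fun u hu => (ha.solves (t - u) ⟨by linarith [hu.2], by linarith [hu.1, ht.2]⟩).reverse t)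
    (fun u hu => solvesAt_axis n f (c := r t)
      (by linarith [(ha.solves t ht).r_pos, hu.1]))
    (by simp [hx]) (by simp) (by simp only [sub_zero, hθ]; ring) t ⟨ht.1, le_rfl⟩
  have h3 := this.2.2
  rw [sub_self, ha.theta_zero] at h3
  linarith [Real.pi_pos]

/-- An inward arc returning to the line `x = 0` is nowhere tangent to the spherical profile:
otherwise it would coincide with it from there on, but the spherical profile runs into the axis
`r = 0` at a point with `x > 0`. -/
theorem false_of_circle (h : Admissible n f m M) (ha : IsInwardArc n f R T x r θ)
    (hend : x T = 0) {ρ : ℝ} (hρ : 0 < ρ) (hF : ρ ^ 2 * deriv f (ρ ^ 2) = 2 * n) {t : ℝ}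
    (ht : t ∈ Ico 0 T) (hx : x t = ρ * Real.sin (-θ t)) (hr : r t = ρ * Real.cos (-θ t)) :
    False := by
  have htT := Ico_subset_Icc_self ht
  have hπ := Real.pi_pos
  have hrT := (ha.solves T ha.end_mem).r_pos
  have hrt := (ha.solves t htT).r_pos
  have hrTt := ha.r_antitone htT ha.end_mem ht.2.le
  have hα0 : 0 ≤ -θ t := by linarith [ha.theta_nonpos htT]
  have hαπ : -θ t ≤ Real.pi := by linarith [ha.neg_pi_le t htT]
  have hcle := Real.cos_le_one (-θ t)
  -- `γ` is the polar angle at which the circle reaches the height `r T / 2`.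
  obtain ⟨γ, hγdef⟩ : ∃ γ, γ = Real.arccos (r T / (2 * ρ)) := ⟨_, rfl⟩
  have hq1 : r T / (2 * ρ) ≤ 1 := by
    rw [div_le_one (by positivity)]; nlinarith
  have hq0 : 0 < r T / (2 * ρ) := by positivity
  have hcosγ : Real.cos γ = r T / (2 * ρ) := by
    rw [hγdef, Real.cos_arccos (by linarith) hq1]
  have hγ0 : 0 ≤ γ := hγdef ▸ Real.arccos_nonneg _
  have hγ2 : γ < Real.pi / 2 := by rw [hγdef]; exact Real.arccos_lt_pi_div_two.2 hq0
  have hαγ : -θ t < γ := by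
    by_contra hle
    push Not at hle
    have := Real.cos_le_cos_of_nonneg_of_le_pi hγ0 hαπ hle
    rw [hcosγ] at this
    have h2 : r t ≤ ρ * (r T / (2 * ρ)) := by rw [hr]; gcongr
    have h3 : ρ * (r T / (2 * ρ)) = r T / 2 := by field_simp
    linarith
  obtain ⟨ℓ, hℓdef⟩ : ∃ ℓ, ℓ = ρ * (γ + θ t) := ⟨_, rfl⟩
  have hℓ : 0 < ℓ := by rw [hℓdef]; exact mul_pos hρ (by linarith)
  have hang : ∀ u ∈ Icc 0 ℓ, -θ t + u / ρ ≤ γ := by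
    intro u hu
    have : u / ρ ≤ γ + θ t := by
      rw [div_le_iff₀ hρ, mul_comm, ← hℓdef]; exact hu.2
    linarith
  have hshift : ∀ u, t + u ∈ Icc 0 T →
      SolvesAt n f (fun u => x (t + u)) (fun u => r (t + u)) (fun u => θ (t + u)) u := by
    intro u hu
    have hs := ha.solves _ hu
    have hd : HasDerivAt (fun u : ℝ => t + u) 1 u := (hasDerivAt_id u).const_add t
    exact ⟨hs.r_pos, (hs.x_deriv.comp u hd).congr_deriv (mul_one _),
      (hs.r_deriv.comp u hd).congr_deriv (mul_one _),
      (hs.theta_deriv.comp u hd).congr_deriv (mul_one _)⟩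
  have agree : ∀ b ∈ Icc 0 ℓ, t + b ≤ T → x (t + b) = ρ * Real.sin (-θ t + b / ρ) ∧
      r (t + b) = ρ * Real.cos (-θ t + b / ρ) := by
    intro b hb hbT
    have := h.eqOn_of_solvesAt (a := 0) (b := b)
      (fun u hu => hshift u ⟨add_nonneg ht.1 hu.1, by linarith [hu.2]⟩)
      (fun u hu => solvesAt_circle (n := n) (f := f) (ρ := ρ) (β := -θ t) (t := u) hρ hF
        (Real.cos_pos_of_mem_Ioo ⟨by
          have : 0 ≤ u / ρ := div_nonneg hu.1 hρ.le
          linarith, by linarith [hang u ⟨hu.1, hu.2.trans hb.2⟩]⟩))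
      (by simp only [add_zero, zero_div]; exact hx) (by simp only [add_zero, zero_div]; exact hr)
      (by simp) b ⟨hb.1, le_rfl⟩
    exact ⟨this.1, this.2.1⟩
  rcases le_or_gt (T - t) ℓ with hle | hlt
  · have hb : T - t ∈ Icc 0 ℓ := ⟨by linarith [ht.2], hle⟩
    have h1 := (agree (T - t) hb (by linarith)).1
    have h2 := hang (T - t) hb
    have h3 : 0 < (T - t) / ρ := div_pos (by linarith [ht.2]) hρ
    have h4 := Real.sin_pos_of_pos_of_lt_pi (x := -θ t + (T - t) / ρ) (by linarith) (by linarith)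
    rw [add_sub_cancel, hend] at h1
    have := mul_pos hρ h4
    linarith
  · have h1 := (agree ℓ ⟨hℓ.le, le_rfl⟩ (by linarith)).2
    have h2 : -θ t + ℓ / ρ = γ := by rw [hℓdef]; field_simp; ring
    rw [h2, hcosγ] at h1
    have h3 : ρ * (r T / (2 * ρ)) = r T / 2 := by field_simp
    have h4 := ha.r_antitone (a := t + ℓ) (b := T) ⟨by linarith [ht.1], by linarith⟩ ha.end_mem
      (by linarith)
    linarith

theorem verticalForce_neg (h : Admissible n f m M) {ρ : ℝ} (hρ : 0 < ρ)
    (hF : ρ ^ 2 * deriv f (ρ ^ 2) = 2 * n) (hρR : ρ ≤ R) : verticalForce n f 0 R < 0 := by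
  have hR : 0 < R := hρ.trans_le hρR
  have h1 : ρ ^ 2 * deriv f (ρ ^ 2) ≤ R ^ 2 * deriv f (R ^ 2) :=
    h.strictMonoOn_mul_deriv.monotoneOn (show ρ ^ 2 ∈ Ioi (0 : ℝ) from pow_pos hρ 2)
      (show R ^ 2 ∈ Ioi (0 : ℝ) from pow_pos hR 2) (by gcongr)
  unfold verticalForce
  rw [zero_pow two_ne_zero, zero_add, sub_neg, div_lt_iff₀ hR]
  nlinarith

/-- On an inward arc returning to the line `x = 0` all inequalities are strict, and the arc does
not start on the spherical profile. At an interior point of contact, the arc would have to be a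
part of the line `x = 0`, or of the spherical profile, or else be horizontal with vanishing
vertical force, which contradicts the vertical balance of forces. -/
theorem isReturningArc (h : Admissible n f m M) (ha : IsInwardArc n f R T x r θ)
    (hend : x T = 0) {ρ : ℝ} (hρ : 0 < ρ) (hF : ρ ^ 2 * deriv f (ρ ^ 2) = 2 * n) (hρR : ρ ≤ R) :
    IsReturningArc n f R T x r θ ∧ ρ < R := by
  have hloc : ∀ {t : ℝ}, t ∈ Ioo 0 T → ∀ᶠ u in 𝓝 t, u ∈ Icc 0 T := fun ht =>
    Icc_mem_nhds ht.1 ht.2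
  have hxpos : ∀ t ∈ Ioo 0 T, 0 < x t := by
    intro t ht
    have htT := Ioo_subset_Icc_self ht
    refine (ha.x_nonneg t htT).lt_of_ne fun h0 => ?_
    have hmin : IsLocalMin x t := by
      filter_upwards [hloc ht] with u hu
      rw [← h0]; exact ha.x_nonneg u hu
    exact ha.cos_ne_zero_of_x_eq_zero h htT h0.symm
      (hmin.hasDerivAt_eq_zero (ha.solves t htT).x_deriv)
  have hlt : ρ < R := by
    refine hρR.lt_of_ne fun heq => ?_
    refine ha.false_of_circle h hend hρ hF (t := 0) ⟨le_rfl, ha.pos⟩ ?_ ?_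
    · simp [ha.x_zero, ha.theta_zero]
    · simp [ha.r_zero, ha.theta_zero, heq]
  refine ⟨{ ha with x_pos := hxpos, x_end := hend, neg_pi_lt := ?_, radial_neg := ?_ }, hlt⟩
  · intro t ht
    have htT := Ioo_subset_Icc_self ht
    refine (ha.neg_pi_le t htT).lt_of_ne fun h0 => ?_
    have hmin : IsLocalMin θ t := by
      filter_upwards [hloc ht] with u hu
      rw [← h0]; exact ha.neg_pi_le u hu
    have hz := hmin.hasDerivAt_eq_zero (ha.solves t htT).theta_deriv
    rw [angleSpeed_eq_verticalForce, ← h0, Real.cos_neg, Real.cos_pi, Real.sin_neg, Real.sin_pi]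
      at hz
    have := ha.sin_neg_of_verticalForce_nonpos h (verticalForce_neg h hρ hF hρR) htT ht.1
      (by linarith)
    rw [← h0, Real.sin_neg, Real.sin_pi] at this
    linarith
  · intro t ht
    have htT := Ioo_subset_Icc_self ht
    refine (ha.radial_nonpos t htT).lt_of_ne fun h0 => ?_
    have hmax : IsLocalMax (fun t => radialPart (x t) (r t) (θ t)) t := by
      filter_upwards [hloc ht] with u hu
      rw [h0]; exact ha.radial_nonpos u hu
    have hz := hmax.hasDerivAt_eq_zero (ha.solves t htT).hasDerivAt_radialPart
    have hsq := (ha.solves t htT).sq_pos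
    have hr := (ha.solves t htT).r_pos
    have e1 := cos_mul_sq (x t) (r t) (θ t)
    have e2 := sin_mul_sq (x t) (r t) (θ t)
    have e3 := radialPart_sq_add_supportPart_sq (x t) (r t) (θ t)
    rw [h0] at e1 e2 e3
    have hp0 : 0 ≤ supportPart (x t) (r t) (θ t) := by
      have h1 := mul_nonpos_of_nonpos_of_nonneg (ha.sin_nonpos htT) hsq.le
      have h2 := hxpos t ht
      by_contra hneg
      push Not at hneg
      nlinarith [mul_pos h2 (neg_pos.2 hneg)]
    rw [angleSpeed_eq] at hz
    obtain ⟨p, hp⟩ : ∃ p, p = supportPart (x t) (r t) (θ t) := ⟨_, rfl⟩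
    rw [← hp] at e1 e2 e3 hp0 hz
    have e3' : x t ^ 2 + r t ^ 2 = p ^ 2 := by linarith
    rw [e3'] at e1 e2 hsq hz
    have hppos : 0 < p := hp0.lt_of_ne fun h => by rw [← h] at hsq; simp at hsq
    have hcos : r t = p * Real.cos (-θ t) := by
      rw [Real.cos_neg]
      have : p * (r t - p * Real.cos (θ t)) = 0 := by linarith
      rcases mul_eq_zero.1 this with h | h
      · exact absurd h hppos.ne'
      · linarith
    have hsin : x t = p * Real.sin (-θ t) := by
      rw [Real.sin_neg]
      have : p * (x t + p * Real.sin (θ t)) = 0 := by linarith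
      rcases mul_eq_zero.1 this with h | h
      · exact absurd h hppos.ne'
      · linarith
    have hcr : Real.cos (θ t) / r t = 1 / p := by
      rw [Real.cos_neg] at hcos
      rw [div_eq_div_iff hr.ne' hppos.ne', hcos]; ring
    have hF' : p ^ 2 * deriv f (p ^ 2) = 2 * n := by
      have : ((n : ℝ) - 1) * Real.cos (θ t) / r t = ((n : ℝ) - 1) * (1 / p) := by
        rw [mul_div_assoc, hcr]
      rw [this] at hz
      field_simp at hz
      linarith
    exact ha.false_of_circle h hend hppos hF' ⟨ht.1.le, ht.2⟩ hsin hcos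

end IsInwardArc

/-! ### Limits and perturbations of returning arcs -/

theorem continuous_supportPart :
    Continuous fun y : ℝ × ℝ × ℝ => supportPart y.1 y.2.1 y.2.2 := by
  unfold supportPart; fun_prop

theorem continuous_radialPart :
    Continuous fun y : ℝ × ℝ × ℝ => radialPart y.1 y.2.1 y.2.2 := by
  unfold radialPart; fun_prop

/-- The radii for which the curve returns form a set that is closed under decreasing limits, down
to the radius of the spherical profile. -/
theorem Admissible.exists_isReturningArc_of_forall_gt {n : ℕ} {f : ℝ → ℝ} {m M : ℝ}
    (h : Admissible n f m M) {ρ R : ℝ} (hρ : 0 < ρ) (hF : ρ ^ 2 * deriv f (ρ ^ 2) = 2 * n)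
    (hρR : ρ ≤ R) (hret : ∀ R' > R, Returns n f R') :
    ∃ (δ K T : ℝ) (Y : ℝ → ℝ × ℝ × ℝ), 0 < δ ∧ δ ≤ K ∧ IsTruncatedSolution n f δ K Y R ∧
      (∀ t ∈ Icc 0 T, (Y t).1 ∈ Icc (-K) K ∧ (Y t).2.1 ∈ Icc δ K) ∧
      IsReturningArc n f R T (fun t => (Y t).1) (fun t => (Y t).2.1) (fun t => (Y t).2.2) ∧
      ρ < R := by
  obtain ⟨K, hKdef⟩ : ∃ K, K = R + 1 := ⟨_, rfl⟩
  have hK0 : 0 < K := by linarith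
  obtain ⟨δ, hδ, hδρ, hlow⟩ := h.exists_pos_le_r hρ (K := K) (by linarith)
  have hδK : δ ≤ K := by linarith
  obtain ⟨Y, hY⟩ := h.exists_isTruncatedSolution hδ hδK R
  obtain ⟨L, C, hL, -⟩ := h.exists_lipschitzWith_truncatedField (n := n) (f := f) hδ hδK
  have hseq : ∀ k : ℕ, ∃ (T : ℝ) (Z : ℝ → ℝ × ℝ × ℝ), IsReturningArc n f (R + 1 / ((k : ℝ) + 1)) T
      (fun t => (Z t).1) (fun t => (Z t).2.1) (fun t => (Z t).2.2) := by
    intro k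
    have hk : (0 : ℝ) < 1 / ((k : ℝ) + 1) := by positivity
    obtain ⟨T, x, r, θ, ha⟩ := hret (R + 1 / ((k : ℝ) + 1)) (by linarith)
    exact ⟨T, fun t => (x t, r t, θ t), ha⟩
  choose T Z ha using hseq
  have hk1 : ∀ k : ℕ, 1 / ((k : ℝ) + 1) ≤ 1 := fun k => by
    rw [div_le_one (by positivity)]; linarith [(Nat.cast_nonneg k : (0 : ℝ) ≤ k)]
  have hk0 : ∀ k : ℕ, (0 : ℝ) < 1 / ((k : ℝ) + 1) := fun k => by positivity
  have hin : ∀ k : ℕ, IsInwardArc n f (R + 1 / ((k : ℝ) + 1)) (T k) (fun t => (Z k t).1)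
      (fun t => (Z k t).2.1) (fun t => (Z k t).2.2) := fun k => (ha k).toIsInwardArc
  have hT : ∀ k, T k ∈ Icc 0 (4 * K) := fun k => ⟨(hin k).pos.le, by
    have := (hin k).length_le h (ha k).x_end
    linarith [hk1 k]⟩
  have hbox : ∀ k, ∀ t ∈ Icc 0 (T k), (Z k t).1 ∈ Icc 0 K ∧ (Z k t).2.1 ∈ Icc δ K := by
    intro k t ht
    refine ⟨⟨(hin k).x_nonneg t ht, ?_⟩, ?_, ?_⟩
    · have := (hin k).x_le ht
      linarith [hk1 k]
    · exact hlow _ _ _ _ _ (by linarith [hk0 k]) (by linarith [hk1 k]) (hin k) (ha k).x_end t ht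
    · have := (hin k).r_le ht
      linarith [hk1 k]
  have hdist : ∀ k, ∀ t ∈ Icc 0 (T k),
      dist (Z k t) (Y t) ≤ 1 / ((k : ℝ) + 1) * Real.exp (L * (4 * K)) := by
    intro k t ht
    have h1 := dist_le_of_lipschitzWith hL (Y := Z k) (Z := Y) ht.1
      (fun u hu => by
        have hu' : u ∈ Icc 0 (T k) := ⟨hu.1, hu.2.trans ht.2⟩
        obtain ⟨b1, b2⟩ := hbox k u hu'
        exact ((hin k).solves u hu').hasDerivAt_truncatedField
          ⟨by linarith [b1.1], b1.2⟩ b2)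
      (fun u _ => hY.hasDerivAt u)
    have h2 : dist (Z k 0) (Y 0) = 1 / ((k : ℝ) + 1) := by
      have e1 : (Z k 0).1 = 0 := (hin k).x_zero
      have e2 : (Z k 0).2.1 = R + 1 / ((k : ℝ) + 1) := (hin k).r_zero
      have e3 : (Z k 0).2.2 = 0 := (hin k).theta_zero
      rw [hY.init, show Z k 0 = (0, R + 1 / ((k : ℝ) + 1), 0) from
        Prod.ext e1 (Prod.ext e2 e3)]
      simp only [Prod.dist_eq, dist_self, Real.dist_eq, add_sub_cancel_left]
      rw [abs_of_pos (hk0 k), max_eq_left (hk0 k).le, max_eq_right (hk0 k).le]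
    rw [h2] at h1
    refine h1.trans (mul_le_mul_of_nonneg_left (Real.exp_le_exp.2 ?_) (hk0 k).le)
    have := ht.2.trans (hT k).2
    rw [sub_zero]
    exact mul_le_mul_of_nonneg_left this L.coe_nonneg
  obtain ⟨T', hT', φ, hφ, hlim⟩ := isCompact_Icc.tendsto_subseq hT
  have hconv : ∀ (τ : ℕ → ℝ) (t : ℝ), (∀ k, τ k ∈ Icc 0 (T (φ k))) → Tendsto τ atTop (𝓝 t) →
      Tendsto (fun k => Z (φ k) (τ k)) atTop (𝓝 (Y t)) := by
    intro τ t hτ hτt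
    have h1 : Tendsto (fun k => Y (τ k)) atTop (𝓝 (Y t)) := (hY.continuous.tendsto t).comp hτt
    refine h1.congr_dist ?_
    have h2 : Tendsto (fun k => 1 / ((φ k : ℝ) + 1) * Real.exp (L * (4 * K))) atTop (𝓝 0) := by
      have := (tendsto_one_div_add_atTop_nhds_zero_nat (𝕜 := ℝ)).comp hφ.tendsto_atTop
      simpa using this.mul_const (Real.exp (L * (4 * K)))
    refine squeeze_zero (fun _ => dist_nonneg) (fun k => ?_) h2
    rw [dist_comm]
    exact hdist (φ k) (τ k) (hτ k)
  have hend := hconv (fun k => T (φ k)) T' (fun k => ⟨(hT (φ k)).1, le_rfl⟩) hlim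
  have hxend : (Y T').1 = 0 := by
    refine tendsto_nhds_unique ((continuous_fst.tendsto _).comp hend) ?_
    refine tendsto_const_nhds.congr fun k => ?_
    exact (ha (φ k)).x_end.symm
  have hcosend : Real.cos (Y T').2.2 ≤ 0 := by
    refine le_of_tendsto ((Real.continuous_cos.tendsto _).comp
      ((continuous_snd.snd.tendsto _).comp hend)) (Eventually.of_forall fun k => ?_)
    obtain ⟨τ, hτ, -, hτ2⟩ := (hin (φ k)).exists_turning_time h (ha (φ k)).x_end
    exact hτ2 _ ⟨hτ.2, le_rfl⟩
  have hT'0 : 0 < T' := by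
    refine hT'.1.lt_of_ne fun h0 => ?_
    rw [← h0, hY.init] at hcosend
    simp only [Real.cos_zero] at hcosend
    linarith
  have hlim' : ∀ t ∈ Icc 0 T', Tendsto (fun k => Z (φ k) (min t (T (φ k)))) atTop (𝓝 (Y t)) := by
    intro t ht
    refine hconv (fun k => min t (T (φ k))) t
      (fun k => ⟨le_min ht.1 (hT _).1, min_le_right _ _⟩) ?_
    have := (tendsto_const_nhds (x := t)).min hlim
    rwa [min_eq_left ht.2] at this
  have hmem : ∀ t ∈ Icc 0 T', ∀ k, min t (T (φ k)) ∈ Icc 0 (T (φ k)) := fun t ht k =>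
    ⟨le_min ht.1 (hT _).1, min_le_right _ _⟩
  have hlimit : ∀ (F : ℝ × ℝ × ℝ → ℝ) (S : Set ℝ), Continuous F → IsClosed S →
      (∀ k, ∀ t ∈ Icc 0 (T k), F (Z k t) ∈ S) → ∀ t ∈ Icc 0 T', F (Y t) ∈ S :=
    fun F S hFc hS hk t ht => hS.mem_of_tendsto ((hFc.tendsto _).comp (hlim' t ht))
      (Eventually.of_forall fun k => hk _ _ (hmem t ht k))
  have hx : ∀ t ∈ Icc 0 T', (Y t).1 ∈ Icc 0 K := hlimit (fun y => y.1) _ continuous_fst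
    isClosed_Icc fun k t ht => (hbox k t ht).1
  have hr : ∀ t ∈ Icc 0 T', (Y t).2.1 ∈ Icc δ K := hlimit (fun y => y.2.1) _ (by fun_prop)
    isClosed_Icc fun k t ht => (hbox k t ht).2
  have hθ : ∀ t ∈ Icc 0 T', (Y t).2.2 ∈ Ici (-Real.pi) := hlimit (fun y => y.2.2) _
    (by fun_prop) isClosed_Ici fun k t ht => (hin k).neg_pi_le t ht
  have hB : ∀ t ∈ Icc 0 T', radialPart (Y t).1 (Y t).2.1 (Y t).2.2 ∈ Iic 0 :=
    hlimit (fun y => radialPart y.1 y.2.1 y.2.2) _ continuous_radialPart isClosed_Iic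
      fun k t ht => (hin k).radial_nonpos t ht
  have hbox' : ∀ t ∈ Icc 0 T', (Y t).1 ∈ Icc (-K) K ∧ (Y t).2.1 ∈ Icc δ K := fun t ht =>
    ⟨⟨by linarith [(hx t ht).1], (hx t ht).2⟩, hr t ht⟩
  have harc : IsInwardArc n f R T' (fun t => (Y t).1) (fun t => (Y t).2.1)
      (fun t => (Y t).2.2) :=
    { pos := hT'0
      x_zero := by rw [hY.init]
      r_zero := by rw [hY.init]
      theta_zero := by rw [hY.init]
      solves := fun t ht => hY.solvesAt hδ (hbox' t ht).1 (hbox' t ht).2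
      x_nonneg := fun t ht => (hx t ht).1
      neg_pi_le := hθ
      radial_nonpos := hB }
  obtain ⟨hfin, hlt⟩ := harc.isReturningArc h hxend hρ hF hρR
  exact ⟨δ, K, T', Y, hδ, hδK, hY, hbox', hfin, hlt⟩

/-- Solutions starting close to a given one stay in a neighbourhood of it during a compact
time interval. -/
theorem Admissible.exists_forall_mem_of_isOpen {n : ℕ} {f : ℝ → ℝ} {m M : ℝ}
    (h : Admissible n f m M) {δ K R a b : ℝ} (hδ : 0 < δ) (hδK : δ ≤ K) {Y : ℝ → ℝ × ℝ × ℝ}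
    (hY : IsTruncatedSolution n f δ K Y R) (ha : 0 ≤ a) {U : Set (ℝ × ℝ × ℝ)} (hU : IsOpen U)
    (hYU : ∀ t ∈ Icc a b, Y t ∈ U) :
    ∃ ε > 0, ∀ (R' : ℝ) (Z : ℝ → ℝ × ℝ × ℝ), |R' - R| < ε → IsTruncatedSolution n f δ K Z R' →
      ∀ t ∈ Icc a b, Z t ∈ U := by
  obtain ⟨L, C, hL, -⟩ := h.exists_lipschitzWith_truncatedField (n := n) (f := f) hδ hδK
  obtain ⟨η, hη, hsub⟩ := (isCompact_Icc.image hY.continuous).exists_thickening_subset_open hU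
    (image_subset_iff.2 hYU : Y '' Icc a b ⊆ U)
  refine ⟨η / Real.exp (L * b), by positivity, fun R' Z hR' hZ t ht => hsub ?_⟩
  rw [Metric.mem_thickening_iff]
  refine ⟨Y t, mem_image_of_mem _ ht, ?_⟩
  have h1 := dist_le_of_lipschitzWith hL (ha.trans ht.1) (fun u _ => hZ.hasDerivAt u)
    (fun u _ => hY.hasDerivAt u)
  have h2 : dist (Z 0) (Y 0) = |R' - R| := by
    rw [hZ.init, hY.init]
    simp only [Prod.dist_eq, dist_self, Real.dist_eq]
    rw [max_eq_left (abs_nonneg (R' - R)), max_eq_right (abs_nonneg (R' - R))]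
  rw [h2, sub_zero] at h1
  refine h1.trans_lt ?_
  have h3 : Real.exp (L * t) ≤ Real.exp (L * b) :=
    Real.exp_le_exp.2 (mul_le_mul_of_nonneg_left ht.2 L.coe_nonneg)
  rw [lt_div_iff₀ (Real.exp_pos _)] at hR'
  exact (mul_le_mul_of_nonneg_left h3 (abs_nonneg _)).trans_lt hR'

/-- The curves starting close to a returning arc either return as well, or they are stopped off
the line `x = 0` because the angle reaches `-π`. The latter is impossible if the given arc ends
with an angle larger than `-π`. -/
theorem IsReturningArc.exists_forall_returns_or {n : ℕ} {f : ℝ → ℝ} {m M : ℝ}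
    (h : Admissible n f m M) {ρ R T : ℝ} {x r θ : ℝ → ℝ} (ha : IsReturningArc n f R T x r θ)
    (hρ : 0 < ρ) (hF : ρ ^ 2 * deriv f (ρ ^ 2) = 2 * n) (hρR : ρ < R) :
    ∃ ε > 0, ∀ R', |R' - R| < ε → (Returns n f R' ∨ ¬ StopsOnAxis n f R') ∧
      (-Real.pi < θ T → Returns n f R') := by
  have hin := ha.toIsInwardArc
  have hπ := Real.pi_pos
  have hT := hin.pos
  have hR := hin.radius_pos
  have hrT : 0 < r T := (hin.solves T hin.end_mem).r_pos
  obtain ⟨δ, hδdef⟩ : ∃ δ, δ = r T / 2 := ⟨_, rfl⟩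
  obtain ⟨K, hKdef⟩ : ∃ K, K = R + 1 := ⟨_, rfl⟩
  have hδ : 0 < δ := by linarith
  have hδK : δ ≤ K := by linarith [hin.r_le hin.end_mem]
  obtain ⟨Y, hY⟩ := h.exists_isTruncatedSolution hδ hδK R
  obtain ⟨L, C, hL, -⟩ := h.exists_lipschitzWith_truncatedField (n := n) (f := f) hδ hδK
  have hFc : Continuous fun y => (truncatedField n f δ K y).2.2 :=
    continuous_snd.snd.comp hL.continuous
  have hYeq : ∀ t ∈ Icc 0 T, Y t = (x t, r t, θ t) := by
    intro t ht
    have h1 := dist_le_of_lipschitzWith hL (Y := Y) (Z := fun t => (x t, r t, θ t)) ht.1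
      (fun u _ => hY.hasDerivAt u) (fun u hu => by
        have hu' := hin.sub_mem hin.zero_mem ht hu
        refine (hin.solves u hu').hasDerivAt_truncatedField
          ⟨by linarith [hin.x_nonneg u hu'], by linarith [hin.x_le hu']⟩
          ⟨by linarith [hin.r_antitone hu' hin.end_mem hu'.2], by linarith [hin.r_le hu']⟩)
    rw [hY.init, hin.x_zero, hin.r_zero, hin.theta_zero, dist_self, zero_mul] at h1
    exact dist_le_zero.1 h1
  -- The angle at the end lies in `[-π, -π / 2)`.
  have hcosT : Real.cos (θ T) < 0 := by
    obtain ⟨τ, hτ, -, hτ2⟩ := hin.exists_turning_time h ha.x_end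
    exact (hτ2 T ⟨hτ.2, le_rfl⟩).lt_of_ne (hin.cos_ne_zero_of_x_eq_zero h hin.end_mem ha.x_end)
  have hθT : θ T < -(Real.pi / 2) := by
    by_contra hcon
    push Not at hcon
    exact hcosT.not_ge (Real.cos_nonneg_of_mem_Icc
      ⟨hcon, by linarith [hin.theta_nonpos hin.end_mem]⟩)
  have hθT' := hin.neg_pi_le T hin.end_mem
  let Bx : Set (ℝ × ℝ × ℝ) := {y | -K < y.1 ∧ y.1 < K ∧ δ < y.2.1 ∧ y.2.1 < K}
  have hBx : IsOpen Bx := by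
    refine (isOpen_lt ?_ ?_).and ((isOpen_lt ?_ ?_).and ((isOpen_lt ?_ ?_).and
      (isOpen_lt ?_ ?_))) <;> fun_prop
  have hYBx : ∀ t ∈ Icc 0 T, Y t ∈ Bx := by
    intro t ht
    rw [hYeq t ht]
    exact ⟨by linarith [hin.x_nonneg t ht], by linarith [hin.x_le ht],
      by linarith [hin.r_antitone ht hin.end_mem ht.2], by linarith [hin.r_le ht]⟩
  have hsolves : ∀ {Z : ℝ → ℝ × ℝ × ℝ} {R' t : ℝ}, IsTruncatedSolution n f δ K Z R' → Z t ∈ Bx →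
      SolvesAt n f (fun t => (Z t).1) (fun t => (Z t).2.1) (fun t => (Z t).2.2) t :=
    fun hZ hb => hZ.solvesAt hδ ⟨hb.1.le, hb.2.1.le⟩ ⟨hb.2.2.1.le, hb.2.2.2.le⟩
  let U₀ : Set (ℝ × ℝ × ℝ) := {y | 0 < Real.cos y.2.2 ∧ -Real.pi < y.2.2 ∧
    1 + supportPart y.1 y.2.1 y.2.2 * (truncatedField n f δ K y).2.2 < 0} ∩ Bx
  have hU₀ : IsOpen U₀ := by
    have := continuous_supportPart
    refine IsOpen.inter ((isOpen_lt ?_ ?_).and ((isOpen_lt ?_ ?_).and (isOpen_lt ?_ ?_))) hBx <;>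
      fun_prop
  let U₁ : Set (ℝ × ℝ × ℝ) := {y | 0 < y.1 ∧ -Real.pi < y.2.2 ∧
    radialPart y.1 y.2.1 y.2.2 < 0} ∩ Bx
  have hU₁ : IsOpen U₁ := by
    have := continuous_radialPart
    refine IsOpen.inter ((isOpen_lt ?_ ?_).and ((isOpen_lt ?_ ?_).and (isOpen_lt ?_ ?_))) hBx <;>
      fun_prop
  obtain ⟨c, hc1, hc2, hc3⟩ : ∃ c, -(3 * Real.pi / 2) ≤ c ∧ c < θ T ∧
      (-Real.pi < θ T → -Real.pi ≤ c) := by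
    by_cases hθ : -Real.pi < θ T
    · exact ⟨-Real.pi, by linarith, hθ, fun _ => le_rfl⟩
    · exact ⟨-(3 * Real.pi / 2), le_rfl, by linarith, fun h => absurd h hθ⟩
  let U₂ : Set (ℝ × ℝ × ℝ) := {y | c < y.2.2 ∧ y.2.2 < -(Real.pi / 2)} ∩ Bx
  have hU₂ : IsOpen U₂ := by
    refine IsOpen.inter ((isOpen_lt ?_ ?_).and (isOpen_lt ?_ ?_)) hBx <;> fun_prop
  have hU₂cos : ∀ y ∈ U₂, Real.cos y.2.2 < 0 := by
    intro y hy
    rw [← Real.cos_neg]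
    exact Real.cos_neg_of_pi_div_two_lt_of_lt (by linarith [hy.1.2]) (by linarith [hy.1.1])
  -- The initial, the final and the middle part of the time interval.
  have hnear0 : Y 0 ∈ U₀ := by
    have hb := hYBx 0 hin.zero_mem
    refine ⟨?_, hb⟩
    have hR2 : 2 * n < R ^ 2 * deriv f (R ^ 2) := by
      rw [← hF]
      exact h.strictMonoOn_mul_deriv (show ρ ^ 2 ∈ Ioi (0 : ℝ) from pow_pos hρ 2)
        (show R ^ 2 ∈ Ioi (0 : ℝ) from pow_pos hR 2) (by gcongr)
    rw [mem_ofPred_eq, truncatedField_eq_of_mem ⟨hb.1.le, hb.2.1.le⟩ ⟨hb.2.2.1.le, hb.2.2.2.le⟩,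
      hY.init]
    refine ⟨by simp, by simpa using hπ, ?_⟩
    have : 1 + supportPart 0 R 0 * angleSpeed n f 0 R 0 = n - R ^ 2 * deriv f (R ^ 2) / 2 := by
      simp only [supportPart, angleSpeed, Real.cos_zero, Real.sin_zero]
      rw [zero_pow two_ne_zero, zero_add]
      field_simp
      ring
    show 1 + supportPart 0 R 0 * angleSpeed n f 0 R 0 < 0
    linarith
  have hnearT : Y T ∈ U₂ := by
    refine ⟨?_, hYBx T hin.end_mem⟩
    rw [hYeq T hin.end_mem]
    exact ⟨hc2, hθT⟩
  obtain ⟨η₀, hη₀, hη₀U⟩ := Metric.mem_nhds_iff.1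
    (hY.continuous.continuousAt.preimage_mem_nhds (hU₀.mem_nhds hnear0))
  obtain ⟨η₁, hη₁, hη₁U⟩ := Metric.mem_nhds_iff.1
    (hY.continuous.continuousAt.preimage_mem_nhds (hU₂.mem_nhds hnearT))
  obtain ⟨a, hadef⟩ : ∃ a, a = min (η₀ / 2) (T / 4) := ⟨_, rfl⟩
  obtain ⟨η, hηdef⟩ : ∃ η, η = min (η₁ / 2) (T / 4) := ⟨_, rfl⟩
  have ha0 : 0 < a := hadef ▸ lt_min (by linarith) (by linarith)
  have haT : a ≤ T / 4 := hadef ▸ min_le_right _ _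
  have haη : a ≤ η₀ / 2 := hadef ▸ min_le_left _ _
  have hη0 : 0 < η := hηdef ▸ lt_min (by linarith) (by linarith)
  have hηT : η ≤ T / 4 := hηdef ▸ min_le_right _ _
  have hηη : η ≤ η₁ / 2 := hηdef ▸ min_le_left _ _
  have hYU₀ : ∀ t ∈ Icc 0 a, Y t ∈ U₀ := fun t ht => hη₀U (by
    rw [Metric.mem_ball, Real.dist_eq, abs_lt]
    constructor <;> linarith [ht.1, ht.2])
  have hYU₂ : ∀ t ∈ Icc (T - η) (T + η), Y t ∈ U₂ := fun t ht => hη₁U (by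
    rw [Metric.mem_ball, Real.dist_eq, abs_lt]
    constructor <;> linarith [ht.1, ht.2])
  have hYU₁ : ∀ t ∈ Icc a (T - η), Y t ∈ U₁ := by
    intro t ht
    have ht' : t ∈ Ioo 0 T := ⟨ha0.trans_le ht.1, by linarith [ht.2]⟩
    refine ⟨?_, hYBx t (Ioo_subset_Icc_self ht')⟩
    rw [hYeq t (Ioo_subset_Icc_self ht')]
    exact ⟨ha.x_pos t ht', ha.neg_pi_lt t ht', ha.radial_neg t ht'⟩
  have hYend : (Y (T + η)).1 < 0 := by
    have h1 := lt_of_forall_hasDerivAt_neg (φ := fun t => (Y t).1) (a := T) (b := T + η)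
      (by linarith) (fun t _ => hY.hasDerivAt_fst t)
      (fun t ht => hU₂cos _ (hYU₂ t ⟨by linarith [ht.1], ht.2.le⟩))
    have h2 : (Y T).1 = 0 := by rw [hYeq T hin.end_mem]; exact ha.x_end
    exact h1.trans_eq h2
  obtain ⟨ε₀, hε₀, H₀⟩ := h.exists_forall_mem_of_isOpen hδ hδK hY le_rfl hU₀ hYU₀
  obtain ⟨ε₁, hε₁, H₁⟩ := h.exists_forall_mem_of_isOpen hδ hδK hY ha0.le hU₁ hYU₁
  obtain ⟨ε₂, hε₂, H₂⟩ := h.exists_forall_mem_of_isOpen hδ hδK hY (by linarith) hU₂ hYU₂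
  obtain ⟨ε₃, hε₃, H₃⟩ := h.exists_forall_mem_of_isOpen hδ hδK hY (a := T + η) (b := T + η)
    (by linarith) (isOpen_lt continuous_fst continuous_const)
    (fun t ht => by rw [le_antisymm ht.2 ht.1]; exact hYend)
  refine ⟨min (min ε₀ ε₁) (min (min ε₂ ε₃) (R - ρ)), by
    simp only [lt_min_iff, gt_iff_lt]; exact ⟨⟨hε₀, hε₁⟩, ⟨hε₂, hε₃⟩, by linarith⟩, ?_⟩
  intro R' hR'
  simp only [lt_min_iff] at hR'
  obtain ⟨⟨e0, e1⟩, ⟨e2, e3⟩, e4⟩ := hR'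
  have hρR' : ρ ≤ R' := by linarith [(abs_lt.1 e4).1]
  obtain ⟨Z, hZ⟩ := h.exists_isTruncatedSolution hδ hδK R'
  have Z0 := H₀ R' Z e0 hZ
  have Z1 := H₁ R' Z e1 hZ
  have Z2 := H₂ R' Z e2 hZ
  have Z3 : (Z (T + η)).1 < 0 := H₃ R' Z e3 hZ (T + η) ⟨le_rfl, le_rfl⟩
  have hZbox : ∀ t ∈ Icc 0 (T + η), Z t ∈ Bx := by
    intro t ht
    rcases le_total t a with h1 | h1
    · exact (Z0 t ⟨ht.1, h1⟩).2
    · rcases le_total t (T - η) with h2 | h2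
      · exact (Z1 t ⟨h1, h2⟩).2
      · exact (Z2 t ⟨h2, ht.2⟩).2
  have hxpos0 : ∀ t ∈ Ioc 0 a, 0 < (Z t).1 := by
    intro t ht
    have := lt_of_forall_hasDerivAt_neg (φ := fun t => -(Z t).1) ht.1
      (fun t _ => (hZ.hasDerivAt_fst t).neg)
      (fun u hu => neg_neg_of_pos (Z0 u ⟨hu.1.le, hu.2.le.trans ht.2⟩).1.1)
    simp only [hZ.init] at this
    linarith
  have hBneg0 : ∀ t ∈ Ioc 0 a, radialPart (Z t).1 (Z t).2.1 (Z t).2.2 < 0 := by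
    intro t ht
    have := lt_of_forall_hasDerivAt_neg
      (φ := fun t => radialPart (Z t).1 (Z t).2.1 (Z t).2.2) ht.1
      (fun u hu => (hsolves hZ (Z0 u ⟨hu.1, hu.2.trans ht.2⟩).2).hasDerivAt_radialPart)
      (fun u hu => by
        have hu0 := Z0 u ⟨hu.1.le, hu.2.le.trans ht.2⟩
        have hb := hu0.2
        have := hu0.1.2.2
        rwa [truncatedField_eq_of_mem ⟨hb.1.le, hb.2.1.le⟩ ⟨hb.2.2.1.le, hb.2.2.2.le⟩] at this)
    simpa only [hZ.init, radialPart, Real.sin_zero, zero_mul, mul_zero, add_zero] using this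
  obtain ⟨T', hT', hxT'⟩ := intermediate_value_Icc' (a := T - η) (b := T + η) (by linarith)
    (fun t _ => (hZ.hasDerivAt_fst t).continuousAt.continuousWithinAt)
    (show (0 : ℝ) ∈ Icc (Z (T + η)).1 (Z (T - η)).1 from
      ⟨Z3.le, (Z1 (T - η) ⟨by linarith, le_rfl⟩).1.1.le⟩)
  have hxT'' : (Z T').1 = 0 := hxT'
  have hT'lt : T - η < T' := by
    refine hT'.1.lt_of_ne fun heq => ?_
    have := (Z1 (T - η) ⟨by linarith, le_rfl⟩).1.1
    rw [heq, hxT''] at this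
    exact lt_irrefl _ this
  have hxpos2 : ∀ t ∈ Ico (T - η) T', 0 < (Z t).1 := by
    intro t ht
    have := lt_of_forall_hasDerivAt_neg (φ := fun t => (Z t).1) ht.2
      (fun t _ => hZ.hasDerivAt_fst t)
      (fun u hu => hU₂cos _ (Z2 u ⟨ht.1.trans hu.1.le, hu.2.le.trans hT'.2⟩))
    exact hxT''.symm.trans_lt this
  have hxpos : ∀ t ∈ Ioo 0 T', 0 < (Z t).1 := by
    intro t ht
    rcases le_total t a with h1 | h1
    · exact hxpos0 t ⟨ht.1, h1⟩
    · rcases le_total t (T - η) with h2 | h2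
      · exact (Z1 t ⟨h1, h2⟩).1.1
      · exact hxpos2 t ⟨h2, ht.2⟩
  have hsolveT' : ∀ t ∈ Icc 0 T',
      SolvesAt n f (fun t => (Z t).1) (fun t => (Z t).2.1) (fun t => (Z t).2.2) t :=
    fun t ht => hsolves hZ (hZbox t ⟨ht.1, ht.2.trans hT'.2⟩)
  have hθearly : ∀ t ∈ Icc 0 (T - η), -Real.pi < (Z t).2.2 := by
    intro t ht
    rcases le_total t a with h1 | h1
    · exact (Z0 t ⟨ht.1, h1⟩).1.2.1
    · exact (Z1 t ⟨h1, ht.2⟩).1.2.1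
  have hreturn : (∀ t ∈ Icc 0 T', -Real.pi ≤ (Z t).2.2) → Returns n f R' := by
    intro hθ
    refine ⟨T', _, _, _, (IsInwardArc.isReturningArc (x := fun t => (Z t).1)
      (r := fun t => (Z t).2.1) (θ := fun t => (Z t).2.2) h ?_ hxT'' hρ hF hρR').1⟩
    refine
      { pos := by linarith
        x_zero := by rw [hZ.init]
        r_zero := by rw [hZ.init]
        theta_zero := by rw [hZ.init]
        solves := hsolveT'
        x_nonneg := ?_
        neg_pi_le := hθ
        radial_nonpos := ?_ }
    · intro t ht
      rcases ht.1.eq_or_lt with h0 | h0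
      · rw [← h0, hZ.init]
      · rcases ht.2.eq_or_lt with h1 | h1
        · rw [h1]; exact hxT''.ge
        · exact (hxpos t ⟨h0, h1⟩).le
    · intro t ht
      rcases ht.1.eq_or_lt with h0 | h0
      · simp [← h0, hZ.init, radialPart]
      rcases le_total t a with h1 | h1
      · exact (hBneg0 t ⟨h0, h1⟩).le
      rcases le_total t (T - η) with h2 | h2
      · exact (Z1 t ⟨h1, h2⟩).1.2.2.le
      have hz := Z2 t ⟨h2, ht.2.trans hT'.2⟩
      have hcos := hU₂cos _ hz
      have hsin := Real.sin_nonpos_of_nonpos_of_neg_pi_le (by linarith [hz.1.2]) (hθ t ht)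
      have hx0 : 0 ≤ (Z t).1 := by
        rcases ht.2.eq_or_lt with h3 | h3
        · rw [h3]; exact hxT''.ge
        · exact (hxpos t ⟨h0, h3⟩).le
      have hr0 : 0 < (Z t).2.1 := (hsolveT' t ht).r_pos
      unfold radialPart
      exact add_nonpos (mul_nonpos_of_nonneg_of_nonpos hx0 hcos.le)
        (mul_nonpos_of_nonneg_of_nonpos hr0.le hsin)
  refine ⟨?_, fun hθ => hreturn fun t ht => ?_⟩
  · by_cases hc : ∀ t ∈ Icc 0 T', -Real.pi ≤ (Z t).2.2
    · exact Or.inl (hreturn hc)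
    · right
      push Not at hc
      obtain ⟨t, ht, hlt⟩ := hc
      have htlate : T - η < t := by
        by_contra hcon
        push Not at hcon
        linarith [hθearly t ⟨ht.1, hcon⟩]
      -- A time before `t` at which the angle is still below `-π`.
      obtain ⟨u, hu1, hu2⟩ : ∃ u, (Z u).2.2 < -Real.pi ∧ u ∈ Ioo (T - η) t := by
        have h1 : ∀ᶠ u in 𝓝[<] t, (Z u).2.2 < -Real.pi :=
          ((continuous_snd.snd.comp hZ.continuous).continuousAt.eventually_lt_const hlt).filter_mono
            nhdsWithin_le_nhds
        exact (h1.and (Ioo_mem_nhdsLT htlate)).exists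
      have hu0 : 0 < u := by linarith [hu2.1]
      exact h.not_stopsOnAxis (x := fun t => (Z t).1) (r := fun t => (Z t).2.1)
        (θ := fun t => (Z t).2.2) hu0 (by rw [hZ.init]) (by rw [hZ.init]) (by rw [hZ.init])
        (fun v hv => hsolveT' v ⟨hv.1, hv.2.trans (hu2.2.le.trans ht.2)⟩)
        (fun v hv => hxpos v ⟨hv.1, hv.2.trans_lt (hu2.2.trans_le ht.2)⟩) hu1.le
  · rcases le_total t (T - η) with h2 | h2
    · exact (hθearly t ⟨ht.1, h2⟩).le
    · linarith [(Z2 t ⟨h2, ht.2.trans hT'.2⟩).1.1, hc3 hθ]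

/-! ### The first part of a curve starting far away from the origin -/

/-- First exit time of a continuous curve from an open set. -/
theorem exists_first_exit {E : Type*} [TopologicalSpace E] {Y : ℝ → E} (hY : Continuous Y)
    {U : Set E} (hU : IsOpen U) {a b : ℝ} (hab : a ≤ b) (ha : Y a ∈ U) (hb : Y b ∉ U) :
    ∃ τ ∈ Ioc a b, Y τ ∉ U ∧ Y τ ∈ closure U ∧ ∀ t ∈ Ico a τ, Y t ∈ U := by
  have hcomp : IsCompact (Icc a b ∩ Y ⁻¹' Uᶜ) :=
    isCompact_Icc.inter_right (hU.isClosed_compl.preimage hY)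
  obtain ⟨τ, hτ, hmin⟩ := hcomp.exists_isLeast ⟨b, right_mem_Icc.2 hab, hb⟩
  have hlt : a < τ := hτ.1.1.lt_of_ne fun h => hτ.2 (h ▸ ha)
  have hbefore : ∀ t ∈ Ico a τ, Y t ∈ U := fun t ht => by
    by_contra hcon
    exact (hmin ⟨⟨ht.1, ht.2.le.trans hτ.1.2⟩, hcon⟩).not_gt ht.2
  refine ⟨τ, ⟨hlt, hτ.1.2⟩, hτ.2, ?_, hbefore⟩
  refine mem_closure_of_tendsto (b := 𝓝[<] τ)
    (hY.continuousAt.tendsto.mono_left nhdsWithin_le_nhds) ?_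
  filter_upwards [Ioo_mem_nhdsLT hlt] with t ht
  exact hbefore t ⟨ht.1.le, ht.2⟩

/-- An arc starting at height `R` along which the support function is positive, up to the end,
outside of the disc of radius `b`, and with `x ≤ r`. -/
structure IsEarlyArc (n : ℕ) (f : ℝ → ℝ) (b R T : ℝ) (x r θ : ℝ → ℝ) : Prop where
  pos : 0 < T
  x_zero : x 0 = 0
  r_zero : r 0 = R
  theta_zero : θ 0 = 0
  solves : ∀ t ∈ Icc 0 T, SolvesAt n f x r θ t
  support_pos : ∀ t ∈ Ico 0 T, 0 < supportPart (x t) (r t) (θ t)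
  support_nonneg : ∀ t ∈ Icc 0 T, 0 ≤ supportPart (x t) (r t) (θ t)
  sq_ge : ∀ t ∈ Icc 0 T, b ^ 2 ≤ x t ^ 2 + r t ^ 2
  x_le_r : ∀ t ∈ Icc 0 T, x t ≤ r t

namespace IsEarlyArc

variable {n : ℕ} {f : ℝ → ℝ} {m M b R T : ℝ} {x r θ : ℝ → ℝ}

theorem end_mem (ha : IsEarlyArc n f b R T x r θ) : T ∈ Icc 0 T := right_mem_Icc.2 ha.pos.le

theorem radius_pos (ha : IsEarlyArc n f b R T x r θ) : 0 < R :=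
  ha.r_zero ▸ (ha.solves 0 (left_mem_Icc.2 ha.pos.le)).r_pos

theorem radial_neg (h : Admissible n f m M) (ha : IsEarlyArc n f b R T x r θ)
    (hb : 40 * n ≤ m * b ^ 2) {t : ℝ} (ht : t ∈ Ioc 0 T) :
    radialPart (x t) (r t) (θ t) < 0 := by
  refine neg_of_hasDerivAt_neg_of_eq_zero (φ := fun t => radialPart (x t) (r t) (θ t))
    (fun u hu => (ha.solves u hu).hasDerivAt_radialPart) ?_ (fun u hu hB => ?_) ht
  · simp [radialPart, ha.x_zero, ha.theta_zero]
  have hs := (ha.solves u hu).sq_pos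
  have hr := (ha.solves u hu).r_pos
  have e1 := cos_mul_sq (x u) (r u) (θ u)
  have e3 := radialPart_sq_add_supportPart_sq (x u) (r u) (θ u)
  rw [hB] at e1 e3
  have hsq := ha.sq_ge u hu
  have hg := (h.bound _ hs).1
  have hn := h.two_le_cast
  have hm := h.m_pos
  rw [angleSpeed_eq]
  generalize supportPart (x u) (r u) (θ u) = p at *
  generalize x u ^ 2 + r u ^ 2 = s at *
  have hc : Real.cos (θ u) / r u = p / s := by
    rw [div_eq_div_iff hr.ne' hs.ne']; linarith
  have e4 : p * (p / s) = 1 := by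
    rw [← mul_div_assoc, div_eq_one_iff_eq hs.ne']; linarith
  have e5 : 1 + p * (((n : ℝ) - 1) * Real.cos (θ u) / r u - deriv f s / 2 * p)
      = n - deriv f s / 2 * s := by
    rw [mul_div_assoc, hc]
    linear_combination ((n : ℝ) - 1) * e4 - deriv f s / 2 * e3
  rw [e5]
  have h1 : m * b ^ 2 ≤ deriv f s * s := mul_le_mul hg hsq (sq_nonneg b) (by linarith)
  linarith

theorem radial_nonpos (h : Admissible n f m M) (ha : IsEarlyArc n f b R T x r θ)
    (hb : 40 * n ≤ m * b ^ 2) {t : ℝ} (ht : t ∈ Icc 0 T) :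
    radialPart (x t) (r t) (θ t) ≤ 0 := by
  rcases ht.1.eq_or_lt with h0 | h0
  · simp [← h0, radialPart, ha.x_zero, ha.theta_zero]
  · exact (ha.radial_neg h hb ⟨h0, ht.2⟩).le

theorem div_monotone (ha : IsEarlyArc n f b R T x r θ) {t u : ℝ} (ht : 0 ≤ t) (htu : t ≤ u)
    (hu : u ≤ T) : x t / r t ≤ x u / r u := by
  have := le_of_forall_hasDerivAt_nonpos (φ := fun t => -(x t / r t)) htu
    (fun v hv => (ha.solves v ⟨ht.trans hv.1, hv.2.trans hu⟩).hasDerivAt_div.neg)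
    (fun v hv => by
      have := ha.support_nonneg v ⟨ht.trans hv.1.le, hv.2.le.trans hu⟩
      have := (ha.solves v ⟨ht.trans hv.1.le, hv.2.le.trans hu⟩).r_pos
      rw [neg_nonpos]; positivity)
  linarith

theorem x_pos (ha : IsEarlyArc n f b R T x r θ) {t : ℝ} (ht : t ∈ Ioc 0 T) : 0 < x t := by
  have := lt_of_forall_hasDerivAt_neg (φ := fun t => -(x t / r t)) ht.1
    (fun v hv => (ha.solves v ⟨hv.1, hv.2.trans ht.2⟩).hasDerivAt_div.neg)
    (fun v hv => by
      have := ha.support_pos v ⟨hv.1.le, hv.2.trans_le ht.2⟩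
      have := (ha.solves v ⟨hv.1.le, hv.2.le.trans ht.2⟩).r_pos
      rw [neg_lt_zero]; positivity)
  rw [ha.x_zero, zero_div, neg_zero, neg_lt_zero] at this
  exact (div_pos_iff_of_pos_right (ha.solves t (Ioc_subset_Icc_self ht)).r_pos).1 this

theorem x_nonneg (ha : IsEarlyArc n f b R T x r θ) {t : ℝ} (ht : t ∈ Icc 0 T) : 0 ≤ x t := by
  rcases ht.1.eq_or_lt with h0 | h0
  · rw [← h0, ha.x_zero]
  · exact (ha.x_pos ⟨h0, ht.2⟩).le

theorem sq_le_two_mul (ha : IsEarlyArc n f b R T x r θ) {t : ℝ} (ht : t ∈ Icc 0 T) :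
    x t ^ 2 + r t ^ 2 ≤ 2 * r t ^ 2 := by
  have := pow_le_pow_left₀ (ha.x_nonneg ht) (ha.x_le_r t ht) 2
  linarith

theorem sq_antitone (h : Admissible n f m M) (ha : IsEarlyArc n f b R T x r θ)
    (hb : 40 * n ≤ m * b ^ 2) {t u : ℝ} (ht : 0 ≤ t) (htu : t ≤ u) (hu : u ≤ T) :
    x u ^ 2 + r u ^ 2 ≤ x t ^ 2 + r t ^ 2 :=
  le_of_forall_hasDerivAt_nonpos (φ := fun t => x t ^ 2 + r t ^ 2) htu
    (fun v hv => (ha.solves v ⟨ht.trans hv.1, hv.2.trans hu⟩).hasDerivAt_sq)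
    fun v hv => by
      linarith [ha.radial_nonpos h hb (t := v) ⟨ht.trans hv.1.le, hv.2.le.trans hu⟩]

theorem sq_le (h : Admissible n f m M) (ha : IsEarlyArc n f b R T x r θ)
    (hb : 40 * n ≤ m * b ^ 2) {t : ℝ} (ht : t ∈ Icc 0 T) : x t ^ 2 + r t ^ 2 ≤ R ^ 2 := by
  have := ha.sq_antitone h hb le_rfl ht.1 ht.2
  rwa [ha.x_zero, ha.r_zero, zero_pow two_ne_zero, zero_add] at this

theorem angleSpeed_le (h : Admissible n f m M) (ha : IsEarlyArc n f b R T x r θ)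
    (hb : 40 * n ≤ m * b ^ 2) {t : ℝ} (ht : t ∈ Icc 0 T) :
    angleSpeed n f (x t) (r t) (θ t) ≤ -(m / 4 * supportPart (x t) (r t) (θ t)) := by
  have hs := (ha.solves t ht).sq_pos
  have hr := (ha.solves t ht).r_pos
  have e1 := cos_mul_sq (x t) (r t) (θ t)
  have hxB := mul_nonpos_of_nonneg_of_nonpos (ha.x_nonneg ht) (ha.radial_nonpos h hb ht)
  have hp := ha.support_nonneg t ht
  have hsq := ha.sq_ge t ht
  have hg := (h.bound _ hs).1
  have hn := h.two_le_cast
  have hm := h.m_pos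
  rw [angleSpeed_eq]
  generalize supportPart (x t) (r t) (θ t) = p at *
  generalize x t ^ 2 + r t ^ 2 = s at *
  have hc : Real.cos (θ t) / r t ≤ p / s := by
    rw [div_le_div_iff₀ hr hs]; linarith
  have h1 : ((n : ℝ) - 1) * (p / s) ≤ m / 4 * p := by
    rw [← mul_div_assoc, div_le_iff₀ hs]
    have : (n : ℝ) - 1 ≤ m / 4 * s := by nlinarith
    nlinarith
  have h2 : ((n : ℝ) - 1) * (Real.cos (θ t) / r t) ≤ ((n : ℝ) - 1) * (p / s) :=
    mul_le_mul_of_nonneg_left hc (by linarith)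
  have h3 : m / 2 * p ≤ deriv f s / 2 * p := mul_le_mul_of_nonneg_right (by linarith) hp
  rw [mul_div_assoc]
  linarith

theorem theta_antitone (h : Admissible n f m M) (ha : IsEarlyArc n f b R T x r θ)
    (hb : 40 * n ≤ m * b ^ 2) {t u : ℝ} (ht : 0 ≤ t) (htu : t ≤ u) (hu : u ≤ T) : θ u ≤ θ t :=
  le_of_forall_hasDerivAt_nonpos htu
    (fun v hv => (ha.solves v ⟨ht.trans hv.1, hv.2.trans hu⟩).theta_deriv)
    fun v hv => by
      have hv' : v ∈ Icc 0 T := ⟨ht.trans hv.1.le, hv.2.le.trans hu⟩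
      have := mul_nonneg h.m_pos.le (ha.support_nonneg v hv')
      linarith [ha.angleSpeed_le h hb hv']

/-- Where `θ = -π`, the support function is negative. -/
theorem neg_pi_lt (ha : IsEarlyArc n f b R T x r θ) {t : ℝ} (ht : t ∈ Icc 0 T) :
    -Real.pi < θ t := by
  by_contra hcon
  push Not at hcon
  obtain ⟨u, hu, hu'⟩ := intermediate_value_Icc' ht.1
    (fun v hv => (ha.solves v ⟨hv.1, hv.2.trans ht.2⟩).theta_deriv.continuousAt.continuousWithinAt)
    (show -Real.pi ∈ Icc (θ t) (θ 0) from ⟨hcon, by rw [ha.theta_zero]; linarith [Real.pi_pos]⟩)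
  have huT : u ∈ Icc 0 T := ⟨hu.1, hu.2.trans ht.2⟩
  have h1 := ha.support_nonneg u huT
  have h2 := (ha.solves u huT).r_pos
  simp only [supportPart, hu', Real.cos_neg, Real.cos_pi, Real.sin_neg, Real.sin_pi] at h1
  linarith

/-- The support function decays like a Gaussian in the distance to the origin. -/
theorem support_le (h : Admissible n f m M) (ha : IsEarlyArc n f b R T x r θ)
    (hb : 40 * n ≤ m * b ^ 2) {t : ℝ} (ht : t ∈ Icc 0 T) :
    supportPart (x t) (r t) (θ t) ≤ R * Real.exp (-(m * (R ^ 2 - (x t ^ 2 + r t ^ 2)) / 8)) := by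
  have hmem : ∀ {v}, v ∈ Icc 0 t → v ∈ Icc 0 T := fun hv => ⟨hv.1, hv.2.trans ht.2⟩
  have key := le_of_forall_hasDerivAt_nonpos
    (φ := fun t => supportPart (x t) (r t) (θ t) * Real.exp (-(m / 8) * (x t ^ 2 + r t ^ 2))) ht.1
    (fun v hv => (ha.solves v (hmem hv)).hasDerivAt_supportPart.mul
      (((ha.solves v (hmem hv)).hasDerivAt_sq.const_mul (-(m / 8))).exp))
    (fun v hv => by
      have hv' := hmem (Ioo_subset_Icc_self hv)
      have h1 := ha.angleSpeed_le h hb hv'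
      have h2 := ha.radial_nonpos h hb hv'
      have h3 := mul_nonneg_of_nonpos_of_nonpos h2 (sub_nonpos.2 h1)
      have h4 := Real.exp_pos (-(m / 8) * (x v ^ 2 + r v ^ 2))
      generalize Real.exp (-(m / 8) * (x v ^ 2 + r v ^ 2)) = e at *
      nlinarith)
  have e0 : supportPart (x 0) (r 0) (θ 0) = R := by
    simp [supportPart, ha.x_zero, ha.r_zero, ha.theta_zero]
  have es : x 0 ^ 2 + r 0 ^ 2 = R ^ 2 := by rw [ha.x_zero, ha.r_zero]; ring
  simp only [e0, es] at key
  have h5 := Real.exp_pos (-(m / 8) * (x t ^ 2 + r t ^ 2))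
  rw [show -(m * (R ^ 2 - (x t ^ 2 + r t ^ 2)) / 8) =
    -(m / 8) * R ^ 2 - -(m / 8) * (x t ^ 2 + r t ^ 2) from by ring, Real.exp_sub,
    ← mul_div_assoc, le_div_iff₀ h5]
  exact key

/-- The direction of the position vector hardly changes. Far out, its rotation is controlled by
that of the tangent vector; further in, the support function is exponentially small. -/
theorem div_le (h : Admissible n f m M) (ha : IsEarlyArc n f b R T x r θ)
    (hb : 40 * n ≤ m * b ^ 2) (hb4 : 4 ≤ b) (hR : R * Real.exp (-(m * R ^ 2 / 16)) ≤ 1) {t : ℝ}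
    (ht : t ∈ Icc 0 T) :
    x t / r t ≤ 2 * R ^ 3 * Real.exp (-(m * R ^ 2 / 16)) + 16 * Real.pi / (m * R ^ 2) := by
  have hmem : ∀ {v}, v ∈ Icc 0 t → v ∈ Icc 0 T := fun hv => ⟨hv.1, hv.2.trans ht.2⟩
  have hm := h.m_pos
  have hR0 := ha.radius_pos
  obtain ⟨q, hq⟩ : ∃ q, q = R * Real.exp (-(m * R ^ 2 / 16)) := ⟨_, rfl⟩
  have hq0 : 0 < q := by rw [hq]; positivity
  obtain ⟨c, hc⟩ : ∃ c, c = 16 / (m * R ^ 2) := ⟨_, rfl⟩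
  have hc0 : 0 < c := by rw [hc]; positivity
  have key := le_of_forall_hasDerivAt_nonpos
    (φ := fun t => x t / r t + c * θ t + 2 * q * (x t ^ 2 + r t ^ 2)) ht.1
    (fun v hv => ((ha.solves v (hmem hv)).hasDerivAt_div.add
      ((ha.solves v (hmem hv)).theta_deriv.const_mul c)).add
      ((ha.solves v (hmem hv)).hasDerivAt_sq.const_mul (2 * q)))
    (fun v hv => by
      have hv' := hmem (Ioo_subset_Icc_self hv)
      have h1 := ha.angleSpeed_le h hb hv'
      have h2 := ha.radial_nonpos h hb hv'
      have h3 := ha.support_nonneg v hv'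
      have h4 := ha.sq_le_two_mul hv'
      have h5 := ha.sq_ge v hv'
      have h6 := ha.support_le h hb hv'
      have h7 := radialPart_sq_add_supportPart_sq (x v) (r v) (θ v)
      have hr := (ha.solves v hv').r_pos
      have hr2 : 0 < r v ^ 2 := by positivity
      generalize angleSpeed n f (x v) (r v) (θ v) = w at *
      generalize supportPart (x v) (r v) (θ v) = p at *
      generalize radialPart (x v) (r v) (θ v) = B at *
      generalize x v ^ 2 + r v ^ 2 = s at *
      have h8 : c * w ≤ c * -(m / 4 * p) := mul_le_mul_of_nonneg_left h1 hc0.le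
      have h9 : 0 ≤ c * (m / 4 * p) := by positivity
      rcases le_total (R ^ 2 / 2) s with hfar | hnear
      · have h10 : p / r v ^ 2 ≤ c * (m / 4 * p) := by
          have : c * (m / 4 * p) = p / (R ^ 2 / 4) := by rw [hc]; field_simp; ring
          rw [this]
          exact div_le_div_of_nonneg_left h3 (by positivity) (by linarith)
        have := mul_nonneg hq0.le (neg_nonneg.2 h2)
        linarith
      · have hpq : p ≤ q := by
          refine h6.trans ?_
          rw [hq]
          refine mul_le_mul_of_nonneg_left (Real.exp_le_exp.2 ?_) hR0.le
          nlinarith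
        have h10 : p / r v ^ 2 ≤ q := by
          rw [div_le_iff₀ hr2]
          have : 1 ≤ r v ^ 2 := by nlinarith
          nlinarith
        have hB : B ≤ -1 := by
          by_contra hcon
          push Not at hcon
          have hp1 : p ≤ 1 := by linarith
          nlinarith
        nlinarith)
  have es : x 0 ^ 2 + r 0 ^ 2 = R ^ 2 := by rw [ha.x_zero, ha.r_zero]; ring
  rw [es, ha.x_zero, ha.theta_zero, zero_div, mul_zero, zero_add, zero_add] at key
  have h1 := ha.neg_pi_lt ht
  have h2 : c * -Real.pi ≤ c * θ t := mul_le_mul_of_nonneg_left h1.le hc0.le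
  have h3 : 0 ≤ 2 * q * (x t ^ 2 + r t ^ 2) := by positivity
  have h4 : 2 * R ^ 3 * Real.exp (-(m * R ^ 2 / 16)) = 2 * q * R ^ 2 := by rw [hq]; ring
  have h5 : 16 * Real.pi / (m * R ^ 2) = c * Real.pi := by rw [hc]; ring
  rw [h4, h5]
  linarith

/-- The radial and the support part are bounded by the decrease of the squared distance and of
the angle, and one of them has to be large. -/
theorem length_le (h : Admissible n f m M) (ha : IsEarlyArc n f b R T x r θ)
    (hb : 40 * n ≤ m * b ^ 2) : b * T ≤ R ^ 2 / 2 + 4 / m * Real.pi := by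
  have hm := h.m_pos
  have hc : 0 < 4 / m := by positivity
  have key := le_of_forall_hasDerivAt_nonpos
    (φ := fun t => b * t + (x t ^ 2 + r t ^ 2) / 2 + 4 / m * θ t) ha.pos.le
    (fun v hv => (((hasDerivAt_id v).const_mul b).add
      ((ha.solves v hv).hasDerivAt_sq.div_const 2)).add
      ((ha.solves v hv).theta_deriv.const_mul (4 / m)))
    (fun v hv => by
      have hv' := Ioo_subset_Icc_self hv
      have h1 := mul_le_mul_of_nonneg_left (ha.angleSpeed_le h hb hv') hc.le
      have h2 := ha.radial_nonpos h hb hv'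
      have h3 := ha.support_nonneg v hv'
      have h5 := ha.sq_ge v hv'
      have h7 := radialPart_sq_add_supportPart_sq (x v) (r v) (θ v)
      generalize angleSpeed n f (x v) (r v) (θ v) = w at *
      generalize supportPart (x v) (r v) (θ v) = p at *
      generalize radialPart (x v) (r v) (θ v) = B at *
      have h8 : 4 / m * -(m / 4 * p) = -p := by field_simp
      have h9 : b ≤ p - B := by
        refine abs_le_of_sq_le_sq' (b := p - B) ?_ (by linarith) |>.2
        nlinarith
      linarith)
  have es : x 0 ^ 2 + r 0 ^ 2 = R ^ 2 := by rw [ha.x_zero, ha.r_zero]; ring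
  simp only [es, ha.theta_zero, mul_zero, zero_add, add_zero] at key
  have h1 := mul_le_mul_of_nonneg_left (ha.neg_pi_lt ha.end_mem).le hc.le
  have h2 := (ha.solves T ha.end_mem).sq_pos
  linarith

/-- The curve cannot come close to the origin while the support function is positive: the torque
exerted by the repelling force of the axis of rotation is only polynomially small in `R`, while
the angular momentum `weight * supportPart` is initially exponentially small. -/
theorem sq_end_ne (h : Admissible n f m M) (ha : IsEarlyArc n f b R T x r θ)
    (hb : 40 * n ≤ m * b ^ 2) (hb4 : 4 ≤ b) (hbR : 2 * b + 2 ≤ R)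
    (hW : 8 * ((n - 1) + M) * R ^ 3 * weight n f 0 R <
      3 * ((n : ℝ) - 1) * b * Real.exp (-(f (4 * b ^ 2) / 4))) :
    x T ^ 2 + r T ^ 2 ≠ b ^ 2 := by
  intro hend
  have hn := h.two_le_cast
  have hM : 0 < M := h.m_pos.trans_le h.m_le_M
  have hR0 := ha.radius_pos
  have hrpos : ∀ t ∈ Icc 0 T, 0 < r t := fun t ht => (ha.solves t ht).r_pos
  have hr1 : ∀ t ∈ Icc 0 T, 1 ≤ r t := fun t ht => by
    have h1 := ha.sq_le_two_mul ht
    have h2 := ha.sq_ge t ht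
    have h3 := hrpos t ht
    nlinarith
  have hrR : ∀ t ∈ Icc 0 T, r t ≤ R := fun t ht =>
    (abs_le_of_sq_le_sq' (by linarith [ha.sq_le h hb ht, sq_nonneg (x t)]) hR0.le).2
  have hxR : ∀ t ∈ Icc 0 T, |x t| ≤ R := fun t ht =>
    abs_le_of_sq_le_sq (by linarith [ha.sq_le h hb ht, sq_nonneg (r t)]) hR0.le
  have hlow : ∀ t ∈ Icc 0 T, R - t ≤ r t := by
    intro t ht
    have := le_of_forall_hasDerivAt_nonpos (φ := fun t => -r t - t) ht.1
      (fun v hv => (ha.solves v ⟨hv.1, hv.2.trans ht.2⟩).r_deriv.neg.sub (hasDerivAt_id v))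
      (fun v _ => by linarith [Real.neg_one_le_sin (θ v)])
    simp only [ha.r_zero] at this
    linarith
  -- The rotation of the position vector after a short time.
  obtain ⟨C, hC⟩ : ∃ C, C = ((n : ℝ) - 1) + R * M := ⟨_, rfl⟩
  have hC1 : 1 ≤ C := by have := mul_pos hR0 hM; linarith
  have hCR : C ≤ ((n - 1) + M) * R := by
    have : ((n : ℝ) - 1) * 1 ≤ (n - 1) * R := by gcongr <;> linarith
    linarith
  have ht₀ : 0 < 1 / C := by positivity
  have ht₀1 : 1 / C ≤ 1 := by rw [div_le_one (by linarith)]; exact hC1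
  have hrT : r T ≤ b :=
    (abs_le_of_sq_le_sq' (by linarith [sq_nonneg (x T)]) (by linarith)).2
  have ht₀T : 1 / C ≤ T := by linarith [hlow T ha.end_mem]
  have hmem₀ : ∀ {v}, v ∈ Icc 0 (1 / C) → v ∈ Icc 0 T := fun hv => ⟨hv.1, hv.2.trans ht₀T⟩
  have hx₀ : 1 / C / 2 ≤ x (1 / C) := by
    refine half_le_x_of_angleSpeed_ge (C := C) ht₀.le ha.x_zero ha.theta_zero
      (fun t ht => ha.solves t (hmem₀ ht)) (fun t ht => ?_) (fun t ht => ?_) (by linarith)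
      (by rw [mul_one_div_cancel (by linarith)])
    · rw [← ha.theta_zero]; exact ha.theta_antitone h hb le_rfl ht.1 (hmem₀ ht).2
    · have := h.abs_angleSpeed_le (θ t) one_pos (hr1 t (hmem₀ ht)) (hrR t (hmem₀ ht))
        (hxR t (hmem₀ ht))
      rw [div_one, ← hC] at this
      exact (abs_le.1 this).1
  obtain ⟨v₀, hv₀⟩ : ∃ v₀, v₀ = 1 / (2 * C * R) := ⟨_, rfl⟩
  have hv₀pos : 0 < v₀ := by rw [hv₀]; positivity
  have hv : ∀ t ∈ Icc (1 / C) T, v₀ ≤ x t / r t := by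
    intro t ht
    refine le_trans ?_ (ha.div_monotone ht₀.le ht.1 ht.2)
    have h0 : (1 / C) ∈ Icc 0 T := ⟨ht₀.le, ht₀T⟩
    rw [le_div_iff₀ (hrpos _ h0)]
    calc v₀ * r (1 / C) ≤ v₀ * R := by gcongr; exact hrR _ h0
      _ = 1 / C / 2 := by rw [hv₀]; field_simp
      _ ≤ _ := hx₀
  -- The time at which the curve enters the disc of radius `2 b`. From there on the weight is
  -- bounded below independently of `R`.
  obtain ⟨t₁, ht₁, hst₁⟩ := intermediate_value_Icc' ht₀T
    (f := fun t => x t ^ 2 + r t ^ 2)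
    (fun t ht =>
      (ha.solves t ⟨ht₀.le.trans ht.1, ht.2⟩).hasDerivAt_sq.continuousAt.continuousWithinAt)
    (show 4 * b ^ 2 ∈ Icc (x T ^ 2 + r T ^ 2) (x (1 / C) ^ 2 + r (1 / C) ^ 2) from ⟨by
      rw [hend]; nlinarith, by
      have h1 := hlow (1 / C) ⟨ht₀.le, ht₀T⟩
      nlinarith [sq_nonneg (x (1 / C))]⟩)
  have hst₁' : x t₁ ^ 2 + r t₁ ^ 2 = 4 * b ^ 2 := hst₁
  have ht₁0 : 0 ≤ t₁ := ht₀.le.trans ht₁.1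
  have hstart := le_of_forall_hasDerivAt_nonpos
    (φ := fun t => weight n f (x t) (r t) * supportPart (x t) (r t) (θ t)) ht₁0
    (fun u hu => (ha.solves u ⟨hu.1, hu.2.trans ht₁.2⟩).hasDerivAt_weight_mul_supportPart h)
    (fun u hu => by
      have hu' : u ∈ Icc 0 T := ⟨hu.1.le, hu.2.le.trans ht₁.2⟩
      have h1 := ha.x_nonneg hu'
      have h2 := hrpos u hu'
      have h3 := weight_pos n f (x u) (r u)
      have h4 : (0 : ℝ) ≤ n - 1 := by linarith
      rw [neg_nonpos]; positivity)
  -- While `x² + r²` decreases from `4 b²` to `b²`, the angular momentum decreases at least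
  -- `c` times as fast.
  obtain ⟨w₀, hw₀⟩ : ∃ w₀, w₀ = Real.exp (-(f (4 * b ^ 2) / 4)) := ⟨_, rfl⟩
  have hw₀pos : 0 < w₀ := by rw [hw₀]; positivity
  obtain ⟨c, hc⟩ : ∃ c, c = (n - 1) * v₀ * w₀ / (4 * b) := ⟨_, rfl⟩
  have hc0 : 0 < c := by
    have : (0 : ℝ) < n - 1 := by linarith
    rw [hc]; positivity
  have hc4 : 4 * b * c = (n - 1) * w₀ * v₀ := by rw [hc]; field_simp
  have hlast := le_of_forall_hasDerivAt_nonpos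
    (φ := fun t => weight n f (x t) (r t) * supportPart (x t) (r t) (θ t)
      - c * (x t ^ 2 + r t ^ 2)) ht₁.2
    (fun u hu => ((ha.solves u ⟨ht₁0.trans hu.1, hu.2⟩).hasDerivAt_weight_mul_supportPart h).sub
      ((ha.solves u ⟨ht₁0.trans hu.1, hu.2⟩).hasDerivAt_sq.const_mul c))
    (fun u hu => by
      have hu' : u ∈ Icc 0 T := ⟨ht₁0.trans hu.1.le, hu.2.le⟩
      have h1 := hv u ⟨ht₁.1.trans hu.1.le, hu.2.le⟩
      have h2 : x u ^ 2 + r u ^ 2 ≤ 4 * b ^ 2 := hst₁' ▸ ha.sq_antitone h hb ht₁0 hu.1.le hu.2.le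
      have h3 : w₀ ≤ weight n f (x u) (r u) := by
        rw [hw₀, weight, Real.exp_le_exp]
        have e1 := h.monotoneOn (show x u ^ 2 + r u ^ 2 ∈ Ici (0 : ℝ) from
          (ha.solves u hu').sq_pos.le) (show 4 * b ^ 2 ∈ Ici (0 : ℝ) by
            rw [mem_Ici]; positivity) h2
        have e2 : 0 ≤ ((n : ℝ) - 1) * Real.log (r u) :=
          mul_nonneg (by linarith) (Real.log_nonneg (hr1 u hu'))
        linarith
      have h4 : -(2 * b) ≤ radialPart (x u) (r u) (θ u) := by
        refine (abs_le_of_sq_le_sq' ?_ (by linarith)).1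
        have := radialPart_sq_add_supportPart_sq (x u) (r u) (θ u)
        nlinarith [sq_nonneg (supportPart (x u) (r u) (θ u))]
      have h5 : ((n : ℝ) - 1) * w₀ * v₀ ≤ (n - 1) * weight n f (x u) (r u) * (x u / r u) := by
        have : (0 : ℝ) ≤ n - 1 := by linarith
        exact mul_le_mul (mul_le_mul_of_nonneg_left h3 this) h1 hv₀pos.le
          (mul_nonneg this (weight_pos n f (x u) (r u)).le)
      have h6 := mul_le_mul_of_nonneg_left h4 hc0.le
      linarith)
  have h0 := mul_nonneg (weight_pos n f (x T) (r T)).le (ha.support_nonneg T ha.end_mem)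
  have e0 : supportPart 0 R 0 = R := by simp [supportPart]
  simp only [ha.x_zero, ha.r_zero, ha.theta_zero, e0] at hstart
  simp only [hend, hst₁'] at hlast
  have h1 : 3 * (c * b ^ 2) ≤ weight n f 0 R * R := by linarith
  have h2 : c * b ^ 2 * (8 * C * R) = (n - 1) * b * w₀ := by
    rw [hc, hv₀]; field_simp; ring
  have h3 : weight n f 0 R * R * (8 * C * R) ≤ 8 * ((n - 1) + M) * R ^ 3 * weight n f 0 R := by
    have := mul_le_mul_of_nonneg_left hCR (by
      have := weight_pos n f 0 R
      positivity : 0 ≤ 8 * R ^ 2 * weight n f 0 R)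
    linarith
  have h4 : 3 * (c * b ^ 2) * (8 * C * R) ≤ weight n f 0 R * R * (8 * C * R) := by gcongr
  rw [← hw₀] at hW
  linarith

end IsEarlyArc

theorem tendsto_pow_mul_exp_neg_mul_sq {c : ℝ} (hc : 0 < c) (k : ℕ) :
    Tendsto (fun R : ℝ => R ^ k * Real.exp (-(c * R ^ 2))) atTop (𝓝 0) := by
  have h1 := tendsto_rpow_mul_exp_neg_mul_atTop_nhds_zero k c hc
  refine squeeze_zero' (g := fun R : ℝ => R ^ (k : ℝ) * Real.exp (-c * R)) ?_ ?_ h1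
  · filter_upwards [eventually_ge_atTop 0] with R hR
    positivity
  · filter_upwards [eventually_ge_atTop 1] with R hR
    rw [Real.rpow_natCast]
    refine mul_le_mul_of_nonneg_left (Real.exp_le_exp.2 ?_) (by positivity)
    have := mul_le_mul_of_nonneg_left (le_self_pow₀ hR two_ne_zero) hc.le
    linarith

theorem Admissible.tendsto_pow_mul_weight {n : ℕ} {f : ℝ → ℝ} {m M : ℝ} (h : Admissible n f m M)
    (k : ℕ) : Tendsto (fun R : ℝ => R ^ k * weight n f 0 R) atTop (𝓝 0) := by
  have hm := h.m_pos
  have h1 := (tendsto_pow_mul_exp_neg_mul_sq (c := m / 4) (by positivity)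
    (k + (n - 1))).mul_const (Real.exp (-(f 0 / 4)))
  rw [zero_mul] at h1
  refine squeeze_zero' ?_ ?_ h1
  · filter_upwards [eventually_ge_atTop 0] with R hR
    have := weight_pos n f 0 R
    positivity
  · filter_upwards [eventually_gt_atTop 0] with R hR
    have e1 : Real.exp (((n : ℝ) - 1) * Real.log R) = R ^ (n - 1) := by
      rw [← Nat.cast_pred (by linarith [h.two_le]), mul_comm, Real.exp_mul, Real.exp_log hR,
        Real.rpow_natCast]
    have e2 := h.add_mul_le (sq_nonneg R)
    rw [pow_add, mul_assoc, mul_assoc]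
    refine mul_le_mul_of_nonneg_left ?_ (by positivity)
    rw [weight, ← e1, ← Real.exp_add, ← Real.exp_add, Real.exp_le_exp, zero_pow two_ne_zero,
      zero_add]
    linarith

/-- Curves starting far away from the origin reach a point at which the position vector is
tangential, outside of a given disc and close to the `r`-axis. -/
theorem Admissible.exists_isEarlyArc {n : ℕ} {f : ℝ → ℝ} {m M : ℝ} (h : Admissible n f m M)
    {b ε : ℝ} (hb : 40 * n ≤ m * b ^ 2) (hb4 : 4 ≤ b) (hε : 0 < ε) (hε1 : ε < 1) :
    ∀ᶠ R in atTop, ∀ (δ : ℝ) (Y : ℝ → ℝ × ℝ × ℝ), 0 < δ → δ ≤ 1 →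
      IsTruncatedSolution n f δ (R + 1) Y R → ∃ τ,
        IsEarlyArc n f b R τ (fun t => (Y t).1) (fun t => (Y t).2.1) (fun t => (Y t).2.2) ∧
        supportPart (Y τ).1 (Y τ).2.1 (Y τ).2.2 = 0 ∧ (Y τ).1 / (Y τ).2.1 ≤ ε := by
  have hm := h.m_pos
  have hn := h.two_le_cast
  have hM : 0 < M := h.m_pos.trans_le h.m_le_M
  have ev1 : ∀ᶠ R : ℝ in atTop, R * Real.exp (-(m * R ^ 2 / 16)) ≤ 1 := by
    have := tendsto_pow_mul_exp_neg_mul_sq (c := m / 16) (by positivity) 1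
    filter_upwards [this.eventually_le_const one_pos] with R hR
    rwa [pow_one, div_mul_eq_mul_div] at hR
  have ev2 : ∀ᶠ R : ℝ in atTop,
      2 * R ^ 3 * Real.exp (-(m * R ^ 2 / 16)) + 16 * Real.pi / (m * R ^ 2) ≤ ε := by
    have h1 := (tendsto_pow_mul_exp_neg_mul_sq (c := m / 16) (by positivity) 3).const_mul 2
    have h2 : Tendsto (fun R : ℝ => 16 * Real.pi / (m * R ^ 2)) atTop (𝓝 0) :=
      ((tendsto_pow_atTop two_ne_zero).const_mul_atTop hm).const_div_atTop _
    have h3 := h1.add h2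
    rw [mul_zero, add_zero] at h3
    filter_upwards [h3.eventually_le_const hε] with R hR
    rwa [← mul_assoc, div_mul_eq_mul_div] at hR
  have ev3 : ∀ᶠ R : ℝ in atTop, 8 * ((n - 1) + M) * R ^ 3 * weight n f 0 R <
      3 * ((n : ℝ) - 1) * b * Real.exp (-(f (4 * b ^ 2) / 4)) := by
    have h1 := (h.tendsto_pow_mul_weight 3).const_mul (8 * (((n : ℝ) - 1) + M))
    rw [mul_zero] at h1
    have h2 : 0 < 3 * ((n : ℝ) - 1) * b * Real.exp (-(f (4 * b ^ 2) / 4)) := by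
      have : (0 : ℝ) < n - 1 := by linarith
      positivity
    filter_upwards [h1.eventually_lt_const h2] with R hR
    rwa [← mul_assoc] at hR
  filter_upwards [ev1, ev2, ev3, eventually_ge_atTop (2 * b + 2)] with R hR1 hR2 hR3 hbR
  intro δ Y hδ hδ1 hY
  have hR0 : 0 < R := by linarith
  let U : Set (ℝ × ℝ × ℝ) := {y | 0 < supportPart y.1 y.2.1 y.2.2 ∧ b ^ 2 < y.1 ^ 2 + y.2.1 ^ 2 ∧
    y.1 ^ 2 + y.2.1 ^ 2 < (R + 1) ^ 2 ∧ y.1 < y.2.1 ∧ 1 < y.2.1}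
  let V : Set (ℝ × ℝ × ℝ) := {y | 0 ≤ supportPart y.1 y.2.1 y.2.2 ∧ b ^ 2 ≤ y.1 ^ 2 + y.2.1 ^ 2 ∧
    y.1 ^ 2 + y.2.1 ^ 2 ≤ (R + 1) ^ 2 ∧ y.1 ≤ y.2.1 ∧ 1 ≤ y.2.1}
  have hcont := continuous_supportPart
  have hU : IsOpen U := by
    refine (isOpen_lt ?_ ?_).and ((isOpen_lt ?_ ?_).and ((isOpen_lt ?_ ?_).and
      ((isOpen_lt ?_ ?_).and (isOpen_lt ?_ ?_)))) <;> fun_prop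
  have hV : IsClosed V := by
    refine (isClosed_le ?_ ?_).and ((isClosed_le ?_ ?_).and ((isClosed_le ?_ ?_).and
      ((isClosed_le ?_ ?_).and (isClosed_le ?_ ?_)))) <;> fun_prop
  have hUV : U ⊆ V := fun y hy =>
    ⟨hy.1.le, hy.2.1.le, hy.2.2.1.le, hy.2.2.2.1.le, hy.2.2.2.2.le⟩
  have hmk : ∀ {τ}, 0 < τ → (∀ t ∈ Ico 0 τ, Y t ∈ U) → Y τ ∈ V →
      IsEarlyArc n f b R τ (fun t => (Y t).1) (fun t => (Y t).2.1) (fun t => (Y t).2.2) := by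
    intro τ hτ hbefore hτV
    have hall : ∀ t ∈ Icc 0 τ, Y t ∈ V := fun t ht => by
      rcases ht.2.eq_or_lt with h1 | h1
      · rw [h1]; exact hτV
      · exact hUV (hbefore t ⟨ht.1, h1⟩)
    refine ⟨hτ, by rw [hY.init], by rw [hY.init], by rw [hY.init], fun t ht => ?_,
      fun t ht => (hbefore t ht).1, fun t ht => (hall t ht).1, fun t ht => (hall t ht).2.1,
      fun t ht => (hall t ht).2.2.2.1⟩
    obtain ⟨-, -, h3, -, h5⟩ := hall t ht
    exact hY.solvesAt hδ
      (abs_le_of_sq_le_sq' (by linarith [sq_nonneg (Y t).2.1]) (by linarith))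
      ⟨by linarith, (abs_le_of_sq_le_sq' (by linarith [sq_nonneg (Y t).1]) (by linarith)).2⟩
  have h0U : Y 0 ∈ U := by
    rw [hY.init]
    refine ⟨by simpa [supportPart] using hR0, ?_, ?_, hR0, ?_⟩
    · show b ^ 2 < 0 ^ 2 + R ^ 2
      nlinarith
    · show 0 ^ 2 + R ^ 2 < (R + 1) ^ 2
      nlinarith
    · show 1 < R
      linarith
  obtain ⟨L, hL⟩ : ∃ L, L = (R ^ 2 / 2 + 4 / m * Real.pi) / b + 1 := ⟨_, rfl⟩
  have hL0 : 0 < L := by rw [hL]; positivity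
  obtain ⟨u, hu, huU⟩ : ∃ u ∈ Icc 0 L, Y u ∉ U := by
    by_contra hcon
    push Not at hcon
    have h1 := (hmk hL0 (fun t ht => hcon t (Ico_subset_Icc_self ht))
      (hUV (hcon L (right_mem_Icc.2 hL0.le)))).length_le h hb
    have h2 : b * L = R ^ 2 / 2 + 4 / m * Real.pi + b := by
      rw [hL]; field_simp
    linarith
  obtain ⟨τ, hτ, hτU, hτcl, hbefore⟩ := exists_first_exit hY.continuous hU hu.1 h0U huU
  have hτV : Y τ ∈ V := closure_minimal hUV hV hτcl
  have ha := hmk hτ.1 hbefore hτV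
  have hdiv := (ha.div_le h hb hb4 hR1 ha.end_mem).trans hR2
  refine ⟨τ, ha, ?_, hdiv⟩
  by_contra hp
  have hrpos := (ha.solves τ ha.end_mem).r_pos
  refine hτU ⟨hτV.1.lt_of_ne (Ne.symm hp), hτV.2.1.lt_of_ne
    (ha.sq_end_ne h hb hb4 hbR hR3).symm, ?_, ?_, ?_⟩
  · have := ha.sq_le h hb ha.end_mem
    nlinarith
  · have := hdiv.trans_lt hε1
    rwa [div_lt_one hrpos] at this
  · have h1 := ha.sq_le_two_mul ha.end_mem
    have h2 := ha.sq_ge τ ha.end_mem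
    have h3 : 0 < (Y τ).2.1 := hrpos
    nlinarith

/-! ### The second part of a curve starting far away from the origin -/

/-- A descending arc in the quadrant `x > 0`, `r > 0` starting at a point where the position
vector is tangential, with slope `x / r ≤ ε`. -/
structure IsLateArc (n : ℕ) (f : ℝ → ℝ) (ε a b : ℝ) (x r θ : ℝ → ℝ) : Prop where
  lt : a < b
  solves : ∀ t ∈ Icc a b, SolvesAt n f x r θ t
  x_pos : ∀ t ∈ Ico a b, 0 < x t
  x_nonneg : ∀ t ∈ Icc a b, 0 ≤ x t
  sin_nonpos : ∀ t ∈ Icc a b, Real.sin (θ t) ≤ 0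
  support_start : supportPart (x a) (r a) (θ a) = 0
  radial_start : radialPart (x a) (r a) (θ a) < 0
  div_start : x a / r a ≤ ε

namespace IsLateArc

variable {n : ℕ} {f : ℝ → ℝ} {m M ε a b c d : ℝ} {x r θ : ℝ → ℝ}

theorem start_mem (ha : IsLateArc n f ε a b x r θ) : a ∈ Icc a b := left_mem_Icc.2 ha.lt.le

theorem r_antitone (ha : IsLateArc n f ε a b x r θ) {t u : ℝ} (ht : a ≤ t) (htu : t ≤ u)
    (hu : u ≤ b) : r u ≤ r t :=
  le_of_forall_hasDerivAt_nonpos htu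
    (fun v hv => (ha.solves v ⟨ht.trans hv.1, hv.2.trans hu⟩).r_deriv)
    fun v hv => ha.sin_nonpos v ⟨ht.trans hv.1.le, hv.2.le.trans hu⟩

theorem support_nonpos (h : Admissible n f m M) (ha : IsLateArc n f ε a b x r θ) {t : ℝ}
    (ht : t ∈ Icc a b) : supportPart (x t) (r t) (θ t) ≤ 0 := by
  have hn := h.two_le_cast
  have key := le_of_forall_hasDerivAt_nonpos
    (φ := fun t => weight n f (x t) (r t) * supportPart (x t) (r t) (θ t)) ht.1
    (fun u hu => (ha.solves u ⟨hu.1, hu.2.trans ht.2⟩).hasDerivAt_weight_mul_supportPart h)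
    (fun u hu => by
      have hu' : u ∈ Icc a b := ⟨hu.1.le, hu.2.le.trans ht.2⟩
      have h1 := ha.x_nonneg u hu'
      have h2 := (ha.solves u hu').r_pos
      have h3 := weight_pos n f (x u) (r u)
      have h4 : (0 : ℝ) ≤ n - 1 := by linarith
      rw [neg_nonpos]; positivity)
  simp only [ha.support_start, mul_zero] at key
  exact nonpos_of_mul_nonpos_right key (weight_pos n f (x t) (r t))

theorem cos_start (ha : IsLateArc n f ε a b x r θ) : Real.cos (θ a) < 0 := by
  have h1 := cos_mul_sq (x a) (r a) (θ a)
  rw [ha.support_start, mul_zero, zero_add] at h1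
  have h2 := mul_neg_of_pos_of_neg (ha.x_pos a ⟨le_rfl, ha.lt⟩) ha.radial_start
  rw [← h1] at h2
  exact neg_of_mul_neg_left h2 (ha.solves a ha.start_mem).sq_pos.le

theorem weight_mul_cos_antitone (h : Admissible n f m M) (ha : IsLateArc n f ε a b x r θ)
    {t u : ℝ} (ht : a ≤ t) (htu : t ≤ u) (hu : u ≤ b) :
    weight n f (x u) (r u) * Real.cos (θ u) ≤ weight n f (x t) (r t) * Real.cos (θ t) :=
  le_of_forall_hasDerivAt_nonpos
    (φ := fun t => weight n f (x t) (r t) * Real.cos (θ t)) htu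
    (fun v hv => (ha.solves v ⟨ht.trans hv.1, hv.2.trans hu⟩).hasDerivAt_weight_mul_cos h)
    (fun v hv => by
      have hv' : v ∈ Icc a b := ⟨ht.trans hv.1.le, hv.2.le.trans hu⟩
      have h1 := ha.x_nonneg v hv'
      have h2 := h.deriv_pos (ha.solves v hv').sq_pos
      have h3 := weight_pos n f (x v) (r v)
      rw [neg_nonpos]; positivity)

theorem cos_neg (h : Admissible n f m M) (ha : IsLateArc n f ε a b x r θ) {t : ℝ}
    (ht : t ∈ Icc a b) : Real.cos (θ t) < 0 := by
  have h1 := ha.weight_mul_cos_antitone h le_rfl ht.1 ht.2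
  have h2 := mul_neg_of_pos_of_neg (weight_pos n f (x a) (r a)) ha.cos_start
  exact neg_of_mul_neg_right (h1.trans_lt h2) (weight_pos n f (x t) (r t)).le

theorem x_antitone (h : Admissible n f m M) (ha : IsLateArc n f ε a b x r θ) {t : ℝ}
    (ht : t ∈ Icc a b) : x t ≤ x a :=
  le_of_forall_hasDerivAt_nonpos ht.1
    (fun v hv => (ha.solves v ⟨hv.1, hv.2.trans ht.2⟩).x_deriv)
    fun v hv => (ha.cos_neg h (t := v) ⟨hv.1.le, hv.2.le.trans ht.2⟩).le

theorem div_le (h : Admissible n f m M) (ha : IsLateArc n f ε a b x r θ) {t : ℝ}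
    (ht : t ∈ Icc a b) : x t / r t ≤ ε := by
  have := le_of_forall_hasDerivAt_nonpos (φ := fun t => x t / r t) ht.1
    (fun v hv => (ha.solves v ⟨hv.1, hv.2.trans ht.2⟩).hasDerivAt_div)
    (fun v hv => div_nonpos_of_nonpos_of_nonneg
      (ha.support_nonpos h ⟨hv.1.le, hv.2.le.trans ht.2⟩) (sq_nonneg _))
  exact this.trans ha.div_start

/-- At height at least `c`, the tangent vector is almost vertical: the quantity
`2 x sin θ - r cos θ` remains negative, because at its zeros it is decreasing. -/
theorem neg_cos_le_of_le_r (h : Admissible n f m M) (ha : IsLateArc n f ε a b x r θ) (hc0 : 0 < c)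
    (hc : 8 * n ≤ m * c ^ 2) {t : ℝ} (ht : t ∈ Icc a b) (hct : c ≤ r t) :
    -Real.cos (θ t) ≤ 2 * ε := by
  have hm := h.m_pos
  have hn := h.two_le_cast
  have hrt := (ha.solves t ht).r_pos
  have hF : -supportPart (x t) (r t) (θ t) + x t * Real.sin (θ t) < 0 := by
    have hstart : -supportPart (x a) (r a) (θ a) + x a * Real.sin (θ a) < 0 := by
      have h1 := sin_mul_sq (x a) (r a) (θ a)
      rw [ha.support_start, mul_zero, sub_zero] at h1
      have h2 := mul_neg_of_pos_of_neg (ha.solves a ha.start_mem).r_pos ha.radial_start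
      rw [← h1] at h2
      rw [ha.support_start, neg_zero, zero_add]
      exact mul_neg_of_pos_of_neg (ha.x_pos a ⟨le_rfl, ha.lt⟩)
        (neg_of_mul_neg_left h2 (ha.solves a ha.start_mem).sq_pos.le)
    rcases ht.1.eq_or_lt with h0 | h0
    · rwa [← h0]
    refine neg_of_hasDerivAt_neg_of_eq_zero
      (φ := fun t => -supportPart (x t) (r t) (θ t) + x t * Real.sin (θ t)) (a := a) (b := t)
      (fun u hu => (ha.solves u ⟨hu.1, hu.2.trans ht.2⟩).hasDerivAt_supportPart.neg.add
        ((ha.solves u ⟨hu.1, hu.2.trans ht.2⟩).x_deriv.mul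
          (ha.solves u ⟨hu.1, hu.2.trans ht.2⟩).theta_deriv.sin)) hstart.le
      (fun u hu hz => ?_) ⟨h0, le_rfl⟩
    have hu' : u ∈ Icc a b := ⟨hu.1, hu.2.trans ht.2⟩
    have hr := (ha.solves u hu').r_pos
    have hcr : c ≤ r u := hct.trans (ha.r_antitone hu.1 hu.2 ht.2)
    have hcos := ha.cos_neg h hu'
    have hg := (h.bound _ (ha.solves u hu').sq_pos).1
    have hp : supportPart (x u) (r u) (θ u) = x u * Real.sin (θ u) := by linarith
    have hx : 0 < x u := by
      refine (ha.x_nonneg u hu').lt_of_ne fun h0 => ?_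
      rw [← h0] at hp
      simp only [supportPart, zero_mul, sub_zero, mul_eq_zero] at hp
      rcases hp with h | h <;> linarith
    have hrc : r u * Real.cos (θ u) = 2 * x u * Real.sin (θ u) := by
      unfold supportPart at hp; linarith
    have hsin : Real.sin (θ u) < 0 := by
      have h1 := mul_neg_of_pos_of_neg hr hcos
      rw [hrc] at h1
      exact neg_of_mul_neg_right h1 (by positivity)
    have hgr : 8 * n ≤ deriv f (x u ^ 2 + r u ^ 2) * r u ^ 2 :=
      hc.trans (mul_le_mul hg (pow_le_pow_left₀ hc0.le hcr 2) (by positivity) (by linarith))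
    have hmr : 8 * n ≤ m * r u ^ 2 :=
      hc.trans (mul_le_mul_of_nonneg_left (pow_le_pow_left₀ hc0.le hcr 2) hm.le)
    have hw : -(m / 4 * x u * Real.sin (θ u)) ≤ angleSpeed n f (x u) (r u) (θ u) := by
      rw [angleSpeed_eq, hp]
      have e1 : ((n : ℝ) - 1) * Real.cos (θ u) / r u =
          ((n : ℝ) - 1) * (2 * x u * Real.sin (θ u)) / r u ^ 2 := by
        rw [← hrc]; field_simp
      have e2 : deriv f (x u ^ 2 + r u ^ 2) / 4 * (x u * Real.sin (θ u)) ≤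
          ((n : ℝ) - 1) * (2 * x u * Real.sin (θ u)) / r u ^ 2 := by
        rw [le_div_iff₀ (by positivity)]
        have := mul_neg_of_pos_of_neg hx hsin
        nlinarith
      have e3 : deriv f (x u ^ 2 + r u ^ 2) * (x u * Real.sin (θ u)) ≤
          m * (x u * Real.sin (θ u)) :=
        mul_le_mul_of_nonpos_right hg (mul_neg_of_pos_of_neg hx hsin).le
      rw [e1]
      linarith
    unfold radialPart
    generalize angleSpeed n f (x u) (r u) (θ u) = w at *
    generalize Real.sin (θ u) = S at *
    generalize Real.cos (θ u) = C at *
    have key : r u * (- -((x u * C + r u * S) * w) + (C * S + x u * (C * w))) < 0 := by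
      have e1 : r u * (- -((x u * C + r u * S) * w) + (C * S + x u * (C * w))) =
          w * (S * (4 * x u ^ 2 + r u ^ 2)) + 2 * x u * S ^ 2 := by
        linear_combination (2 * x u * w + S) * hrc
      have e2 : w * (S * (4 * x u ^ 2 + r u ^ 2)) ≤
          -(m / 4 * x u * S) * (S * (4 * x u ^ 2 + r u ^ 2)) :=
        mul_le_mul_of_nonpos_right hw (mul_nonpos_of_nonpos_of_nonneg hsin.le (by positivity))
      have e3 : 0 < x u * S ^ 2 := mul_pos hx (sq_pos_of_neg hsin)
      have e4 : 0 ≤ m * x u ^ 2 * (x u * S ^ 2) := by positivity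
      have e5 := mul_le_mul_of_nonneg_right hmr e3.le
      nlinarith
    exact neg_of_mul_neg_right key hr.le
  have h1 := ha.div_le h ht
  rw [div_le_iff₀ hrt] at h1
  have h2 := mul_le_mul_of_nonneg_left (Real.neg_one_le_sin (θ t)) (ha.x_nonneg t ht)
  have h3 : r t * -Real.cos (θ t) ≤ r t * (2 * ε) := by
    unfold supportPart at hF; linarith
  exact le_of_mul_le_mul_left h3 hrt

/-- Further down, the repelling force of the axis can tilt the tangent vector only by a factor
that is controlled by the change of the height. -/
theorem pow_mul_cos_monotone (h : Admissible n f m M) (ha : IsLateArc n f ε a b x r θ)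
    {t u : ℝ} (ht : a ≤ t) (htu : t ≤ u) (hu : u ≤ b) :
    Real.exp (((n : ℝ) - 1) * Real.log (r t)) * Real.cos (θ t) ≤
      Real.exp (((n : ℝ) - 1) * Real.log (r u)) * Real.cos (θ u) := by
  have hmem : ∀ {v}, v ∈ Icc t u → v ∈ Icc a b := fun hv => ⟨ht.trans hv.1, hv.2.trans hu⟩
  have := le_of_forall_hasDerivAt_nonpos
    (φ := fun t => -(Real.exp (((n : ℝ) - 1) * Real.log (r t)) * Real.cos (θ t))) htu
    (fun v hv => ((((ha.solves v (hmem hv)).r_deriv.log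
      (ha.solves v (hmem hv)).r_pos.ne').const_mul ((n : ℝ) - 1)).exp.mul
      (ha.solves v (hmem hv)).theta_deriv.cos).neg)
    (fun v hv => by
      have hv' := hmem (Ioo_subset_Icc_self hv)
      have h1 := ha.sin_nonpos v hv'
      have h2 := ha.support_nonpos h hv'
      have h3 := h.deriv_pos (ha.solves v hv').sq_pos
      have h4 := mul_nonneg_of_nonpos_of_nonpos h1 h2
      rw [angleSpeed_eq]
      have h5 := Real.exp_pos (((n : ℝ) - 1) * Real.log (r v))
      have h6 := mul_nonneg h5.le (mul_nonneg h3.le h4)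
      have hr := (ha.solves v hv').r_pos
      generalize Real.exp (((n : ℝ) - 1) * Real.log (r v)) = e at *
      rw [neg_nonpos]
      refine (div_nonneg h6 zero_le_two).trans_eq ?_
      ring)
  linarith

theorem exists_r_eq (ha : IsLateArc n f ε a b x r θ) (hca : c ≤ r a) {t : ℝ} (ht : t ∈ Icc a b)
    (htc : r t ≤ c) : ∃ u ∈ Icc a t, r u = c :=
  intermediate_value_Icc' ht.1
    (fun v hv => (ha.solves v ⟨hv.1, hv.2.trans ht.2⟩).r_deriv.continuousAt.continuousWithinAt)
    ⟨htc, hca⟩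

theorem neg_cos_le (h : Admissible n f m M) (ha : IsLateArc n f ε a b x r θ) (hc0 : 0 < c)
    (hc : 8 * n ≤ m * c ^ 2) (hca : c ≤ r a) (hd0 : 0 < d) (hdc : d ≤ c)
    (hε : 4 * ε * Real.exp (((n : ℝ) - 1) * (Real.log c - Real.log d)) ≤ 1) {t : ℝ}
    (ht : t ∈ Icc a b) (hdt : d ≤ r t) : -Real.cos (θ t) ≤ 1 / 2 := by
  have hn := h.two_le_cast
  have hlog := Real.log_le_log hd0 hdc
  have hε0 : 0 ≤ ε := (div_nonneg (ha.x_nonneg t ht) (ha.solves t ht).r_pos.le).trans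
    (ha.div_le h ht)
  rcases le_total c (r t) with h1 | h1
  · have h2 := ha.neg_cos_le_of_le_r h hc0 hc ht h1
    have h3 : 1 ≤ Real.exp (((n : ℝ) - 1) * (Real.log c - Real.log d)) :=
      Real.one_le_exp (mul_nonneg (by linarith) (by linarith))
    nlinarith
  · obtain ⟨u, hu, hu'⟩ := ha.exists_r_eq hca ht h1
    have h2 := ha.neg_cos_le_of_le_r h hc0 hc ⟨hu.1, hu.2.trans ht.2⟩ hu'.ge
    have h3 := ha.pow_mul_cos_monotone h hu.1 hu.2 ht.2
    rw [hu'] at h3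
    have h4 := Real.exp_pos (((n : ℝ) - 1) * Real.log (r t))
    have h5 : Real.exp (((n : ℝ) - 1) * Real.log c) ≤
        Real.exp (((n : ℝ) - 1) * (Real.log c - Real.log d)) *
          Real.exp (((n : ℝ) - 1) * Real.log (r t)) := by
      rw [← Real.exp_add, Real.exp_le_exp]
      have := mul_le_mul_of_nonneg_left (Real.log_le_log hd0 hdt)
        (show (0 : ℝ) ≤ n - 1 by linarith)
      linarith
    have h6 : Real.exp (((n : ℝ) - 1) * Real.log c) * -Real.cos (θ u) ≤
        Real.exp (((n : ℝ) - 1) * Real.log c) * (2 * ε) :=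
      mul_le_mul_of_nonneg_left h2 (Real.exp_pos _).le
    have h7 := mul_le_mul_of_nonneg_right h5 (show 0 ≤ 2 * ε by positivity)
    have h8 := mul_le_mul_of_nonneg_right hε h4.le
    refine le_of_mul_le_mul_left ?_ h4
    linarith

theorem sin_le (h : Admissible n f m M) (ha : IsLateArc n f ε a b x r θ) {t : ℝ}
    (ht : t ∈ Icc a b) (hcos : -Real.cos (θ t) ≤ 1 / 2) : Real.sin (θ t) ≤ -(1 / 2) := by
  have h1 := ha.cos_neg h ht
  have h2 := ha.sin_nonpos t ht
  by_contra hcon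
  push Not at hcon
  nlinarith [Real.sin_sq_add_cos_sq (θ t)]

/-- Between the heights `c` and `d`, the slope of the arc stays bounded below by a quantity of the
order `x / r`, where `x` is the distance to the `r`-axis at height `c`; hence `log c - log d`
cannot be large while `x` remains nonnegative. -/
theorem r_end_ne (h : Admissible n f m M) (ha : IsLateArc n f ε a b x r θ)
    (hca : c ≤ r a) (hd0 : 0 < d) (hε1 : ε ≤ 1)
    {κ : ℝ} (hκ : κ = Real.exp (-((f (2 * c ^ 2) - f 0) / 4)))
    (hdκ : Real.log c - Real.log d = 3 / κ) (hdc : d < c)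
    (hsin : ∀ t ∈ Icc a b, Real.sin (θ t) ≤ -(1 / 2)) : r b ≠ d := by
  intro hend
  have hn := h.two_le_cast
  have hc0 : 0 < c := hd0.trans hdc
  have hκ0 : 0 < κ := by rw [hκ]; positivity
  obtain ⟨u, hu, hru⟩ := ha.exists_r_eq hca (right_mem_Icc.2 ha.lt.le) (hend ▸ hdc.le)
  have hub : u < b := by
    refine hu.2.lt_of_ne fun h0 => ?_
    rw [h0, hend] at hru
    linarith
  have hxu := ha.x_pos u ⟨hu.1, hub⟩
  have hxc : x u ≤ c := by
    have := (ha.div_le h hu).trans hε1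
    rwa [hru, div_le_one hc0] at this
  have hcosu : Real.cos (θ u) ≤ -(x u / (2 * c)) := by
    have h1 := ha.support_nonpos h hu
    rw [hru, supportPart] at h1
    have h2 := mul_le_mul_of_nonneg_left (hsin u hu) hxu.le
    have h3 : c * Real.cos (θ u) ≤ c * -(x u / (2 * c)) := by
      have : c * -(x u / (2 * c)) = x u * -(1 / 2) := by field_simp
      linarith
    exact le_of_mul_le_mul_left h3 hc0
  have hcos : ∀ t ∈ Icc u b, Real.cos (θ t) ≤ -(x u * κ / 2 / r t) := by
    intro t ht
    have ht' : t ∈ Icc a b := ⟨hu.1.trans ht.1, ht.2⟩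
    have hr := (ha.solves t ht').r_pos
    have hrc : r t ≤ c := hru ▸ ha.r_antitone hu.1 ht.1 ht.2
    have h1 := ha.weight_mul_cos_antitone h hu.1 ht.1 ht.2
    have h2 := mul_le_mul_of_nonneg_left hcosu (weight_pos n f (x u) (r u)).le
    have h3 : weight n f (x t) (r t) * (κ / r t) ≤ weight n f (x u) (r u) / c := by
      have e1 : κ / r t = Real.exp (-((f (2 * c ^ 2) - f 0) / 4) - Real.log (r t)) := by
        rw [Real.exp_sub, Real.exp_log hr, hκ]
      have e2 : weight n f (x u) (r u) / c = Real.exp (((n : ℝ) - 1) * Real.log c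
          - f (x u ^ 2 + c ^ 2) / 4 - Real.log c) := by
        rw [Real.exp_sub, Real.exp_log hc0, weight, hru]
      rw [e1, e2, weight, ← Real.exp_add, Real.exp_le_exp]
      have e3 := h.monotoneOn (show (0 : ℝ) ∈ Ici 0 from self_mem_Ici)
        (show x t ^ 2 + r t ^ 2 ∈ Ici (0 : ℝ) from (ha.solves t ht').sq_pos.le)
        (ha.solves t ht').sq_pos.le
      have e4 := h.monotoneOn (show x u ^ 2 + c ^ 2 ∈ Ici (0 : ℝ) by rw [mem_Ici]; positivity)
        (show 2 * c ^ 2 ∈ Ici (0 : ℝ) by rw [mem_Ici]; positivity) (by nlinarith)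
      have e5 := Real.log_le_log hr hrc
      have e6 : 0 ≤ ((n : ℝ) - 1 - 1) * (Real.log c - Real.log (r t)) :=
        mul_nonneg (by linarith) (by linarith)
      linarith
    have h4 := mul_le_mul_of_nonneg_right h3 (show 0 ≤ x u / 2 by positivity)
    refine le_of_mul_le_mul_left ?_ (weight_pos n f (x t) (r t))
    refine h1.trans (h2.trans ?_)
    have e1 : weight n f (x u) (r u) * -(x u / (2 * c)) =
        -(weight n f (x u) (r u) / c * (x u / 2)) := by field_simp
    have e2 : weight n f (x t) (r t) * -(x u * κ / 2 / r t) =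
        -(weight n f (x t) (r t) * (κ / r t) * (x u / 2)) := by field_simp
    rw [e1, e2]
    linarith
  have key := le_of_forall_hasDerivAt_nonpos
    (φ := fun t => x t - x u * κ / 2 * Real.log (r t)) hub.le
    (fun t ht => (ha.solves t ⟨hu.1.trans ht.1, ht.2⟩).x_deriv.sub
      (((ha.solves t ⟨hu.1.trans ht.1, ht.2⟩).r_deriv.log
        (ha.solves t ⟨hu.1.trans ht.1, ht.2⟩).r_pos.ne').const_mul (x u * κ / 2)))
    (fun t ht => by
      have h1 := hcos t (Ioo_subset_Icc_self ht)
      have hr := (ha.solves t ⟨hu.1.trans ht.1.le, ht.2.le⟩).r_pos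
      have h2 : x u * κ / 2 * (-1 / r t) ≤ x u * κ / 2 * (Real.sin (θ t) / r t) := by
        gcongr
        exact Real.neg_one_le_sin _
      have h3 : x u * κ / 2 * (-1 / r t) = -(x u * κ / 2 / r t) := by ring
      linarith)
  simp only [hru, hend] at key
  have h1 : x u * κ / 2 * (Real.log c - Real.log d) = 3 / 2 * x u := by
    rw [hdκ]; field_simp
  have h2 := ha.x_nonneg b (right_mem_Icc.2 ha.lt.le)
  linarith

theorem length_le (ha : IsLateArc n f ε a b x r θ)
    (hsin : ∀ t ∈ Icc a b, Real.sin (θ t) ≤ -(1 / 2)) : b - a < 2 * r a := by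
  have := le_of_forall_hasDerivAt_nonpos (φ := fun t => r t + t / 2) ha.lt.le
    (fun t ht => (ha.solves t ht).r_deriv.add ((hasDerivAt_id t).div_const 2))
    (fun t ht => by linarith [hsin t (Ioo_subset_Icc_self ht)])
  have h1 := (ha.solves b (right_mem_Icc.2 ha.lt.le)).r_pos
  linarith

end IsLateArc

/-- All curves starting sufficiently far away from the origin return to the line `x = 0`. -/
theorem Admissible.exists_forall_returns {n : ℕ} {f : ℝ → ℝ} {m M : ℝ} (h : Admissible n f m M) :
    ∃ R₁, ∀ R > R₁, Returns n f R := by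
  have hm := h.m_pos
  have hn := h.two_le_cast
  have hπ := Real.pi_pos
  obtain ⟨s, hs, hs'⟩ := h.exists_mul_deriv_eq (c := 2 * n) (by linarith)
  obtain ⟨ρ, hρ⟩ : ∃ ρ, ρ = √s := ⟨_, rfl⟩
  have hρ0 : 0 < ρ := by rw [hρ]; positivity
  have hF : ρ ^ 2 * deriv f (ρ ^ 2) = 2 * n := by rw [hρ, Real.sq_sqrt hs.le]; exact hs'
  -- The radius `b` of the disc avoided by the first part, and the heights `c > d`.
  obtain ⟨b, hb⟩ : ∃ b, b = max 4 (40 * n / m) := ⟨_, rfl⟩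
  have hb4 : 4 ≤ b := hb ▸ le_max_left _ _
  have hbn : 40 * n ≤ m * b ^ 2 := by
    have h1 : 40 * n / m ≤ b := hb ▸ le_max_right _ _
    rw [div_le_iff₀ hm] at h1
    nlinarith
  obtain ⟨c, hc⟩ : ∃ c, c = b / 2 := ⟨_, rfl⟩
  have hc0 : 0 < c := by linarith
  have hcn : 8 * n ≤ m * c ^ 2 := by
    have : m * c ^ 2 = m * b ^ 2 / 4 := by rw [hc]; ring
    linarith
  obtain ⟨κ, hκ⟩ : ∃ κ, κ = Real.exp (-((f (2 * c ^ 2) - f 0) / 4)) := ⟨_, rfl⟩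
  have hκ0 : 0 < κ := by rw [hκ]; positivity
  obtain ⟨d, hd⟩ : ∃ d, d = c * Real.exp (-(3 / κ)) := ⟨_, rfl⟩
  have hd0 : 0 < d := by rw [hd]; positivity
  have hdc : d < c := by
    rw [hd]
    refine mul_lt_of_lt_one_right hc0 (Real.exp_lt_one_iff.2 ?_)
    rw [neg_lt_zero]; positivity
  have hdκ : Real.log c - Real.log d = 3 / κ := by
    rw [hd, Real.log_mul hc0.ne' (Real.exp_pos _).ne', Real.log_exp]; ring
  obtain ⟨ε, hε⟩ : ∃ ε, ε = Real.exp (-(((n : ℝ) - 1) * (3 / κ))) / 4 := ⟨_, rfl⟩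
  have hε0 : 0 < ε := by rw [hε]; positivity
  have hε4 : 4 * ε * Real.exp (((n : ℝ) - 1) * (Real.log c - Real.log d)) ≤ 1 := by
    rw [hdκ, hε, mul_div_cancel₀ _ (by norm_num), ← Real.exp_add, neg_add_cancel, Real.exp_zero]
  have hε1 : ε < 1 := by
    have : Real.exp (-(((n : ℝ) - 1) * (3 / κ))) ≤ 1 := by
      rw [Real.exp_le_one_iff, neg_nonpos]
      exact mul_nonneg (by linarith) (by positivity)
    linarith
  obtain ⟨R₀, hR₀⟩ := eventually_atTop.1 (h.exists_isEarlyArc hbn hb4 hε0 hε1)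
  refine ⟨max R₀ (max ρ c), fun R hR => ?_⟩
  have hRR₀ : R₀ ≤ R := (le_max_left _ _).trans hR.le
  have hρR : ρ ≤ R := (le_max_left _ _).trans ((le_max_right _ _).trans hR.le)
  have hcR : c ≤ R := (le_max_right _ _).trans ((le_max_right _ _).trans hR.le)
  have hR0 : 0 < R := hρ0.trans_le hρR
  obtain ⟨δ, hδ⟩ : ∃ δ, δ = min 1 d := ⟨_, rfl⟩
  have hδ0 : 0 < δ := hδ ▸ lt_min one_pos hd0
  have hδ1 : δ ≤ 1 := hδ ▸ min_le_left _ _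
  have hδd : δ ≤ d := hδ ▸ min_le_right _ _
  obtain ⟨Y, hY⟩ := h.exists_isTruncatedSolution hδ0 (show δ ≤ R + 1 by linarith) R
  obtain ⟨τ, ha, hpτ, hvτ⟩ := hR₀ R hRR₀ δ Y hδ0 hδ1 hY
  have hxτ : 0 < (Y τ).1 := ha.x_pos ⟨ha.pos, le_rfl⟩
  have hBτ : radialPart (Y τ).1 (Y τ).2.1 (Y τ).2.2 < 0 := ha.radial_neg h hbn ⟨ha.pos, le_rfl⟩
  have hsqτ := ha.sq_le h hbn ha.end_mem
  have hxτR : (Y τ).1 ≤ R :=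
    (abs_le_of_sq_le_sq' (by linarith [sq_nonneg (Y τ).2.1]) hR0.le).2
  have hrτR : (Y τ).2.1 ≤ R :=
    (abs_le_of_sq_le_sq' (by linarith [sq_nonneg (Y τ).1]) hR0.le).2
  have hrτ0 : 0 < (Y τ).2.1 := (ha.solves τ ha.end_mem).r_pos
  have hcτ : c ≤ (Y τ).2.1 := by
    have h1 := ha.sq_le_two_mul ha.end_mem
    have h2 := ha.sq_ge τ ha.end_mem
    refine (abs_le_of_sq_le_sq' ?_ hrτ0.le).2
    rw [hc]
    linarith [sq_nonneg b]
  let U : Set (ℝ × ℝ × ℝ) := {y | 0 < y.1 ∧ y.1 < R + 1 ∧ d < y.2.1 ∧ y.2.1 < R + 1 ∧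
    -Real.pi < y.2.2 ∧ y.2.2 < 0}
  let V : Set (ℝ × ℝ × ℝ) := {y | 0 ≤ y.1 ∧ y.1 ≤ R + 1 ∧ d ≤ y.2.1 ∧ y.2.1 ≤ R + 1 ∧
    -Real.pi ≤ y.2.2 ∧ y.2.2 ≤ 0}
  have hU : IsOpen U := by
    refine (isOpen_lt ?_ ?_).and ((isOpen_lt ?_ ?_).and ((isOpen_lt ?_ ?_).and
      ((isOpen_lt ?_ ?_).and ((isOpen_lt ?_ ?_).and (isOpen_lt ?_ ?_))))) <;> fun_prop
  have hV : IsClosed V := by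
    refine (isClosed_le ?_ ?_).and ((isClosed_le ?_ ?_).and ((isClosed_le ?_ ?_).and
      ((isClosed_le ?_ ?_).and ((isClosed_le ?_ ?_).and (isClosed_le ?_ ?_))))) <;> fun_prop
  have hUV : U ⊆ V := fun y hy => ⟨hy.1.le, hy.2.1.le, hy.2.2.1.le, hy.2.2.2.1.le,
    hy.2.2.2.2.1.le, hy.2.2.2.2.2.le⟩
  have hτU : Y τ ∈ U := by
    refine ⟨hxτ, by linarith, hdc.trans_le hcτ, by linarith, ha.neg_pi_lt ha.end_mem, ?_⟩
    have h1 := ha.theta_antitone h hbn le_rfl ha.pos.le le_rfl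
    simp only [hY.init] at h1
    refine h1.lt_of_ne fun h0 => ?_
    simp only [supportPart, h0, Real.cos_zero, Real.sin_zero] at hpτ
    linarith
  have hall : ∀ {σ}, (∀ t ∈ Ico τ σ, Y t ∈ U) → Y σ ∈ V → ∀ t ∈ Icc τ σ, Y t ∈ V := by
    intro σ hbefore hσV t ht
    rcases ht.2.eq_or_lt with h1 | h1
    · rw [h1]; exact hσV
    · exact hUV (hbefore t ⟨ht.1, h1⟩)
  have hmk : ∀ {σ}, τ < σ → (∀ t ∈ Ico τ σ, Y t ∈ U) → Y σ ∈ V →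
      IsLateArc n f ε τ σ (fun t => (Y t).1) (fun t => (Y t).2.1) (fun t => (Y t).2.2) := by
    intro σ hτσ hbefore hσV
    refine ⟨hτσ, fun t ht => ?_, fun t ht => (hbefore t ht).1,
      fun t ht => (hall hbefore hσV t ht).1, fun t ht => ?_, hpτ, hBτ, hvτ⟩
    · obtain ⟨h1, h2, h3, h4, -⟩ := hall hbefore hσV t ht
      exact hY.solvesAt hδ0 ⟨by linarith, h2⟩ ⟨by linarith, h4⟩
    · obtain ⟨-, -, -, -, h5, h6⟩ := hall hbefore hσV t ht
      exact Real.sin_nonpos_of_nonpos_of_neg_pi_le h6 h5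
  have hsin : ∀ {σ}, τ < σ → (∀ t ∈ Ico τ σ, Y t ∈ U) → Y σ ∈ V →
      ∀ t ∈ Icc τ σ, Real.sin (Y t).2.2 ≤ -(1 / 2) := by
    intro σ hτσ hbefore hσV t ht
    have hl := hmk hτσ hbefore hσV
    exact hl.sin_le h ht (hl.neg_cos_le h hc0 hcn hcτ hd0 hdc.le hε4 ht
      (hall hbefore hσV t ht).2.2.1)
  obtain ⟨u, hu, huU⟩ : ∃ u ∈ Icc τ (τ + (2 * R + 1)), Y u ∉ U := by
    by_contra hcon
    push Not at hcon
    have hlt : τ < τ + (2 * R + 1) := by linarith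
    have hbef : ∀ t ∈ Ico τ (τ + (2 * R + 1)), Y t ∈ U :=
      fun t ht => hcon t (Ico_subset_Icc_self ht)
    have hfin := hUV (hcon _ (right_mem_Icc.2 hlt.le))
    have := (hmk hlt hbef hfin).length_le (hsin hlt hbef hfin)
    linarith
  obtain ⟨σ, hσ, hσU, hσcl, hbefore⟩ := exists_first_exit hY.continuous hU hu.1 hτU huU
  have hσV : Y σ ∈ V := closure_minimal hUV hV hσcl
  have hl := hmk hσ.1 hbefore hσV
  have hsinσ := hsin hσ.1 hbefore hσV
  have hσmem : σ ∈ Icc τ σ := right_mem_Icc.2 hσ.1.le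
  have hxσ : (Y σ).1 = 0 := by
    by_contra hx
    refine hσU ⟨hσV.1.lt_of_ne (Ne.symm hx), ?_, hσV.2.2.1.lt_of_ne
      (hl.r_end_ne h hcτ hd0 hε1.le hκ hdκ hdc hsinσ).symm, ?_, ?_, ?_⟩
    · have := hl.x_antitone h hσmem
      linarith
    · have := hl.r_antitone le_rfl hσ.1.le le_rfl
      linarith
    · refine hσV.2.2.2.2.1.lt_of_ne fun h0 => ?_
      have := hsinσ σ hσmem
      rw [← h0, Real.sin_neg, Real.sin_pi] at this
      linarith
    · refine hσV.2.2.2.2.2.lt_of_ne fun h0 => ?_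
      have := hsinσ σ hσmem
      rw [h0, Real.sin_zero] at this
      linarith
  refine ⟨σ, _, _, _, (IsInwardArc.isReturningArc (x := fun t => (Y t).1)
    (r := fun t => (Y t).2.1) (θ := fun t => (Y t).2.2) h ?_ hxσ hρ0 hF hρR).1⟩
  have hsplit : ∀ {P : ℝ → Prop}, (∀ t ∈ Icc 0 τ, P t) → (∀ t ∈ Icc τ σ, P t) →
      ∀ t ∈ Icc 0 σ, P t := fun h1 h2 t ht => by
    rcases le_total t τ with h3 | h3
    · exact h1 t ⟨ht.1, h3⟩
    · exact h2 t ⟨h3, ht.2⟩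
  refine
    { pos := ha.pos.trans hσ.1
      x_zero := ha.x_zero
      r_zero := ha.r_zero
      theta_zero := ha.theta_zero
      solves := hsplit ha.solves hl.solves
      x_nonneg := hsplit (fun t ht => ha.x_nonneg ht) hl.x_nonneg
      neg_pi_le := hsplit (fun t ht => (ha.neg_pi_lt ht).le)
        (fun t ht => (hall hbefore hσV t ht).2.2.2.2.1)
      radial_nonpos := hsplit (fun t ht => ha.radial_nonpos h hbn ht) (fun t ht => ?_) }
  exact add_nonpos
    (mul_nonpos_of_nonneg_of_nonpos (hl.x_nonneg t ht) (hl.cos_neg h ht).le)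
    (mul_nonpos_of_nonneg_of_nonpos (hl.solves t ht).r_pos.le (hl.sin_nonpos t ht))

/-! ### The threshold -/

/-- At the infimum `R` of the radii above which all curves return, the curve returns
perpendicularly to the line `x = 0`: otherwise, the nearby curves would return as well. It is
the threshold, as the nearby curves that do not return are stopped off the line `x = 0`. -/
theorem Admissible.exists_isThreshold {n : ℕ} {f : ℝ → ℝ} {m M : ℝ} (h : Admissible n f m M)
    {ρ : ℝ} (hρ : 0 < ρ) (hF : ρ ^ 2 * deriv f (ρ ^ 2) = 2 * n) :
    ∃ (R δ K T : ℝ) (Y : ℝ → ℝ × ℝ × ℝ), IsThreshold n f R ∧ ρ < R ∧ 0 < δ ∧ δ ≤ K ∧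
      IsTruncatedSolution n f δ K Y R ∧
      (∀ t ∈ Icc 0 T, (Y t).1 ∈ Icc (-K) K ∧ (Y t).2.1 ∈ Icc δ K) ∧
      IsReturningArc n f R T (fun t => (Y t).1) (fun t => (Y t).2.1) (fun t => (Y t).2.2) ∧
      (Y T).2.2 = -Real.pi := by
  obtain ⟨R₁, hR₁⟩ := h.exists_forall_returns
  obtain ⟨S, hS⟩ : ∃ S, S = {q : ℝ | ρ ≤ q ∧ ∀ R > q, Returns n f R} := ⟨_, rfl⟩
  have hmem : ∀ {q}, q ∈ S ↔ ρ ≤ q ∧ ∀ R > q, Returns n f R := by rw [hS]; exact Iff.rfl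
  have hne : S.Nonempty := ⟨max R₁ ρ, hmem.2 ⟨le_max_right _ _,
    fun R hR => hR₁ R ((le_max_left _ _).trans_lt hR)⟩⟩
  have hbdd : BddBelow S := ⟨ρ, fun q hq => (hmem.1 hq).1⟩
  obtain ⟨R, hR⟩ : ∃ R, R = sInf S := ⟨_, rfl⟩
  have hρR : ρ ≤ R := hR ▸ le_csInf hne fun q hq => (hmem.1 hq).1
  have hret : ∀ R' > R, Returns n f R' := fun R' hR' => by
    obtain ⟨q, hq, hq'⟩ := exists_lt_of_csInf_lt hne (hR ▸ hR')
    exact (hmem.1 hq).2 R' hq'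
  have hle : ∀ q ∈ S, R ≤ q := fun q hq => hR ▸ csInf_le hbdd hq
  obtain ⟨δ, K, T, Y, hδ, hδK, hY, hbox, ha, hlt⟩ :=
    h.exists_isReturningArc_of_forall_gt hρ hF hρR hret
  have hretR : Returns n f R := ⟨T, _, _, _, ha⟩
  obtain ⟨ε, hε, hnear⟩ := ha.exists_forall_returns_or h hρ hF hlt
  -- All curves above a smaller radius would return.
  have hcontra : ∀ q < R, (∀ R' > q, |R' - R| < ε → Returns n f R') → False := by
    intro q hq hq'
    have hlt' : max q (max ρ (R - ε)) < R := max_lt hq (max_lt hlt (by linarith))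
    refine (hle _ (hmem.2 ⟨(le_max_left _ _).trans (le_max_right _ _), fun R' hR' => ?_⟩)).not_gt
      hlt'
    have h1 : q < R' := (le_max_left _ _).trans_lt hR'
    have h2 : R - ε < R' := ((le_max_right _ _).trans (le_max_right _ _)).trans_lt hR'
    rcases lt_trichotomy R' R with h3 | h3 | h3
    · exact hq' R' h1 (by rw [abs_lt]; constructor <;> linarith)
    · exact h3 ▸ hretR
    · exact hret R' h3
  refine ⟨R, δ, K, T, Y, ⟨⟨hρ.trans hlt, fun R' hR' => (hret R' hR').stopsOnAxis⟩, ?_⟩, hlt, hδ,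
    hδK, hY, hbox, ha, ?_⟩
  · rintro q ⟨-, hq⟩
    by_contra hcon
    push Not at hcon
    exact hcontra q hcon fun R' h1 h2 => ((hnear R' h2).1).resolve_right (not_not.2 (hq R' h1))
  · by_contra hcon
    have hθ : -Real.pi < (Y T).2.2 :=
      (ha.neg_pi_le T (right_mem_Icc.2 ha.pos.le)).lt_of_ne (Ne.symm hcon)
    exact hcontra (R - 1) (by linarith) fun R' _ h2 => (hnear R' h2).2 hθ

/-! ### The closed curve -/

theorem truncatedField_reflect (n : ℕ) (f : ℝ → ℝ) (δ K : ℝ) (y : ℝ × ℝ × ℝ) (hK : -K ≤ K) :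
    truncatedField n f δ K (-y.1, y.2.1, -y.2.2) = ((truncatedField n f δ K y).1,
      -(truncatedField n f δ K y).2.1, (truncatedField n f δ K y).2.2) := by
  have : max (-K) (min K (-y.1)) = -max (-K) (min K y.1) := by
    grind
  simp only [truncatedField, this, Real.cos_neg, Real.sin_neg, angleSpeed]
  refine Prod.ext rfl (Prod.ext rfl ?_)
  simp only [neg_sq]
  ring

theorem truncatedField_add_two_pi (n : ℕ) (f : ℝ → ℝ) (δ K : ℝ) (y : ℝ × ℝ × ℝ) :
    truncatedField n f δ K (y.1, y.2.1, y.2.2 + 2 * Real.pi) = truncatedField n f δ K y := by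
  simp only [truncatedField, Real.cos_add_two_pi, Real.sin_add_two_pi, angleSpeed]

namespace IsTruncatedSolution

variable {n : ℕ} {f : ℝ → ℝ} {m M δ K R T : ℝ} {Y : ℝ → ℝ × ℝ × ℝ}

theorem eq_of_eq (h : Admissible n f m M) (hδ : 0 < δ) (hδK : δ ≤ K)
    (hY : IsTruncatedSolution n f δ K Y R) {Z : ℝ → ℝ × ℝ × ℝ}
    (hZ : ∀ t, HasDerivAt Z (truncatedField n f δ K (Z t)) t) {c : ℝ} (hc : Z c = Y c) (t : ℝ) :
    Z t = Y t := by
  obtain ⟨L, C, hL, -⟩ := h.exists_lipschitzWith_truncatedField (n := n) (f := f) hδ hδK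
  exact eqOn_Ioo_of_lipschitzWith hL (a := min c t - 1) (b := max c t + 1) (c := c)
    ⟨by linarith [min_le_left c t], by linarith [le_max_left c t]⟩ (fun u _ => hZ u)
    (fun u _ => hY.hasDerivAt u) hc
    ⟨by linarith [min_le_right c t], by linarith [le_max_right c t]⟩

theorem reflect (h : Admissible n f m M) (hδ : 0 < δ) (hδK : δ ≤ K)
    (hY : IsTruncatedSolution n f δ K Y R) (t : ℝ) :
    Y (-t) = (-(Y t).1, (Y t).2.1, -(Y t).2.2) := by
  have hneg : ∀ u : ℝ, HasDerivAt (fun t : ℝ => -t) (-1) u := fun u => (hasDerivAt_id u).neg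
  have := hY.eq_of_eq h hδ hδK
    (Z := fun t => (-(Y (-t)).1, (Y (-t)).2.1, -(Y (-t)).2.2)) (c := 0) (fun u => by
      rw [truncatedField_reflect n f δ K (Y (-u)) (by linarith)]
      have h1 := (hY.hasDerivAt_fst (-u)).comp u (hneg u)
      have h2 := (hY.hasDerivAt_snd (-u)).comp u (hneg u)
      have h3 := (hY.hasDerivAt_angle (-u)).comp u (hneg u)
      refine (h1.neg.prodMk (h2.prodMk h3.neg)).congr_deriv ?_
      refine Prod.ext ?_ (Prod.ext ?_ ?_) <;> simp [truncatedField])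
    (by simp [hY.init]) (-t)
  rw [← this]
  simp

theorem add_two_mul (h : Admissible n f m M) (hδ : 0 < δ) (hδK : δ ≤ K)
    (hY : IsTruncatedSolution n f δ K Y R) (hx : (Y T).1 = 0) (hθ : (Y T).2.2 = -Real.pi) (t : ℝ) :
    Y (t + 2 * T) = ((Y t).1, (Y t).2.1, (Y t).2.2 - 2 * Real.pi) := by
  have := hY.eq_of_eq h hδ hδK
    (Z := fun t => ((Y (t + 2 * T)).1, (Y (t + 2 * T)).2.1, (Y (t + 2 * T)).2.2 + 2 * Real.pi))
    (c := -T) (fun u => by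
      rw [truncatedField_add_two_pi]
      have hadd : HasDerivAt (fun t : ℝ => t + 2 * T) 1 u := (hasDerivAt_id u).add_const _
      have h1 := (hY.hasDerivAt_fst (u + 2 * T)).comp u hadd
      have h2 := (hY.hasDerivAt_snd (u + 2 * T)).comp u hadd
      have h3 := (hY.hasDerivAt_angle (u + 2 * T)).comp u hadd
      refine (h1.prodMk (h2.prodMk (h3.add_const (2 * Real.pi)))).congr_deriv ?_
      refine Prod.ext ?_ (Prod.ext ?_ ?_) <;> simp [truncatedField])
    (by
      rw [hY.reflect h hδ hδK T, show -T + 2 * T = T by ring, hx, hθ]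
      refine Prod.ext ?_ (Prod.ext rfl ?_)
      · simp
      · show -Real.pi + 2 * Real.pi = - -Real.pi
        ring) t
  rw [← this]
  simp

end IsTruncatedSolution

/-- A returning arc that meets the line `x = 0` perpendicularly closes up under reflection. -/
theorem IsReturningArc.isClosedEmbeddedReflection {n : ℕ} {f : ℝ → ℝ} {m M : ℝ}
    (h : Admissible n f m M) {δ K R T : ℝ} {Y : ℝ → ℝ × ℝ × ℝ} (hδ : 0 < δ) (hδK : δ ≤ K)
    (hY : IsTruncatedSolution n f δ K Y R)
    (hbox : ∀ t ∈ Icc 0 T, (Y t).1 ∈ Icc (-K) K ∧ (Y t).2.1 ∈ Icc δ K)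
    (ha : IsReturningArc n f R T (fun t => (Y t).1) (fun t => (Y t).2.1) (fun t => (Y t).2.2))
    (hθ : (Y T).2.2 = -Real.pi) :
    IsClosedEmbeddedReflection n f T (fun t => (Y t).1) (fun t => (Y t).2.1) (fun t => (Y t).2.2)
      (fun t => (Y t).1) (fun t => (Y t).2.1) (fun t => (Y t).2.2) := by
  have hT := ha.pos
  have hx : (Y T).1 = 0 := ha.x_end
  have hrefl := hY.reflect h hδ hδK
  have hper := hY.add_two_mul h hδ hδK hx hθ
  have hQ : Function.Periodic (fun t => ((Y t).1, (Y t).2.1)) (2 * T) := fun t => by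
    simp only [hper t]
  have hreduce : ∀ t, ∃ u ∈ Icc 0 T, ((Y t).1, (Y t).2.1) = ((Y u).1, (Y u).2.1) ∨
      ((Y t).1, (Y t).2.1) = (-(Y u).1, (Y u).2.1) := by
    intro t
    obtain ⟨u, hu, hu'⟩ := hQ.exists_mem_Ico (by linarith) t (-T)
    rcases le_total 0 u with h0 | h0
    · exact ⟨u, ⟨h0, by linarith [hu.2]⟩, Or.inl hu'⟩
    · refine ⟨-u, ⟨by linarith, by linarith [hu.1]⟩, Or.inr ?_⟩
      rw [hrefl u, neg_neg]
      exact hu'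
  have hbox' : ∀ t, (Y t).1 ∈ Icc (-K) K ∧ (Y t).2.1 ∈ Icc δ K := by
    intro t
    obtain ⟨u, hu, h1 | h1⟩ := hreduce t <;> rw [Prod.mk.injEq] at h1 <;> rw [h1.1, h1.2]
    · exact hbox u hu
    · obtain ⟨⟨h2, h3⟩, h4⟩ := hbox u hu
      exact ⟨⟨by linarith, by linarith⟩, h4⟩
  have hsol : ∀ t, SolvesAt n f (fun t => (Y t).1) (fun t => (Y t).2.1) (fun t => (Y t).2.2) t :=
    fun t => hY.solvesAt hδ (hbox' t).1 (hbox' t).2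
  have hsin : ∀ t ∈ Ioo 0 T, Real.sin (Y t).2.2 < 0 := by
    intro t ht
    refine Real.sin_neg_of_neg_of_neg_pi_lt
      ((ha.toIsInwardArc.theta_nonpos (Ioo_subset_Icc_self ht)).lt_of_ne fun h0 => ?_)
      (ha.neg_pi_lt t ht)
    exact ha.isStoppedProfile.not_before t ht (Or.inl h0)
  have hanti : ∀ {t u}, 0 ≤ t → t < u → u ≤ T → (Y u).2.1 < (Y t).2.1 := fun ht htu hu =>
    lt_of_forall_hasDerivAt_neg (φ := fun t => (Y t).2.1) htu (fun v _ => hY.hasDerivAt_snd v)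
      fun v hv => hsin v ⟨ht.trans_lt hv.1, hv.2.trans_le hu⟩
  have hinj : ∀ {t u}, t ∈ Icc 0 T → u ∈ Icc 0 T → (Y t).2.1 = (Y u).2.1 → t = u := by
    intro t u ht hu heq
    rcases lt_trichotomy t u with h1 | h1 | h1
    · exact absurd heq (hanti ht.1 h1 hu.2).ne'
    · exact h1
    · exact absurd heq (hanti hu.1 h1 ht.2).ne
  -- The second half of the period.
  have hhalf : ∀ t, Y t = (-(Y (2 * T - t)).1, (Y (2 * T - t)).2.1,
      -(Y (2 * T - t)).2.2 - 2 * Real.pi) := by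
    intro t
    have h1 := hper (-(2 * T - t))
    rw [show -(2 * T - t) + 2 * T = t by ring, hrefl (2 * T - t)] at h1
    exact h1
  have hneg : ∀ t ∈ Ioo T (2 * T), (Y t).1 < 0 := by
    intro t ht
    rw [hhalf t]
    have := ha.x_pos (2 * T - t) ⟨by linarith [ht.2], by linarith [ht.1]⟩
    exact neg_neg_of_pos this
  have hmixed : ∀ {t u}, t ∈ Icc 0 T → u ∈ Ioo T (2 * T) → (Y t).1 = (Y u).1 → False := by
    intro t u ht hu heq
    have h1 : 0 ≤ (Y t).1 := ha.x_nonneg t ht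
    linarith [hneg u hu]
  refine
    { extends_arc := fun t _ => ⟨rfl, rfl, rfl⟩
      pos := fun t => (hsol t).r_pos
      x_deriv := fun t => (hsol t).x_deriv
      r_deriv := fun t => (hsol t).r_deriv
      theta_deriv := fun t => (hsol t).theta_deriv
      reflect := fun t => by simp only [hrefl t, and_self]
      closed := fun t => by simp only [hper t, and_self]
      embedded := ?_
      trace := ?_ }
  · rintro t ht u hu heq
    simp only [Prod.mk.injEq] at heq
    rcases le_or_gt t T with h1 | h1 <;> rcases le_or_gt u T with h2 | h2
    · exact hinj ⟨ht.1, h1⟩ ⟨hu.1, h2⟩ heq.2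
    · exact (hmixed ⟨ht.1, h1⟩ ⟨h2, hu.2⟩ heq.1).elim
    · exact (hmixed ⟨hu.1, h2⟩ ⟨h1, ht.2⟩ heq.1.symm).elim
    · have h3 := heq.2
      rw [hhalf t, hhalf u] at h3
      have := hinj ⟨by linarith [ht.2], by linarith⟩ ⟨by linarith [hu.2], by linarith⟩ h3
      linarith
  · refine Subset.antisymm ?_ (union_subset ?_ ?_)
    · rintro _ ⟨t, rfl⟩
      obtain ⟨u, hu, h1 | h1⟩ := hreduce t
      · exact Or.inl ⟨u, hu, h1.symm⟩
      · exact Or.inr ⟨u, hu, h1.symm⟩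
    · rintro _ ⟨t, -, rfl⟩
      exact ⟨t, rfl⟩
    · rintro _ ⟨t, -, rfl⟩
      exact ⟨-t, by simp only [hrefl t]⟩

theorem mainTheorem2 (n : ℕ) (hn : 2 ≤ n) (f : ℝ → ℝ) (m M : ℝ)
    (hf : ContDiffOn ℝ ∞ f (Set.Ici 0))
    (hconv : ∀ s : ℝ, 0 < s → 0 ≤ deriv (deriv f) s)
    (hm : 0 < m)
    (hbound : ∀ s : ℝ, 0 < s → m ≤ deriv f s ∧ deriv f s ≤ M) :
    ∃ Rs : ℝ, IsThreshold n f Rs ∧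
      (∃ r₀ : ℝ, 0 < r₀ ∧ ((n : ℝ) - 1) / r₀ - r₀ / 2 * deriv f (r₀ ^ 2) = 0 ∧ r₀ ≤ Rs) ∧
      ∃ (t₁ : ℝ) (x r θ : ℝ → ℝ),
        IsStoppedProfile n f Rs t₁ x r θ ∧
        x t₁ = 0 ∧ θ t₁ = -Real.pi ∧ 0 < r t₁ ∧
        ∃ X P Θ : ℝ → ℝ, IsClosedEmbeddedReflection n f t₁ x r θ X P Θ := by
  have h : Admissible n f m M := ⟨hn, hf, hconv, hm, hbound⟩
  have hn2 := h.two_le_cast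
  obtain ⟨s, hs, hs'⟩ := h.exists_mul_deriv_eq (c := 2 * n) (by linarith)
  obtain ⟨s₀, hs₀, hs₀'⟩ := h.exists_mul_deriv_eq (c := 2 * (n - 1)) (by linarith)
  have hss : s₀ ≤ s := (h.strictMonoOn_mul_deriv.le_iff_le hs₀ hs).1 (by
    simp only [hs', hs₀']; linarith)
  have hF : √s ^ 2 * deriv f (√s ^ 2) = 2 * n := by rw [Real.sq_sqrt hs.le]; exact hs'
  obtain ⟨R, δ, K, T, Y, hthr, hlt, hδ, hδK, hY, hbox, ha, hθ⟩ :=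
    h.exists_isThreshold (Real.sqrt_pos.2 hs) hF
  refine ⟨R, hthr, ⟨√s₀, Real.sqrt_pos.2 hs₀, ?_, (Real.sqrt_le_sqrt hss).trans hlt.le⟩, T, _, _, _,
    ha.isStoppedProfile, ha.x_end, hθ, (ha.solves T (right_mem_Icc.2 ha.pos.le)).r_pos, _, _, _,
    ha.isClosedEmbeddedReflection h hδ hδK hY hbox hθ⟩
  have h0 := Real.sqrt_pos.2 hs₀
  rw [Real.sq_sqrt hs₀.le, sub_eq_zero, div_eq_iff h0.ne']
  have h1 : √s₀ * √s₀ = s₀ := Real.mul_self_sqrt hs₀.le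
  linear_combination (-1 / 2 : ℝ) * hs₀' - deriv f s₀ / 2 * h1
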